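/- **Theorem 3.1.** Fix constants $g>0$, $\sigma\le 0$, $c,P_{atm}\in\mathbb R$. Consider a steady stratified water wave that is $2\pi$-periodic in $x$, in the frame moving with the wave speed $c$, over the flat bed $y=0$: a free surface $\eta\in C^2(\mathbb R)$ with $\eta>0$, and a velocity $(u,v)$, a density $\rho>0$ and a pressure $P$, all $2\pi$-periodic in $x$ and of class $C^1$ on $\overline\Omega=\{(x,y): x\in\mathbb R,\ 0\le y\le\eta(x)\}$, such that $$u_x+v_y=0,\qquad (u-c)\rho_x+v\rho_y=0,$$ $$\rho(u-c)u_x+\rho v u_y=-P_x,\qquad \rho(u-c)v_x+\rho v v_y=-P_y-g\rho$$ for $0<y<\eta(x)$, and $$v=0\ \text{ on } y=0,\qquad v=(u-c)\eta_x,\quad P=P_{atm}-\sigma\frac{\eta_{xx}}{(1+\eta_x^2)^{3/2}}\ \text{ on } y=\eta(x).$$ Let $\psi$ be the pseudo-stream function, i.e. the continuous function on $\overline\Omega$ with $\psi_x=-\sqrt\rho\,v$ and $\psi_y=\sqrt\rho\,(u-c)$ inside the fluid and $\psi=0$ on $y=\eta(x)$; write $\psi=-p_0$ on $y=0$. Assume: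 1. there are no stagnation points: $u<c$ on $\overline\Omega$ (equivalently $\psi_y<0$, so that $p_0<0$ and each streamline $\{\psi=-p\}$, $p_0\le p\le 0$, is a graph over the $x$-axis); 2. the streamline density function, i.e. the function $\varrho$ on $[p_0,0]$ with $\rho(x,y)=\varrho(-\psi(x,y))$, is nonincreasing; 3. there is a crest line $x=x_c$ with $-\pi<x_c<\pi$ such that the height of every streamline is nondecreasing in $x$ on $[-\pi,x_c]$ and nonincreasing in $x$ on $[x_c,\pi]$ (the trough lines are $x=\pm\pi$); 4. for every streamline other than the bed there is $\delta>0$ such that its height is strictly increasing on $[-\pi,-\pi+\delta]$ and strictly decreasing on $[\pi-\delta,\pi]$. Then $x_c=0$ and the wave is symmetric about the crest line: for all $(x,y)\in\overline\Omega$, $\eta(-x)=\eta(x)$, and $u,\rho,P,\psi$ take the same value at $(-x,y)$ as at $(x,y)$, while $v(-x,y)=-v(x,y)$. -/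

import Mathlib

/-- The closed fluid domain, in the frame moving with the wave: flat bed `y = 0`, free
surface `y = η x`. -/
def closedFluid (η : ℝ → ℝ) : Set (ℝ × ℝ) :=
  {z | 0 ≤ z.2 ∧ z.2 ≤ η z.1}

/-- The open fluid domain. -/
def openFluid (η : ℝ → ℝ) : Set (ℝ × ℝ) :=
  {z | 0 < z.2 ∧ z.2 < η z.1}

/-- Partial derivative in the horizontal variable. -/
noncomputable def partialX (f : ℝ → ℝ → ℝ) (x y : ℝ) : ℝ :=
  deriv (fun s => f s y) x

/-- Partial derivative in the vertical variable. -/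
noncomputable def partialY (f : ℝ → ℝ → ℝ) (x y : ℝ) : ℝ :=
  deriv (fun s => f x s) y

/-- `f` is continuously differentiable on the fluid domain, up to and including the boundary. -/
def IsC1Up (η : ℝ → ℝ) (f : ℝ → ℝ → ℝ) : Prop :=
  ContDiffOn ℝ 1 (Function.uncurry f) (closedFluid η)

/-- `f` is `2π`-periodic in the horizontal variable on the fluid domain. -/
def IsPeriodicX (η : ℝ → ℝ) (f : ℝ → ℝ → ℝ) : Prop :=
  ∀ x y, (x, y) ∈ closedFluid η → f (x + 2 * Real.pi) y = f x y

/-- A classical `2π`-periodic steady stratified water wave over a flat bed, in the frame moving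
with the wave speed `c`: surface profile `η`, velocity field `(u, v)`, density `ρ` and
pressure `P` solving the Euler equations with gravity `g`, coefficient of surface tension `σ`
and constant atmospheric pressure `Patm`. -/
structure IsSteadyStratifiedWave (g σ c Patm : ℝ) (η : ℝ → ℝ) (u v ρ P : ℝ → ℝ → ℝ) :
    Prop where
  surface_contDiff : ContDiff ℝ 2 η
  u_contDiff : IsC1Up η u
  v_contDiff : IsC1Up η v
  density_contDiff : IsC1Up η ρ
  pressure_contDiff : IsC1Up η P
  surface_periodic : ∀ x, η (x + 2 * Real.pi) = η x
  u_periodic : IsPeriodicX η u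
  v_periodic : IsPeriodicX η v
  density_periodic : IsPeriodicX η ρ
  pressure_periodic : IsPeriodicX η P
  surface_pos : ∀ x, 0 < η x
  density_pos : ∀ x y, (x, y) ∈ closedFluid η → 0 < ρ x y
  incompressible : ∀ x y, (x, y) ∈ openFluid η →
    partialX u x y + partialY v x y = 0
  mass : ∀ x y, (x, y) ∈ openFluid η →
    (u x y - c) * partialX ρ x y + v x y * partialY ρ x y = 0
  momentum_x : ∀ x y, (x, y) ∈ openFluid η →
    ρ x y * (u x y - c) * partialX u x y + ρ x y * v x y * partialY u x y
      = -partialX P x y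
  momentum_y : ∀ x y, (x, y) ∈ openFluid η →
    ρ x y * (u x y - c) * partialX v x y + ρ x y * v x y * partialY v x y
      = -partialY P x y - g * ρ x y
  bed : ∀ x, v x 0 = 0
  kinematic : ∀ x, v x (η x) = (u x (η x) - c) * deriv η x
  dynamic : ∀ x, P x (η x)
    = Patm - σ * (deriv (deriv η) x / (1 + deriv η x ^ 2) ^ (3 / 2 : ℝ))

/-- `ψ` is the relative pseudo-stream function of the flow, `ψ_x = -√ρ v` and
`ψ_y = √ρ (u - c)`, normalized to vanish on the free surface; `p₀` is the relative pseudo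
mass flux, so that `ψ = -p₀` on the bed. -/
structure IsPseudoStreamFunction (c : ℝ) (η : ℝ → ℝ) (u v ρ : ℝ → ℝ → ℝ)
    (ψ : ℝ → ℝ → ℝ) (p₀ : ℝ) : Prop where
  continuousOn : ContinuousOn (Function.uncurry ψ) (closedFluid η)
  deriv_x : ∀ x y, (x, y) ∈ openFluid η →
    HasDerivAt (fun s => ψ s y) (-(Real.sqrt (ρ x y) * v x y)) x
  deriv_y : ∀ x y, (x, y) ∈ openFluid η →
    HasDerivAt (fun s => ψ x s) (Real.sqrt (ρ x y) * (u x y - c)) y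
  surface : ∀ x, ψ x (η x) = 0
  bed : ∀ x, ψ x 0 = -p₀

/-- The streamline `ψ = -p`. -/
def streamline (η : ℝ → ℝ) (ψ : ℝ → ℝ → ℝ) (p : ℝ) : Set (ℝ × ℝ) :=
  {z | z ∈ closedFluid η ∧ ψ z.1 z.2 = -p}

/-- Along the curve `S` the height is nondecreasing on `a ≤ x ≤ b`. -/
def RisesOn (S : Set (ℝ × ℝ)) (a b : ℝ) : Prop :=
  ∀ z₁ ∈ S, ∀ z₂ ∈ S, a ≤ z₁.1 → z₁.1 ≤ z₂.1 → z₂.1 ≤ b → z₁.2 ≤ z₂.2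

/-- Along the curve `S` the height is nonincreasing on `a ≤ x ≤ b`. -/
def FallsOn (S : Set (ℝ × ℝ)) (a b : ℝ) : Prop :=
  ∀ z₁ ∈ S, ∀ z₂ ∈ S, a ≤ z₁.1 → z₁.1 ≤ z₂.1 → z₂.1 ≤ b → z₂.2 ≤ z₁.2

/-- Along the curve `S` the height is strictly increasing on `a ≤ x ≤ b`. -/
def StrictlyRisesOn (S : Set (ℝ × ℝ)) (a b : ℝ) : Prop :=
  ∀ z₁ ∈ S, ∀ z₂ ∈ S, a ≤ z₁.1 → z₁.1 < z₂.1 → z₂.1 ≤ b → z₁.2 < z₂.2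

/-- Along the curve `S` the height is strictly decreasing on `a ≤ x ≤ b`. -/
def StrictlyFallsOn (S : Set (ℝ × ℝ)) (a b : ℝ) : Prop :=
  ∀ z₁ ∈ S, ∀ z₂ ∈ S, a ≤ z₁.1 → z₁.1 < z₂.1 → z₂.1 ≤ b → z₂.2 < z₁.2

/-- Every streamline is monotone between the trough lines `x = ±π` and the crest
line `x = xc`. -/
def StreamlinesMonotone (η : ℝ → ℝ) (ψ : ℝ → ℝ → ℝ) (p₀ xc : ℝ) : Prop :=
  ∀ p ∈ Set.Icc p₀ 0,
    RisesOn (streamline η ψ p) (-Real.pi) xc ∧ FallsOn (streamline η ψ p) xc Real.pi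

/-- Every streamline, except the flat bed `p = p₀`, is strictly monotone near the trough
lines `x = ±π`. -/
def StreamlinesStrictNearTrough (η : ℝ → ℝ) (ψ : ℝ → ℝ → ℝ) (p₀ : ℝ) : Prop :=
  ∀ p ∈ Set.Ioc p₀ 0, ∃ δ > 0,
    StrictlyRisesOn (streamline η ψ p) (-Real.pi) (-Real.pi + δ) ∧
    StrictlyFallsOn (streamline η ψ p) (Real.pi - δ) Real.pi

/-- The wave is symmetric about the vertical line `x = a`: the surface, the horizontal velocity,
the density, the pressure and the pseudo-stream function (hence the family of streamlines)
are even about the line, the vertical velocity is odd. -/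
structure IsSymmetricAbout (a : ℝ) (η : ℝ → ℝ) (u v ρ P ψ : ℝ → ℝ → ℝ) : Prop where
  surface : ∀ x, η (2 * a - x) = η x
  u_even : ∀ x y, (x, y) ∈ closedFluid η → u (2 * a - x) y = u x y
  v_odd : ∀ x y, (x, y) ∈ closedFluid η → v (2 * a - x) y = -v x y
  density_even : ∀ x y, (x, y) ∈ closedFluid η → ρ (2 * a - x) y = ρ x y
  pressure_even : ∀ x y, (x, y) ∈ closedFluid η → P (2 * a - x) y = P x y
  stream_even : ∀ x y, (x, y) ∈ closedFluid η → ψ (2 * a - x) y = ψ x y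

/-! The proof is a moving-plane argument in semi-hodograph variables. Since `u < c`, the map `(x, y)
↦ (q, p) = (x, -ψ)` straightens the fluid into the strip `p₀ ≤ p ≤ 0`, and the wave is encoded in
the height `h(q, p)` of the streamline `ψ = -p` above `x = q`. Density and Bernoulli's total head
depend on `p` alone, so `h` solves `(1 + h_q²) h_pp - 2 h_q h_p h_qp + h_p² h_qq = h_p³ (A(p) h +
B(p))`, with `h = 0` on the bed and a nonlinear condition involving the curvature on `p = 0`
(`exists_heightSystem`).

Both `h(l - s, p)` and `h(l + s, p)`, as functions of `(s, p)`, solve this problem, and their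
difference `w` satisfies a linear inequality `L w ≤ C (|w| + |∇w|)` (`supersol_sub`). No sign of a
zeroth-order coefficient is needed: where `w ≥ 0` is already known, the strong maximum principle and
Hopf's lemma hold regardless (`pos_of_supersol`, `hopf_disc`), and near the edges of `[0, π] × [p₀,
0]` a steep barrier dominates the lower-order terms. At a zero of `w` on the top edge Hopf's lemma
contradicts the boundary condition, because `σ ≤ 0` gives the curvature term the same sign as the
kinetic term (`sub_pos`).

Call `l` admissible if `h(l - s, p) ≤ h(l + s, p)` for `0 ≤ s ≤ π`. Monotonicity makes `l = (x_c -
π)/2` admissible. Admissibility is a closed condition, and it is open as long as the two sides are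
not identical (`eventually_reflectionBelow`): on a compact core strict inequality persists, and the
remaining region is covered by `exists_narrow_comparison`, whose width does not depend on `l`. This
narrow-region estimate does the work of a corner lemma. So `l` can be moved up to `0`. If the two
sides still differed there, some `l > 0` would be admissible, against strict monotonicity near the
trough (`eqOn_reflection`). Hence `h` is even.

If `x_c > 0`, evenness and monotonicity make every streamline flat on `[0, x_c]`, against the strict
inequality for a plane with `l < 0` (`crest_not_pos`); reflecting `q` excludes `x_c < 0`. Finally
`h_q`, `h_p` and the total head determine `v`, `u` and `P` on each streamline. -/

open Set Filter Topology

/-! ### Second-order jets in the plane and the derivative test at a contact point. -/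

/-- The linear form `(a, b)` on the plane. -/
noncomputable def planeForm (a b : ℝ) : ℝ × ℝ →L[ℝ] ℝ :=
  a • ContinuousLinearMap.fst ℝ ℝ ℝ + b • ContinuousLinearMap.snd ℝ ℝ ℝ

@[simp] lemma planeForm_apply (a b : ℝ) (z : ℝ × ℝ) : planeForm a b z = a * z.1 + b * z.2 := by
  simp [planeForm]

lemma planeForm_sub (a b a' b' : ℝ) :
    planeForm a b - planeForm a' b' = planeForm (a - a') (b - b') := by
  ext <;> simp

lemma planeForm_inj {a b a' b' : ℝ} (h : planeForm a b = planeForm a' b') : a = a' ∧ b = b' := by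
  have h1 := congrArg (fun L : ℝ × ℝ →L[ℝ] ℝ => L (1, 0)) h
  have h2 := congrArg (fun L : ℝ × ℝ →L[ℝ] ℝ => L (0, 1)) h
  simpa using And.intro h1 h2

/-- A function of two variables `(q, p)` together with candidates for its partial derivatives
up to order two. -/
structure PlaneJet where
  val : ℝ × ℝ → ℝ
  dq : ℝ × ℝ → ℝ
  dp : ℝ × ℝ → ℝ
  dqq : ℝ × ℝ → ℝ
  dqp : ℝ × ℝ → ℝ
  dpp : ℝ × ℝ → ℝ

namespace PlaneJet

/-- The candidates are the actual derivatives at `z`. -/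
structure ValidAt (J : PlaneJet) (z : ℝ × ℝ) : Prop where
  val : HasFDerivAt J.val (planeForm (J.dq z) (J.dp z)) z
  dq : HasFDerivAt J.dq (planeForm (J.dqq z) (J.dqp z)) z
  dp : HasFDerivAt J.dp (planeForm (J.dqp z) (J.dpp z)) z

/-- The elliptic operator `∂_p² + (a ∂_q + b ∂_p)²` with frozen coefficients. -/
def ellip (J : PlaneJet) (a b : ℝ) (z : ℝ × ℝ) : ℝ :=
  J.dpp z + (a ^ 2 * J.dqq z + 2 * a * b * J.dqp z + b ^ 2 * J.dpp z)

/-- Difference of two jets. -/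
def sub (J K : PlaneJet) : PlaneJet where
  val z := J.val z - K.val z
  dq z := J.dq z - K.dq z
  dp z := J.dp z - K.dp z
  dqq z := J.dqq z - K.dqq z
  dqp z := J.dqp z - K.dqp z
  dpp z := J.dpp z - K.dpp z

lemma ValidAt.sub {J K : PlaneJet} {z : ℝ × ℝ} (hJ : J.ValidAt z) (hK : K.ValidAt z) :
    (J.sub K).ValidAt z where
  val := by
    have := hJ.val.sub hK.val
    rwa [planeForm_sub] at this
  dq := by
    have := hJ.dq.sub hK.dq
    rwa [planeForm_sub] at this
  dp := by
    have := hJ.dp.sub hK.dp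
    rwa [planeForm_sub] at this

lemma ellip_sub (J K : PlaneJet) (a b : ℝ) (z : ℝ × ℝ) :
    (J.sub K).ellip a b z = J.ellip a b z - K.ellip a b z := by
  simp only [ellip, sub]; ring

end PlaneJet

/-- At a local minimum the second derivative is nonnegative. -/
lemma IsLocalMin.deriv_deriv_nonneg {g : ℝ → ℝ} {x : ℝ} (h : IsLocalMin g x)
    (hc : ContinuousAt g x) : 0 ≤ deriv (deriv g) x := by
  by_contra hneg
  have hneg : deriv (deriv g) x < 0 := not_le.mp hneg
  have hmax := isLocalMax_of_deriv_deriv_neg hneg h.deriv_eq_zero hc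
  have hconst : g =ᶠ[𝓝 x] fun _ => g x := by
    filter_upwards [h, hmax] with y h1 h2
    exact le_antisymm h2 h1
  have h2 : deriv g =ᶠ[𝓝 x] fun _ => 0 := by
    have := hconst.deriv
    simpa using this
  rw [h2.deriv_eq] at hneg
  simp at hneg

lemma IsLocalMin.second_deriv_nonneg {g g' : ℝ → ℝ} {g'' x : ℝ} (h : IsLocalMin g x)
    (hg : ∀ᶠ y in 𝓝 x, HasDerivAt g (g' y) y) (hg' : HasDerivAt g' g'' x) : 0 ≤ g'' := by
  have h1 : deriv g =ᶠ[𝓝 x] g' := hg.mono fun y hy => hy.deriv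
  have h2 := h.deriv_deriv_nonneg hg.self_of_nhds.continuousAt
  rwa [h1.deriv_eq, hg'.deriv] at h2

namespace PlaneJet

lemma ValidAt.hasDerivAt_line {f : ℝ × ℝ → ℝ} {a b t : ℝ} {z ξ : ℝ × ℝ}
    (h : HasFDerivAt f (planeForm a b) (z + t • ξ)) :
    HasDerivAt (fun t : ℝ => f (z + t • ξ)) (a * ξ.1 + b * ξ.2) t := by
  have h1 : HasDerivAt (fun t : ℝ => z + t • ξ) ξ t := by
    simpa using ((hasDerivAt_id t).smul_const ξ).const_add z
  have := h.comp_hasDerivAt t h1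
  rw [planeForm_apply] at this
  exact this

/-- The one-variable test applied along the line through `z` in direction `(a, b)`. -/
lemma second_deriv_nonneg_of_isLocalMin {J : PlaneJet} {z : ℝ × ℝ}
    (hJ : ∀ᶠ y in 𝓝 z, J.ValidAt y) (hmin : IsLocalMin J.val z) (a b : ℝ) :
    0 ≤ a ^ 2 * J.dqq z + 2 * a * b * J.dqp z + b ^ 2 * J.dpp z := by
  have hz := hJ.self_of_nhds
  have hcont : ContinuousAt (fun t : ℝ => z + t • (a, b)) 0 := by fun_prop
  have hz0 : z + (0 : ℝ) • (a, b) = z := by simp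
  have ht : Tendsto (fun t : ℝ => z + t • (a, b)) (𝓝 0) (𝓝 z) := by
    have h := hcont.tendsto
    rwa [hz0] at h
  have hm : IsLocalMin (fun t : ℝ => J.val (z + t • (a, b))) 0 := by
    have := ht.eventually hmin
    filter_upwards [this] with t ht
    rwa [hz0]
  have h1 : ∀ᶠ t in 𝓝 (0 : ℝ), HasDerivAt (fun t : ℝ => J.val (z + t • (a, b)))
      (J.dq (z + t • (a, b)) * a + J.dp (z + t • (a, b)) * b) t := by
    filter_upwards [ht.eventually hJ] with t ht
    exact ValidAt.hasDerivAt_line ht.val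
  have h2 : HasDerivAt (fun t : ℝ => J.dq (z + t • (a, b)) * a + J.dp (z + t • (a, b)) * b)
      ((J.dqq z * a + J.dqp z * b) * a + (J.dqp z * a + J.dpp z * b) * b) 0 := by
    have e1 := ValidAt.hasDerivAt_line (f := J.dq) (z := z) (t := 0) (ξ := (a, b))
      (by rw [hz0]; exact hz.dq)
    have e2 := ValidAt.hasDerivAt_line (f := J.dp) (z := z) (t := 0) (ξ := (a, b))
      (by rw [hz0]; exact hz.dp)
    exact (e1.mul_const a).add (e2.mul_const b)
  have := hm.second_deriv_nonneg h1 h2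
  nlinarith [this]

/-- If `K` touches `J` from below at `z`, the first derivatives agree and the elliptic operators
are ordered. -/
lemma touching {J K : PlaneJet} {z : ℝ × ℝ}
    (hJ : ∀ᶠ y in 𝓝 z, J.ValidAt y) (hK : ∀ᶠ y in 𝓝 z, K.ValidAt y)
    (hmin : IsLocalMin (fun y => J.val y - K.val y) z) (a b : ℝ) :
    J.dq z = K.dq z ∧ J.dp z = K.dp z ∧ K.ellip a b z ≤ J.ellip a b z := by
  have hv : ∀ᶠ y in 𝓝 z, (J.sub K).ValidAt y := by
    filter_upwards [hJ, hK] with y h1 h2 using h1.sub h2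
  have hmin' : IsLocalMin (J.sub K).val z := hmin
  have h0 := hmin'.hasFDerivAt_eq_zero hv.self_of_nhds.val
  have h00 : planeForm ((J.sub K).dq z) ((J.sub K).dp z) = planeForm 0 0 := by
    rw [h0]; ext <;> simp
  obtain ⟨h1, h2⟩ := planeForm_inj h00
  -- `ellip` is the sum of the second derivatives along `(0, 1)` and along `(a, b)`.
  have h3 := second_deriv_nonneg_of_isLocalMin hv hmin' 0 1
  have h4 := second_deriv_nonneg_of_isLocalMin hv hmin' a b
  have h5 : 0 ≤ (J.sub K).ellip a b z := by
    simp only [ellip]; linarith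
  rw [ellip_sub] at h5
  simp only [sub] at h1 h2
  exact ⟨by linarith, by linarith, by linarith⟩

end PlaneJet

/-! ### Gaussian barriers and Hopf's lemma on a disc. -/

/-- Squared Euclidean distance in the plane. -/
def sqDist (c z : ℝ × ℝ) : ℝ := (z.1 - c.1) ^ 2 + (z.2 - c.2) ^ 2

lemma sqDist_nonneg (c z : ℝ × ℝ) : 0 ≤ sqDist c z := by unfold sqDist; positivity

lemma continuous_sqDist (c : ℝ × ℝ) : Continuous (sqDist c) := by unfold sqDist; fun_prop

lemma isCompact_sqDist_le (c : ℝ × ℝ) (R : ℝ) : IsCompact {z | sqDist c z ≤ R ^ 2} := by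
  refine Metric.isCompact_of_isClosed_isBounded
    (isClosed_le (continuous_sqDist c) continuous_const) ?_
  refine (Metric.isBounded_closedBall (x := c) (r := |R|)).subset fun z hz => ?_
  have hz : sqDist c z ≤ R ^ 2 := hz
  unfold sqDist at hz
  rw [Metric.mem_closedBall, Prod.dist_eq, Real.dist_eq, Real.dist_eq, max_le_iff]
  exact ⟨sq_le_sq.mp (by nlinarith [sq_nonneg (z.2 - c.2)]),
    sq_le_sq.mp (by nlinarith [sq_nonneg (z.1 - c.1)])⟩

namespace PlaneJet

/-- The function `ε (exp (-α |z - c|²) - exp (-α R²))` used as a barrier. -/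
noncomputable def gaussBarrier (c : ℝ × ℝ) (ε α R : ℝ) : PlaneJet where
  val z := ε * (Real.exp (-α * sqDist c z) - Real.exp (-α * R ^ 2))
  dq z := ε * (Real.exp (-α * sqDist c z) * (-2 * α * (z.1 - c.1)))
  dp z := ε * (Real.exp (-α * sqDist c z) * (-2 * α * (z.2 - c.2)))
  dqq z := ε * (Real.exp (-α * sqDist c z) * (4 * α ^ 2 * (z.1 - c.1) ^ 2 - 2 * α))
  dqp z := ε * (Real.exp (-α * sqDist c z) * (4 * α ^ 2 * (z.1 - c.1) * (z.2 - c.2)))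
  dpp z := ε * (Real.exp (-α * sqDist c z) * (4 * α ^ 2 * (z.2 - c.2) ^ 2 - 2 * α))

lemma hasFDerivAt_exp_sqDist (c : ℝ × ℝ) (α : ℝ) (z : ℝ × ℝ) :
    HasFDerivAt (fun z => Real.exp (-α * sqDist c z))
      (planeForm (Real.exp (-α * sqDist c z) * (-2 * α * (z.1 - c.1)))
        (Real.exp (-α * sqDist c z) * (-2 * α * (z.2 - c.2)))) z := by
  have h1 : HasFDerivAt (fun z : ℝ × ℝ => z.1 - c.1) (ContinuousLinearMap.fst ℝ ℝ ℝ) z :=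
    hasFDerivAt_fst.sub_const _
  have h2 : HasFDerivAt (fun z : ℝ × ℝ => z.2 - c.2) (ContinuousLinearMap.snd ℝ ℝ ℝ) z :=
    hasFDerivAt_snd.sub_const _
  have := (((h1.pow 2).add (h2.pow 2)).const_mul (-α)).exp
  refine this.congr_fderiv ?_
  ext <;> simp [sqDist] <;> ring

lemma gaussBarrier_validAt (c : ℝ × ℝ) (ε α R : ℝ) (z : ℝ × ℝ) :
    (gaussBarrier c ε α R).ValidAt z := by
  have h0 := hasFDerivAt_exp_sqDist c α z
  have h1 : HasFDerivAt (fun z : ℝ × ℝ => -2 * α * (z.1 - c.1)) (planeForm (-2 * α) 0) z := by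
    refine ((hasFDerivAt_fst.sub_const c.1).const_mul (-2 * α)).congr_fderiv ?_
    ext <;> simp
  have h2 : HasFDerivAt (fun z : ℝ × ℝ => -2 * α * (z.2 - c.2)) (planeForm 0 (-2 * α)) z := by
    refine ((hasFDerivAt_snd.sub_const c.2).const_mul (-2 * α)).congr_fderiv ?_
    ext <;> simp
  refine ⟨?_, ?_, ?_⟩
  · refine ((h0.sub_const _).const_mul ε).congr_fderiv ?_
    ext <;> simp [gaussBarrier]
  · refine ((h0.mul h1).const_mul ε).congr_fderiv ?_
    ext <;> simp [gaussBarrier] <;> ring_nf <;> simp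
  · refine ((h0.mul h2).const_mul ε).congr_fderiv ?_
    ext <;> simp [gaussBarrier] <;> ring_nf <;> simp

lemma gaussBarrier_ellip (c : ℝ × ℝ) (ε α R a b : ℝ) (z : ℝ × ℝ) :
    (gaussBarrier c ε α R).ellip a b z = ε * Real.exp (-α * sqDist c z) *
      (4 * α ^ 2 * ((z.2 - c.2) ^ 2 + (a * (z.1 - c.1) + b * (z.2 - c.2)) ^ 2)
        - 2 * α * (1 + a ^ 2 + b ^ 2)) := by
  simp only [ellip, gaussBarrier]; ring

/-- `J` satisfies `L J ≤ C (|J| + |∇J|)` at `z`, where `L` is elliptic with constants `κ`, `N`. -/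
structure Supersol (J : PlaneJet) (κ N C : ℝ) (z : ℝ × ℝ) : Prop where
  valid : J.ValidAt z
  ineq : ∃ a b : ℝ, (∀ x y : ℝ, κ * (x ^ 2 + y ^ 2) ≤ y ^ 2 + (a * x + b * y) ^ 2) ∧
    a ^ 2 + b ^ 2 ≤ N ∧ J.ellip a b z ≤ C * (|J.val z| + |J.dq z| + |J.dp z|)

/-- A barrier touching a supersolution from below violates the strict opposite inequality. -/
lemma Supersol.false_of_touching {J K : PlaneJet} {κ N C : ℝ} {z : ℝ × ℝ}
    (hJ : ∀ᶠ y in 𝓝 z, J.Supersol κ N C y) (hK : ∀ᶠ y in 𝓝 z, K.ValidAt y)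
    (hmin : IsLocalMin (fun y => J.val y - K.val y) z)
    (hbar : ∀ a b : ℝ, (∀ x y : ℝ, κ * (x ^ 2 + y ^ 2) ≤ y ^ 2 + (a * x + b * y) ^ 2) →
      a ^ 2 + b ^ 2 ≤ N → C * (|J.val z| + |K.dq z| + |K.dp z|) < K.ellip a b z) : False := by
  obtain ⟨a, b, h1, h2, h3⟩ := hJ.self_of_nhds.ineq
  obtain ⟨e1, e2, e3⟩ := touching (hJ.mono fun y hy => hy.valid) hK hmin a b
  have := hbar a b h1 h2
  rw [e1, e2] at h3
  linarith

/-- A term quadratic in `α` beats linear ones. On the annulus of radii `R / 2` and `R`, up to a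
common factor, the principal part of the operator on the Gaussian is at least `α² κ R²`; the left
side collects its remaining second-order part and the lower-order terms. -/
lemma exists_barrier_exponent {κ : ℝ} (hκ : 0 < κ) (N C : ℝ) {R : ℝ} (hR : 0 < R) :
    ∃ α : ℝ, 1 ≤ α ∧ α * (2 * (1 + N)) + C * (1 + 4 * α * R) < α ^ 2 * (κ * R ^ 2) := by
  have hd : 0 < κ * R ^ 2 := by positivity
  refine ⟨1 + (2 * (1 + |N|) + |C| * (1 + 4 * R)) / (κ * R ^ 2), ?_, ?_⟩
  · have : 0 ≤ (2 * (1 + |N|) + |C| * (1 + 4 * R)) / (κ * R ^ 2) := by positivity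
    linarith
  · set D := 2 * (1 + |N|) + |C| * (1 + 4 * R) with hD
    have hD0 : 0 ≤ D := by positivity
    set α := 1 + D / (κ * R ^ 2) with hα
    have hα1 : 1 ≤ α := by
      have : 0 ≤ D / (κ * R ^ 2) := by positivity
      linarith
    have h1 : α * (κ * R ^ 2) = κ * R ^ 2 + D := by rw [hα]; field_simp
    have h2 : α ^ 2 * (κ * R ^ 2) = α * (κ * R ^ 2) + α * D := by
      linear_combination α * h1
    have h3 : α * (2 * (1 + N)) ≤ α * (2 * (1 + |N|)) := by
      have := le_abs_self N
      gcongr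
    have h4 : C * (1 + 4 * α * R) ≤ |C| * (α * (1 + 4 * R)) := by
      have h5 : 1 + 4 * α * R ≤ α * (1 + 4 * R) := by nlinarith
      have h6 : 0 ≤ 1 + 4 * α * R := by positivity
      calc C * (1 + 4 * α * R) ≤ |C| * (1 + 4 * α * R) := by
            have := le_abs_self C
            gcongr
        _ ≤ _ := by gcongr
    have h7 : 0 < α * (κ * R ^ 2) := by positivity
    have h8 : α * D = α * (2 * (1 + |N|)) + |C| * (α * (1 + 4 * R)) := by rw [hD]; ring
    linarith

/-- Hopf's boundary point lemma on a disc: a supersolution that is positive in the open disc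
grows at least linearly along the inward normals. -/
lemma hopf_disc {J : PlaneJet} {κ N C R : ℝ} {c : ℝ × ℝ} (hκ : 0 < κ) (hC : 0 ≤ C) (hR : 0 < R)
    (hcont : ContinuousOn J.val {z | sqDist c z ≤ R ^ 2})
    (hsup : ∀ z, sqDist c z < R ^ 2 → J.Supersol κ N C z)
    (hpos : ∀ z, sqDist c z < R ^ 2 → 0 < J.val z)
    (hnonneg : ∀ z, sqDist c z ≤ R ^ 2 → 0 ≤ J.val z) :
    ∃ k > 0, ∀ z, sqDist c z = R ^ 2 → ∀ t ∈ Icc (0 : ℝ) (1 / 2),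
      k * t ≤ J.val (z + t • (c - z)) := by
  obtain ⟨α, hα1, hα⟩ := exists_barrier_exponent hκ N C hR
  have hα0 : 0 < α := by linarith
  have hR2 : (R / 2) ^ 2 < R ^ 2 := by nlinarith
  -- The barrier is scaled by the minimum of `J` on the inner disc, so that it lies below `J` there;
  -- it vanishes on the outer circle.
  obtain ⟨z₀, hz₀, hz₀min⟩ := (isCompact_sqDist_le c (R / 2)).exists_isMinOn
    ⟨c, by simp only [mem_ofPred_eq, sqDist]; nlinarith⟩
    (hcont.mono fun z hz => le_trans hz hR2.le)
  set ε := J.val z₀ with hε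
  have hε0 : 0 < ε := hpos _ (lt_of_le_of_lt hz₀ hR2)
  have hcore : ∀ z, sqDist c z ≤ (R / 2) ^ 2 → ε ≤ J.val z := fun z hz => hz₀min hz
  set K := gaussBarrier c ε α R with hK
  have hKle : ∀ z, K.val z ≤ ε := fun z => by
    have h1 : Real.exp (-α * sqDist c z) ≤ 1 := Real.exp_le_one_iff.mpr (by
      nlinarith [mul_nonneg hα0.le (sqDist_nonneg c z)])
    have h2 := Real.exp_pos (-α * R ^ 2)
    have : ε * (Real.exp (-α * sqDist c z) - Real.exp (-α * R ^ 2)) ≤ ε * 1 :=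
      mul_le_mul_of_nonneg_left (by linarith) hε0.le
    simpa [hK, gaussBarrier] using this
  have hKcont : Continuous K.val := by
    have := continuous_sqDist c
    simp only [hK, gaussBarrier]; fun_prop
  -- A negative minimum of `J - K` over the annulus would lie in its interior, where the barrier
  -- would touch `J` from below up to a constant.
  have hcmp : ∀ z, (R / 2) ^ 2 ≤ sqDist c z → sqDist c z ≤ R ^ 2 → K.val z ≤ J.val z := by
    intro z hz1 hz2
    have hcomp : IsCompact ({z | sqDist c z ≤ R ^ 2} ∩ {z | (R / 2) ^ 2 ≤ sqDist c z}) :=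
      (isCompact_sqDist_le c R).inter_right (isClosed_le continuous_const (continuous_sqDist c))
    obtain ⟨y, hy, hymin⟩ := hcomp.exists_isMinOn ⟨z, hz2, hz1⟩
      ((hcont.mono inter_subset_left).sub hKcont.continuousOn)
    by_contra hlt
    have hy0 : J.val y - K.val y < 0 := by
      have : J.val y - K.val y ≤ J.val z - K.val z := hymin ⟨hz2, hz1⟩
      linarith
    have hyR : sqDist c y < R ^ 2 := by
      refine lt_of_le_of_ne hy.1 fun he => ?_
      have : K.val y = 0 := by simp [hK, gaussBarrier, he]
      have := hnonneg y hy.1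
      linarith
    have hyR2 : (R / 2) ^ 2 < sqDist c y := by
      refine lt_of_le_of_ne hy.2 fun he => ?_
      have := hcore y he.ge
      have := hKle y
      linarith
    have hnb : ∀ᶠ x in 𝓝 y, sqDist c x < R ^ 2 ∧ (R / 2) ^ 2 < sqDist c x :=
      ((continuous_sqDist c).continuousAt.eventually_lt continuousAt_const hyR).and
        (continuousAt_const.eventually_lt (continuous_sqDist c).continuousAt hyR2)
    refine Supersol.false_of_touching (J := J) (K := K) (hnb.mono fun x hx => hsup x hx.1)
      (Eventually.of_forall fun x => gaussBarrier_validAt c ε α R x)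
      (hnb.mono fun x hx => hymin ⟨hx.1.le, hx.2.le⟩) fun a b hab hN => ?_
    rw [hK, gaussBarrier_ellip, ← hK]
    set e := Real.exp (-α * sqDist c y) with he
    have he0 : 0 < e := Real.exp_pos _
    -- At the negative minimum `0 < J < K`, so the zeroth-order term is controlled by the barrier
    -- itself.
    have hJy : |J.val y| ≤ ε * e := by
      rw [abs_of_pos (hpos y hyR)]
      have h1 : K.val y ≤ ε * e := by
        have : K.val y = ε * (e - Real.exp (-α * R ^ 2)) := rfl
        rw [this]
        exact mul_le_mul_of_nonneg_left (by linarith [Real.exp_pos (-α * R ^ 2)]) hε0.le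
      linarith
    have hx : |y.1 - c.1| ≤ R := abs_le_of_sq_le_sq (by
      have := hyR.le; unfold sqDist at this; nlinarith [sq_nonneg (y.2 - c.2)]) hR.le
    have hy' : |y.2 - c.2| ≤ R := abs_le_of_sq_le_sq (by
      have := hyR.le; unfold sqDist at this; nlinarith [sq_nonneg (y.1 - c.1)]) hR.le
    have hKq : |K.dq y| ≤ ε * e * (2 * α * R) := by
      have : K.dq y = ε * (e * (-2 * α * (y.1 - c.1))) := rfl
      rw [this, abs_mul, abs_mul, abs_mul, abs_of_pos hε0, abs_of_pos he0, mul_assoc]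
      have h2 : |-2 * α| = 2 * α := by rw [abs_mul, abs_of_pos hα0]; norm_num
      rw [h2]
      gcongr
    have hKp : |K.dp y| ≤ ε * e * (2 * α * R) := by
      have : K.dp y = ε * (e * (-2 * α * (y.2 - c.2))) := rfl
      rw [this, abs_mul, abs_mul, abs_mul, abs_of_pos hε0, abs_of_pos he0, mul_assoc]
      have h2 : |-2 * α| = 2 * α := by rw [abs_mul, abs_of_pos hα0]; norm_num
      rw [h2]
      gcongr
    have hεe : 0 < ε * e := mul_pos hε0 he0
    have hquad := hab (y.1 - c.1) (y.2 - c.2)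
    have hkr : κ * R ^ 2 ≤ 4 * (κ * ((y.1 - c.1) ^ 2 + (y.2 - c.2) ^ 2)) := by
      have := hyR2.le
      unfold sqDist at this
      nlinarith
    calc C * (|J.val y| + |K.dq y| + |K.dp y|)
        ≤ C * (ε * e + ε * e * (2 * α * R) + ε * e * (2 * α * R)) := by gcongr
      _ = ε * e * (C * (1 + 4 * α * R)) := by ring
      _ < ε * e * (α ^ 2 * (κ * R ^ 2) - α * (2 * (1 + N))) := by
          apply mul_lt_mul_of_pos_left _ hεe; linarith
      _ ≤ _ := by
          apply mul_le_mul_of_nonneg_left _ hεe.le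
          have h3 : α ^ 2 * (κ * R ^ 2) ≤ α ^ 2 * (4 * ((y.2 - c.2) ^ 2 +
              (a * (y.1 - c.1) + b * (y.2 - c.2)) ^ 2)) := by
            apply mul_le_mul_of_nonneg_left _ (by positivity)
            linarith
          have h4 : α * (2 * (1 + a ^ 2 + b ^ 2)) ≤ α * (2 * (1 + N)) := by
            apply mul_le_mul_of_nonneg_left _ hα0.le
            linarith
          linarith
  -- The point `z + t (c - z)` is at distance `(1 - t) R` from the centre, so `t ≤ 1/2` keeps it in
  -- the annulus; there `exp x ≥ 1 + x` and `2t - t² ≥ t` give linear growth.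
  refine ⟨ε * Real.exp (-α * R ^ 2) * (α * R ^ 2), by positivity, fun z hz t ht => ?_⟩
  have hs : sqDist c (z + t • (c - z)) = (1 - t) ^ 2 * R ^ 2 := by
    rw [← hz]; simp [sqDist]; ring
  have ht0 := ht.1
  have ht1 := ht.2
  have ht2 : 1 / 4 ≤ (1 - t) ^ 2 := by nlinarith
  have ht3 : (1 - t) ^ 2 ≤ 1 := by nlinarith
  have h1 := hcmp (z + t • (c - z)) (by rw [hs]; nlinarith [sq_nonneg R])
    (by rw [hs]; nlinarith [sq_nonneg R])
  refine le_trans ?_ h1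
  have h2 : K.val (z + t • (c - z)) = ε * Real.exp (-α * R ^ 2) *
      (Real.exp (α * R ^ 2 * (2 * t - t ^ 2)) - 1) := by
    simp only [hK, gaussBarrier, hs]
    rw [mul_assoc ε, mul_sub (Real.exp _), ← Real.exp_add]
    ring_nf
  rw [h2, mul_assoc (ε * _)]
  apply mul_le_mul_of_nonneg_left _ (by positivity)
  have h3 := Real.add_one_le_exp (α * R ^ 2 * (2 * t - t ^ 2))
  have h4 : α * R ^ 2 * t ≤ α * R ^ 2 * (2 * t - t ^ 2) := by
    apply mul_le_mul_of_nonneg_left _ (by positivity); nlinarith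
  linarith

end PlaneJet

/-! ### The strong maximum principle. -/

lemma HasDerivAt.le_of_le_right {g : ℝ → ℝ} {g' k : ℝ} (hg : HasDerivWithinAt g g' (Ici 0) 0)
    (h : ∀ᶠ t in 𝓝[>] (0 : ℝ), k * t ≤ g t - g 0) : k ≤ g' := by
  have h1 := (hasDerivWithinAt_iff_tendsto_slope' self_notMem_Ioi).mp
    (hg.mono Ioi_subset_Ici_self)
  refine ge_of_tendsto h1 ?_
  filter_upwards [h, self_mem_nhdsWithin] with t ht ht0
  have ht0 : 0 < t := ht0
  rw [slope_def_field, le_div_iff₀ (by linarith)]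
  linarith

namespace PlaneJet

lemma dq_dp_eq_zero_of_isLocalMin {J : PlaneJet} {z : ℝ × ℝ} (hJ : J.ValidAt z)
    (hmin : IsLocalMin J.val z) : J.dq z = 0 ∧ J.dp z = 0 := by
  have h0 := hmin.hasFDerivAt_eq_zero hJ.val
  have h00 : planeForm (J.dq z) (J.dp z) = planeForm 0 0 := by
    rw [h0]; ext <;> simp
  exact planeForm_inj h00

/-- Strong maximum principle for nonnegative supersolutions. -/
lemma pos_of_supersol {J : PlaneJet} {κ N C : ℝ} (hκ : 0 < κ) (hC : 0 ≤ C) {U : Set (ℝ × ℝ)}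
    (hU : IsOpen U) (hconn : IsPreconnected U) (hsup : ∀ z ∈ U, J.Supersol κ N C z)
    (hnonneg : ∀ z ∈ U, 0 ≤ J.val z) (hpos : ∃ z ∈ U, 0 < J.val z) :
    ∀ z ∈ U, 0 < J.val z := by
  have hcontAt : ∀ z ∈ U, ContinuousAt J.val z := fun z hz => (hsup z hz).valid.val.continuousAt
  have hcont : ContinuousOn J.val U := fun z hz => (hcontAt z hz).continuousWithinAt
  set u := U ∩ J.val ⁻¹' Ioi 0 with hu
  have huo : IsOpen u := hcont.isOpen_inter_preimage hU isOpen_Ioi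
  have key : U ⊆ u := by
    obtain ⟨z₀, hz₀, hz₀pos⟩ := hpos
    refine hconn.subset_of_closure_inter_subset huo ⟨z₀, hz₀, hz₀, hz₀pos⟩ ?_
    rintro y ⟨hyc, hyU⟩
    refine ⟨hyU, lt_of_le_of_ne (hnonneg y hyU) fun hy0 => ?_⟩
    obtain ⟨r, hr, hrU⟩ := Metric.isOpen_iff.mp hU y hyU
    obtain ⟨c, hcu, hcy⟩ := Metric.mem_closure_iff.mp hyc (r / 4) (by linarith)
    rw [Prod.dist_eq, max_lt_iff, Real.dist_eq, Real.dist_eq, abs_lt, abs_lt] at hcy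
    -- With `c` within `r / 4` of `y` in the sup metric, the Euclidean disc about `c` through `y`
    -- stays inside the `r`-ball about `y`, hence in `U`.
    obtain ⟨⟨a1, a2⟩, a3, a4⟩ := hcy
    have hsub : ∀ z, sqDist c z ≤ sqDist c y → z ∈ U := by
      intro z hz
      refine hrU ?_
      unfold sqDist at hz
      have h1 : (z.1 - c.1) ^ 2 < (r / 2) ^ 2 := by
        nlinarith [sq_nonneg (z.2 - c.2)]
      have h2 : (z.2 - c.2) ^ 2 < (r / 2) ^ 2 := by
        nlinarith [sq_nonneg (z.1 - c.1)]
      have h3 := abs_lt.mp (abs_lt_of_sq_lt_sq h1 (by linarith))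
      have h4 := abs_lt.mp (abs_lt_of_sq_lt_sq h2 (by linarith))
      rw [Metric.mem_ball, Prod.dist_eq, max_lt_iff, Real.dist_eq, Real.dist_eq, abs_lt, abs_lt]
      exact ⟨⟨by linarith, by linarith⟩, by linarith, by linarith⟩
    have hD : Real.sqrt (sqDist c y) ^ 2 = sqDist c y := Real.sq_sqrt (sqDist_nonneg _ _)
    have hcomp := isCompact_sqDist_le c (Real.sqrt (sqDist c y))
    rw [hD] at hcomp
    have hZc : IsCompact ({z | sqDist c z ≤ sqDist c y} ∩ J.val ⁻¹' {0}) :=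
      hcomp.of_isClosed_subset
        ((hcont.mono hsub).preimage_isClosed_of_isClosed hcomp.isClosed isClosed_singleton)
        inter_subset_left
    -- The zero nearest to `c`: the open disc about `c` reaching to it contains only positive
    -- values, so Hopf's lemma applies at `z`. But `z` is an interior minimum, where the gradient
    -- vanishes.
    obtain ⟨z, hzZ, hzmin⟩ := hZc.exists_isMinOn ⟨y, le_refl (sqDist c y), hy0.symm⟩
      (continuous_sqDist c).continuousOn
    have hz1 : sqDist c z ≤ sqDist c y := hzZ.1
    have hz0 : J.val z = 0 := hzZ.2
    have hzU : z ∈ U := hsub z hz1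
    have hcpos : 0 < J.val c := hcu.2
    have hRpos : 0 < sqDist c z := by
      refine lt_of_le_of_ne (sqDist_nonneg _ _) fun h0 => ?_
      unfold sqDist at h0
      have e1 : z.1 = c.1 := by nlinarith [sq_nonneg (z.1 - c.1), sq_nonneg (z.2 - c.2)]
      have e2 : z.2 = c.2 := by nlinarith [sq_nonneg (z.1 - c.1), sq_nonneg (z.2 - c.2)]
      have : z = c := Prod.ext e1 e2
      rw [this] at hz0
      linarith
    set R := Real.sqrt (sqDist c z) with hR
    have hR2 : R ^ 2 = sqDist c z := Real.sq_sqrt (sqDist_nonneg _ _)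
    have hR0 : 0 < R := Real.sqrt_pos.mpr hRpos
    obtain ⟨k, hk, hgrow⟩ := hopf_disc (J := J) (κ := κ) (N := N) (C := C) (R := R) (c := c)
      hκ hC hR0 (hcont.mono fun x hx => hsub x (by
        have hx : sqDist c x ≤ R ^ 2 := hx
        linarith))
      (fun x hx => hsup x (hsub x (by linarith)))
      (fun x hx => lt_of_le_of_ne (hnonneg x (hsub x (by linarith))) fun h0 => by
        have : sqDist c z ≤ sqDist c x := hzmin ⟨by
          have : sqDist c x ≤ sqDist c y := by linarith
          exact this, h0.symm⟩
        linarith)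
      (fun x hx => hnonneg x (hsub x (by linarith)))
    have hlm : IsLocalMin J.val z := by
      filter_upwards [hU.mem_nhds hzU] with x hx
      rw [hz0]
      exact hnonneg x hx
    obtain ⟨e1, e2⟩ := dq_dp_eq_zero_of_isLocalMin (hsup z hzU).valid hlm
    have hv := (hsup z hzU).valid.val
    rw [e1, e2] at hv
    have hd := ValidAt.hasDerivAt_line (f := J.val) (z := z) (t := 0) (ξ := c - z)
      (a := 0) (b := 0) (by simpa using hv)
    have := HasDerivAt.le_of_le_right (k := k) hd.hasDerivWithinAt (by
      filter_upwards [Ioo_mem_nhdsGT (show (0 : ℝ) < 1 / 2 by norm_num)] with t ht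
      have := hgrow z hR2.symm t ⟨ht.1.le, ht.2.le⟩
      simpa [hz0] using this)
    linarith
  exact fun z hz => (key hz).2

end PlaneJet

/-! ### The nonlinear boundary value problem for the height, and its invariance under translation
and reflection. -/

/-- The factor `(1 + s)^(-3/2)` in the curvature of a graph whose squared slope is `s`. -/
noncomputable def curvatureFactor (s : ℝ) : ℝ := 1 / (1 + s) ^ (3 / 2 : ℝ)

lemma curvatureFactor_pos {s : ℝ} (hs : 0 ≤ s) : 0 < curvatureFactor s := by
  unfold curvatureFactor; positivity

lemma hasDerivAt_curvatureFactor {s : ℝ} (hs : 0 ≤ s) :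
    HasDerivAt curvatureFactor (-(3 / 2) * (1 + s) ^ (-(5 / 2) : ℝ)) s := by
  have h1 : HasDerivAt (fun s : ℝ => 1 + s) 1 s := (hasDerivAt_id s).const_add 1
  have h2 := h1.rpow_const (p := -(3 / 2)) (Or.inl (by linarith))
  have h3 : curvatureFactor =ᶠ[𝓝 s] fun s => (1 + s) ^ (-(3 / 2) : ℝ) := by
    have : ∀ᶠ x in 𝓝 s, -1 < x := lt_mem_nhds (by linarith)
    filter_upwards [this] with x hx
    rw [Real.rpow_neg (by linarith), curvatureFactor, one_div]
  refine (h2.congr_of_eventuallyEq h3).congr_deriv ?_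
  norm_num

lemma curvatureFactor_lipschitz {s t : ℝ} (hs : 0 ≤ s) (ht : 0 ≤ t) :
    |curvatureFactor s - curvatureFactor t| ≤ 2 * |s - t| := by
  have := (convex_Ici (0 : ℝ)).norm_image_sub_le_of_norm_hasDerivWithin_le (C := 2)
    (f := curvatureFactor) (f' := fun s => -(3 / 2) * (1 + s) ^ (-(5 / 2) : ℝ))
    (fun x hx => (hasDerivAt_curvatureFactor hx).hasDerivWithinAt)
    (fun x hx => by
      have hx : 0 ≤ x := hx
      have h1 : (1 + x) ^ (-(5 / 2) : ℝ) ≤ 1 :=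
        Real.rpow_le_one_of_one_le_of_nonpos (by linarith) (by norm_num)
      have h2 : 0 ≤ (1 + x) ^ (-(5 / 2) : ℝ) := by positivity
      rw [Real.norm_eq_abs, abs_mul, abs_of_nonneg h2]
      norm_num
      linarith) (show t ∈ Ici 0 from ht) (show s ∈ Ici 0 from hs)
  simpa using this

/-- The height function of a steady wave in the semi-hodograph variables `(q, p)`: it solves a
quasilinear elliptic equation in the strip `p₀ < p < 0`, vanishes on `p = p₀`, and satisfies a
nonlinear boundary condition involving the curvature on `p = 0`. -/
structure HeightSystem (p₀ m M k σ E : ℝ) (A B : ℝ → ℝ) (h : PlaneJet) : Prop where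
  valid : ∀ z, z.2 ∈ Ioo p₀ 0 → h.ValidAt z
  cont : ContinuousOn h.val {z | z.2 ∈ Icc p₀ 0}
  periodic : ∀ q, ∀ p ∈ Icc p₀ 0, h.val (q + 2 * Real.pi, p) = h.val (q, p)
  bed : ∀ q, h.val (q, p₀) = 0
  dq_bound : ∀ z, z.2 ∈ Ioc p₀ 0 → |h.dq z| ≤ M
  dp_lower : ∀ z, z.2 ∈ Ioc p₀ 0 → m ≤ h.dp z
  dp_upper : ∀ z, z.2 ∈ Ioc p₀ 0 → h.dp z ≤ M
  dqq_bound : ∀ z, z.2 ∈ Ioc p₀ 0 → |h.dqq z| ≤ M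
  dqp_bound : ∀ z, z.2 ∈ Ioo p₀ 0 → |h.dqp z| ≤ M
  dpp_bound : ∀ z, z.2 ∈ Ioo p₀ 0 → |h.dpp z| ≤ M
  coeff_bound : ∀ p ∈ Ioo p₀ 0, |A p| ≤ M
  eqn : ∀ z, z.2 ∈ Ioo p₀ 0 →
    h.ellip (h.dp z) (-h.dq z) z = h.dp z ^ 3 * (A z.2 * h.val z + B z.2)
  top_dq : ∀ q, HasDerivAt (fun q => h.val (q, 0)) (h.dq (q, 0)) q
  top_dqq : ∀ q, HasDerivAt (fun q => h.dq (q, 0)) (h.dqq (q, 0)) q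
  top_dp : ∀ q, HasDerivWithinAt (fun p => h.val (q, p)) (h.dp (q, 0)) (Iic 0) 0
  top_cond : ∀ q, (1 + h.dq (q, 0) ^ 2) / (2 * h.dp (q, 0) ^ 2) + k * h.val (q, 0)
    - σ * (h.dqq (q, 0) * curvatureFactor (h.dq (q, 0) ^ 2)) = E

namespace PlaneJet

/-- `q ↦ l + q`. -/
def translate (l : ℝ) (J : PlaneJet) : PlaneJet where
  val z := J.val (l + z.1, z.2)
  dq z := J.dq (l + z.1, z.2)
  dp z := J.dp (l + z.1, z.2)
  dqq z := J.dqq (l + z.1, z.2)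
  dqp z := J.dqp (l + z.1, z.2)
  dpp z := J.dpp (l + z.1, z.2)

/-- `q ↦ -q`. -/
def reflect (J : PlaneJet) : PlaneJet where
  val z := J.val (-z.1, z.2)
  dq z := -J.dq (-z.1, z.2)
  dp z := J.dp (-z.1, z.2)
  dqq z := J.dqq (-z.1, z.2)
  dqp z := -J.dqp (-z.1, z.2)
  dpp z := J.dpp (-z.1, z.2)

lemma hasFDerivAt_comp_translate {f : ℝ × ℝ → ℝ} {a b l : ℝ} {z : ℝ × ℝ}
    (hf : HasFDerivAt f (planeForm a b) (l + z.1, z.2)) :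
    HasFDerivAt (fun z : ℝ × ℝ => f (l + z.1, z.2)) (planeForm a b) z := by
  have h1 : HasFDerivAt (fun z : ℝ × ℝ => (l + z.1, z.2))
      ((ContinuousLinearMap.fst ℝ ℝ ℝ).prod (ContinuousLinearMap.snd ℝ ℝ ℝ)) z :=
    (hasFDerivAt_fst.const_add l).prodMk hasFDerivAt_snd
  refine (HasFDerivAt.comp z hf h1).congr_fderiv ?_
  ext <;> simp

lemma hasFDerivAt_comp_reflect {f : ℝ × ℝ → ℝ} {a b : ℝ} {z : ℝ × ℝ}
    (hf : HasFDerivAt f (planeForm a b) (-z.1, z.2)) :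
    HasFDerivAt (fun z : ℝ × ℝ => f (-z.1, z.2)) (planeForm (-a) b) z := by
  have h1 : HasFDerivAt (fun z : ℝ × ℝ => (-z.1, z.2))
      ((-ContinuousLinearMap.fst ℝ ℝ ℝ).prod (ContinuousLinearMap.snd ℝ ℝ ℝ)) z :=
    (hasFDerivAt_fst.neg).prodMk hasFDerivAt_snd
  refine (HasFDerivAt.comp z hf h1).congr_fderiv ?_
  ext <;> simp

lemma ValidAt.translate {J : PlaneJet} {l : ℝ} {z : ℝ × ℝ} (h : J.ValidAt (l + z.1, z.2)) :
    (J.translate l).ValidAt z :=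
  ⟨hasFDerivAt_comp_translate h.val, hasFDerivAt_comp_translate h.dq,
    hasFDerivAt_comp_translate h.dp⟩

lemma ValidAt.reflect {J : PlaneJet} {z : ℝ × ℝ} (h : J.ValidAt (-z.1, z.2)) :
    J.reflect.ValidAt z := by
  refine ⟨hasFDerivAt_comp_reflect h.val, ?_, hasFDerivAt_comp_reflect h.dp⟩
  refine (hasFDerivAt_comp_reflect h.dq).neg.congr_fderiv ?_
  ext <;> simp [PlaneJet.reflect]

end PlaneJet

namespace HeightSystem

variable {p₀ m M k σ E : ℝ} {A B : ℝ → ℝ} {h : PlaneJet}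

lemma translate (H : HeightSystem p₀ m M k σ E A B h) (l : ℝ) :
    HeightSystem p₀ m M k σ E A B (h.translate l) where
  valid z hz := (H.valid (l + z.1, z.2) hz).translate
  cont := H.cont.comp (f := fun z : ℝ × ℝ => (l + z.1, z.2)) (by fun_prop) fun z hz => hz
  periodic q p hp := by
    have := H.periodic (l + q) p hp
    simpa [PlaneJet.translate, add_assoc] using this
  bed q := H.bed _
  dq_bound z hz := H.dq_bound (l + z.1, z.2) hz
  dp_lower z hz := H.dp_lower (l + z.1, z.2) hz
  dp_upper z hz := H.dp_upper (l + z.1, z.2) hz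
  dqq_bound z hz := H.dqq_bound (l + z.1, z.2) hz
  dqp_bound z hz := H.dqp_bound (l + z.1, z.2) hz
  dpp_bound z hz := H.dpp_bound (l + z.1, z.2) hz
  coeff_bound := H.coeff_bound
  eqn z hz := H.eqn (l + z.1, z.2) hz
  top_dq q := (H.top_dq (l + q)).comp_const_add l q
  top_dqq q := (H.top_dqq (l + q)).comp_const_add l q
  top_dp q := H.top_dp (l + q)
  top_cond q := H.top_cond (l + q)

lemma reflect (H : HeightSystem p₀ m M k σ E A B h) :
    HeightSystem p₀ m M k σ E A B h.reflect where
  valid z hz := (H.valid (-z.1, z.2) hz).reflect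
  cont := H.cont.comp (f := fun z : ℝ × ℝ => (-z.1, z.2)) (by fun_prop) fun z hz => hz
  periodic q p hp := by
    have := H.periodic (-(q + 2 * Real.pi)) p hp
    simpa [PlaneJet.reflect] using this.symm
  bed q := H.bed _
  dq_bound z hz := by simpa [PlaneJet.reflect] using H.dq_bound (-z.1, z.2) hz
  dp_lower z hz := H.dp_lower (-z.1, z.2) hz
  dp_upper z hz := H.dp_upper (-z.1, z.2) hz
  dqq_bound z hz := H.dqq_bound (-z.1, z.2) hz
  dqp_bound z hz := by simpa [PlaneJet.reflect] using H.dqp_bound (-z.1, z.2) hz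
  dpp_bound z hz := H.dpp_bound (-z.1, z.2) hz
  coeff_bound := H.coeff_bound
  eqn z hz := by
    have := H.eqn (-z.1, z.2) hz
    simp only [PlaneJet.ellip, PlaneJet.reflect] at this ⊢
    linarith
  top_dq q := by
    have := (H.top_dq (-q)).comp q (hasDerivAt_neg q)
    simpa [PlaneJet.reflect, Function.comp_def] using this
  top_dqq q := by
    have := ((H.top_dqq (-q)).comp q (hasDerivAt_neg q)).neg
    exact this.congr_deriv (by simp [PlaneJet.reflect])
  top_dp q := H.top_dp (-q)
  top_cond q := by
    have := H.top_cond (-q)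
    simpa [PlaneJet.reflect] using this

end HeightSystem

/-! ### The linear inequality and the boundary relations for the difference of two solutions. -/

/-- Ellipticity constant of the height equation. -/
noncomputable def ellipConst (m M : ℝ) : ℝ := m ^ 2 / (2 + 2 * M ^ 2 + m ^ 2)

/-- Lower order constant in the inequality satisfied by the difference of two solutions. -/
noncomputable def diffConst (m M : ℝ) : ℝ :=
  4 * M ^ 2 + (M + 4 * M ^ 3) / m ^ 3 * (3 * M ^ 2) + M ^ 4

lemma ellipConst_pos {m : ℝ} (hm : 0 < m) (M : ℝ) : 0 < ellipConst m M := by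
  unfold ellipConst; positivity

lemma diffConst_nonneg {m M : ℝ} (hm : 0 < m) (hM : 0 ≤ M) : 0 ≤ diffConst m M := by
  unfold diffConst; positivity

/-- From `a x = (a x + b y) - b y`, the size of `x` is controlled by `y` and `a x + b y`, because
`a` stays away from zero. -/
lemma ellipConst_le {m M a b : ℝ} (hm : 0 < m) (ha : m ≤ a) (hb : |b| ≤ M) (x y : ℝ) :
    ellipConst m M * (x ^ 2 + y ^ 2) ≤ y ^ 2 + (a * x + b * y) ^ 2 := by
  have hb2 : b ^ 2 ≤ M ^ 2 := by
    rw [← sq_abs b]; exact pow_le_pow_left₀ (abs_nonneg b) hb 2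
  have ha2 : m ^ 2 ≤ a ^ 2 := pow_le_pow_left₀ hm.le ha 2
  unfold ellipConst
  rw [div_mul_eq_mul_div, div_le_iff₀ (by positivity)]
  have h1 : (a * x) ^ 2 ≤ 2 * (a * x + b * y) ^ 2 + 2 * (b * y) ^ 2 := by
    nlinarith [sq_nonneg (a * x + 2 * (b * y))]
  have h2 : m ^ 2 * x ^ 2 ≤ (a * x) ^ 2 := by
    rw [mul_pow]; exact mul_le_mul_of_nonneg_right ha2 (sq_nonneg x)
  have h3 : (b * y) ^ 2 ≤ M ^ 2 * y ^ 2 := by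
    rw [mul_pow]; exact mul_le_mul_of_nonneg_right hb2 (sq_nonneg y)
  have h4 : 0 ≤ (a * x + b * y) ^ 2 * (2 * M ^ 2 + m ^ 2) := by positivity
  nlinarith [sq_nonneg y]

namespace HeightSystem

variable {p₀ m M k σ E : ℝ} {A B : ℝ → ℝ} {X Y : PlaneJet}

lemma M_nonneg (HX : HeightSystem p₀ m M k σ E A B X) (hp₀ : p₀ < 0) : 0 ≤ M :=
  le_trans (abs_nonneg _) (HX.dq_bound (0, 0) ⟨hp₀, le_refl 0⟩)

/-- The coefficients are frozen at `X`. Applying this operator to `Y` and using the equation of `Y`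
leaves differences of coefficients times second derivatives of `Y`, plus differences of the right
sides; all are linear in `Y - X` and its gradient, with bounded factors. -/
lemma supersol_sub (HX : HeightSystem p₀ m M k σ E A B X) (HY : HeightSystem p₀ m M k σ E A B Y)
    (hm : 0 < m) {z : ℝ × ℝ} (hz : z.2 ∈ Ioo p₀ 0) :
    (Y.sub X).Supersol (ellipConst m M) (2 * M ^ 2) (diffConst m M) z := by
  have hz' : z.2 ∈ Ioc p₀ 0 := ⟨hz.1, hz.2.le⟩
  refine ⟨(HY.valid z hz).sub (HX.valid z hz), X.dp z, -X.dq z,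
    ellipConst_le hm (HX.dp_lower z hz') (by rw [abs_neg]; exact HX.dq_bound z hz'), ?_, ?_⟩
  · have h1 : X.dp z ^ 2 ≤ M ^ 2 :=
      pow_le_pow_left₀ (hm.le.trans (HX.dp_lower z hz')) (HX.dp_upper z hz') 2
    have h2 : (-X.dq z) ^ 2 ≤ M ^ 2 := by
      rw [neg_sq, ← sq_abs]; exact pow_le_pow_left₀ (abs_nonneg _) (HX.dq_bound z hz') 2
    linarith
  · have hM : 0 ≤ M := (abs_nonneg _).trans (HX.dq_bound z hz')
    have eX := HX.eqn z hz
    have eY := HY.eqn z hz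
    have bXq := HX.dq_bound z hz'
    have bYq := HY.dq_bound z hz'
    have lXp := HX.dp_lower z hz'
    have lYp := HY.dp_lower z hz'
    have bXp : |X.dp z| ≤ M := by rw [abs_of_pos (by linarith)]; exact HX.dp_upper z hz'
    have bYp : |Y.dp z| ≤ M := by rw [abs_of_pos (by linarith)]; exact HY.dp_upper z hz'
    have bqq := HY.dqq_bound z hz'
    have bqp := HY.dqp_bound z hz
    have bpp := HY.dpp_bound z hz
    have bA := HX.coeff_bound z.2 hz
    rw [PlaneJet.ellip_sub, eX]
    simp only [PlaneJet.ellip, PlaneJet.sub] at eY ⊢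
    set a := X.dp z
    set b := X.dq z
    set a' := Y.dp z
    set b' := Y.dq z
    set S := A z.2 * Y.val z + B z.2 with hS
    have ha'0 : 0 < a' := by linarith
    -- No bound on `B` is part of the system: the equation of `Y` expresses `S` by derivatives of
    -- `Y`, divided by `Y_p³ ≥ m³`.
    have hSb : |S| ≤ (M + 4 * M ^ 3) / m ^ 3 := by
      rw [le_div_iff₀ (by positivity)]
      have h1 : |S| * m ^ 3 ≤ |a' ^ 3 * S| := by
        rw [abs_mul, mul_comm, abs_of_pos (by positivity : 0 < a' ^ 3)]
        gcongr
      refine h1.trans ?_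
      rw [← eY]
      have t1 : |a' ^ 2 * Y.dqq z| ≤ M ^ 2 * M := by rw [abs_mul, abs_pow]; gcongr
      have t2 : |2 * a' * -b' * Y.dqp z| ≤ 2 * M * M * M := by
        rw [abs_mul, abs_mul, abs_mul, abs_neg, abs_two]; gcongr
      have t3 : |(-b') ^ 2 * Y.dpp z| ≤ M ^ 2 * M := by
        rw [abs_mul, abs_pow, abs_neg]; gcongr
      refine (abs_add_le _ _).trans ?_
      have := (abs_add_le (a' ^ 2 * Y.dqq z + 2 * a' * -b' * Y.dqp z) ((-b') ^ 2 * Y.dpp z))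
      have := abs_add_le (a' ^ 2 * Y.dqq z) (2 * a' * -b' * Y.dqp z)
      linarith
    have key : Y.dpp z + (a ^ 2 * Y.dqq z + 2 * a * -b * Y.dqp z + (-b) ^ 2 * Y.dpp z)
        - a ^ 3 * (A z.2 * X.val z + B z.2)
        = -(a' - a) * (a + a') * Y.dqq z
          + (2 * (a' - a) * b' * Y.dqp z + 2 * (b' - b) * a * Y.dqp z)
          - (b' - b) * (b + b') * Y.dpp z
          + (a' - a) * (a' ^ 2 + a' * a + a ^ 2) * S
          + a ^ 3 * A z.2 * (Y.val z - X.val z) := by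
      rw [hS]; rw [hS] at eY; linear_combination eY
    rw [key]
    have haa : |a + a'| ≤ 2 * M := (abs_add_le _ _).trans (by linarith)
    have hbb : |b + b'| ≤ 2 * M := (abs_add_le _ _).trans (by linarith)
    have t1 : |-(a' - a) * (a + a') * Y.dqq z| ≤ |a' - a| * (2 * M) * M := by
      rw [abs_mul, abs_mul, abs_neg]; gcongr
    have t2 : |2 * (a' - a) * b' * Y.dqp z| ≤ 2 * |a' - a| * M * M := by
      rw [abs_mul, abs_mul, abs_mul, abs_two]; gcongr
    have t3 : |2 * (b' - b) * a * Y.dqp z| ≤ 2 * |b' - b| * M * M := by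
      rw [abs_mul, abs_mul, abs_mul, abs_two]; gcongr
    have t4 : |(b' - b) * (b + b') * Y.dpp z| ≤ |b' - b| * (2 * M) * M := by
      rw [abs_mul, abs_mul]; gcongr
    have t5 : |(a' - a) * (a' ^ 2 + a' * a + a ^ 2) * S| ≤
        |a' - a| * (3 * M ^ 2) * ((M + 4 * M ^ 3) / m ^ 3) := by
      rw [abs_mul, abs_mul]
      have : |a' ^ 2 + a' * a + a ^ 2| ≤ 3 * M ^ 2 := by
        refine (abs_add_le _ _).trans ?_
        have u1 : |a ^ 2| ≤ M ^ 2 := by rw [abs_pow]; gcongr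
        have u2 : |a' ^ 2| ≤ M ^ 2 := by rw [abs_pow]; gcongr
        have u3 : |a' * a| ≤ M * M := by rw [abs_mul]; gcongr
        have := abs_add_le (a' ^ 2) (a' * a)
        nlinarith
      gcongr
    have t6 : |a ^ 3 * A z.2 * (Y.val z - X.val z)| ≤ M ^ 3 * M * |Y.val z - X.val z| := by
      rw [abs_mul, abs_mul, abs_pow]; gcongr
    have l1 := (abs_le.mp t1).2
    have l2 := (abs_le.mp t2).2
    have l3 := (abs_le.mp t3).2
    have l4 := (abs_le.mp t4).1
    have l5 := (abs_le.mp t5).2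
    have l6 := (abs_le.mp t6).2
    have hD : 0 ≤ (M + 4 * M ^ 3) / m ^ 3 * (3 * M ^ 2) := by positivity
    have n1 := abs_nonneg (Y.val z - X.val z)
    have n2 := abs_nonneg (b' - b)
    have n3 := abs_nonneg (a' - a)
    set D := (M + 4 * M ^ 3) / m ^ 3 * (3 * M ^ 2) with hDd
    have l5' : (a' - a) * (a' ^ 2 + a' * a + a ^ 2) * S ≤ |a' - a| * D := by
      rw [hDd]; linarith
    have hM4 : 0 ≤ M ^ 4 := by positivity
    have hM2 : 0 ≤ M ^ 2 := by positivity
    have hd : diffConst m M = 4 * M ^ 2 + D + M ^ 4 := rfl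
    rw [hd]
    have p1 := mul_nonneg hM4 n2
    have p2 := mul_nonneg hM4 n3
    have p3 := mul_nonneg hD n1
    have p4 := mul_nonneg hD n2
    have p5 := mul_nonneg hM2 n1
    clear_value D
    clear t1 t2 t3 t4 t5 t6 eX eY key hSb l5 haa hbb
    linarith

lemma top_diff (HX : HeightSystem p₀ m M k σ E A B X) (HY : HeightSystem p₀ m M k σ E A B Y)
    (q : ℝ) :
    (1 + Y.dq (q, 0) ^ 2) / (2 * Y.dp (q, 0) ^ 2) - (1 + X.dq (q, 0) ^ 2) / (2 * X.dp (q, 0) ^ 2)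
      + k * (Y.val (q, 0) - X.val (q, 0))
      - σ * ((Y.dqq (q, 0) - X.dqq (q, 0)) * curvatureFactor (Y.dq (q, 0) ^ 2)
        + X.dqq (q, 0) *
          (curvatureFactor (Y.dq (q, 0) ^ 2) - curvatureFactor (X.dq (q, 0) ^ 2))) = 0 := by
  have h1 := HX.top_cond q
  have h2 := HY.top_cond q
  linear_combination h2 - h1

/-- The boundary condition contains second derivatives along the top edge only, so contact from
below is tested there in one variable. -/
lemma top_touching (HX : HeightSystem p₀ m M k σ E A B X)
    (HY : HeightSystem p₀ m M k σ E A B Y) {f f' : ℝ → ℝ} {f'' q : ℝ}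
    (hf : ∀ q, HasDerivAt f (f' q) q) (hf' : HasDerivAt f' f'' q)
    (hmin : IsLocalMin (fun q => Y.val (q, 0) - X.val (q, 0) - f q) q) :
    Y.dq (q, 0) - X.dq (q, 0) = f' q ∧ f'' ≤ Y.dqq (q, 0) - X.dqq (q, 0) := by
  have h1 : ∀ q, HasDerivAt (fun q => Y.val (q, 0) - X.val (q, 0) - f q)
      (Y.dq (q, 0) - X.dq (q, 0) - f' q) q := fun q =>
    ((HY.top_dq q).sub (HX.top_dq q)).sub (hf q)
  have h2 : HasDerivAt (fun q => Y.dq (q, 0) - X.dq (q, 0) - f' q)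
      (Y.dqq (q, 0) - X.dqq (q, 0) - f'') q := ((HY.top_dqq q).sub (HX.top_dqq q)).sub hf'
  have h3 := hmin.hasDerivAt_eq_zero (h1 q)
  have h4 := hmin.second_deriv_nonneg (Eventually.of_forall h1) h2
  exact ⟨by linarith, by linarith⟩

lemma hasDerivWithinAt_down (HX : HeightSystem p₀ m M k σ E A B X) (q : ℝ) :
    HasDerivWithinAt (fun t => X.val (q, -t)) (-X.dp (q, 0)) (Ici 0) 0 := by
  have h1 : HasDerivWithinAt (fun p => X.val (q, p)) (X.dp (q, 0)) (Iic 0) (-0) := by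
    simpa using HX.top_dp q
  have h2 := HasDerivWithinAt.scomp (h := fun t : ℝ => -t) (0 : ℝ) h1
    (hasDerivAt_neg (0 : ℝ)).hasDerivWithinAt
    (t' := Iic 0) (s := Ici 0) (fun t ht => by
      have ht : 0 ≤ t := ht
      simpa using ht)
  exact h2.congr_deriv (by simp)

end HeightSystem

/-! ### Strict ordering of two solutions up to the top edge. -/

namespace HeightSystem

variable {p₀ m M k σ E : ℝ} {A B : ℝ → ℝ} {X Y : PlaneJet}

lemma continuousOn_sub (HX : HeightSystem p₀ m M k σ E A B X)
    (HY : HeightSystem p₀ m M k σ E A B Y) :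
    ContinuousOn (Y.sub X).val {z | z.2 ∈ Icc p₀ 0} := HY.cont.sub HX.cont

/-- If two solutions are ordered on a rectangle and differ at some interior point, they are
strictly ordered in the interior and on the top edge. -/
lemma sub_pos (HX : HeightSystem p₀ m M k σ E A B X) (HY : HeightSystem p₀ m M k σ E A B Y)
    (hm : 0 < m) (hp₀ : p₀ < 0) (hσ : σ ≤ 0) {a b : ℝ}
    (hnonneg : ∀ q ∈ Ioo a b, ∀ p ∈ Icc p₀ 0, X.val (q, p) ≤ Y.val (q, p))
    (hne : ∃ q ∈ Ioo a b, ∃ p ∈ Ioo p₀ 0, X.val (q, p) ≠ Y.val (q, p)) :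
    ∀ q ∈ Ioo a b, ∀ p ∈ Ioc p₀ 0, X.val (q, p) < Y.val (q, p) := by
  have hM := HX.M_nonneg hp₀
  have hC := diffConst_nonneg hm hM
  have hκ := ellipConst_pos hm M
  have hint : ∀ z ∈ Ioo a b ×ˢ Ioo p₀ 0, 0 < (Y.sub X).val z := by
    refine PlaneJet.pos_of_supersol hκ hC (isOpen_Ioo.prod isOpen_Ioo)
      ((convex_Ioo a b).prod (convex_Ioo p₀ 0)).isPreconnected
      (fun z hz => HX.supersol_sub HY hm hz.2)
      (fun z hz => sub_nonneg.mpr (hnonneg z.1 hz.1 z.2 ⟨hz.2.1.le, hz.2.2.le⟩)) ?_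
    obtain ⟨q, hq, p, hp, hne⟩ := hne
    exact ⟨(q, p), ⟨hq, hp⟩,
      _root_.sub_pos.mpr (lt_of_le_of_ne (hnonneg q hq p ⟨hp.1.le, hp.2.le⟩) hne)⟩
  intro q hq p hp
  rcases lt_or_eq_of_le hp.2 with hlt | heq
  · exact _root_.sub_pos.mp (hint (q, p) ⟨hq, hp.1, hlt⟩)
  subst heq
  refine lt_of_le_of_ne (hnonneg q hq 0 ⟨hp₀.le, le_refl 0⟩) fun h0 => ?_
  -- Radius of a disc centred at `(q, -R)`, inside the rectangle and tangent to the top edge at the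
  -- supposed zero `(q, 0)`.
  obtain ⟨R, hR0, hRa, hRb, hRp⟩ : ∃ R, 0 < R ∧ a < q - R ∧ q + R < b ∧ p₀ < -2 * R := by
    refine ⟨min (min (q - a) (b - q)) (-p₀) / 3, ?_, ?_, ?_, ?_⟩
    · have := hq.1
      have := hq.2
      have : 0 < min (min (q - a) (b - q)) (-p₀) :=
        lt_min (lt_min (by linarith) (by linarith)) (by linarith)
      linarith
    all_goals
      have h1 := min_le_left (min (q - a) (b - q)) (-p₀)
      have h2 := min_le_right (min (q - a) (b - q)) (-p₀)
      have h3 := min_le_left (q - a) (b - q)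
      have h4 := min_le_right (q - a) (b - q)
      have := hq.1
      have := hq.2
      linarith
  have hbox : ∀ z, sqDist (q, -R) z ≤ R ^ 2 → z.1 ∈ Ioo a b ∧ z.2 ∈ Icc p₀ 0 := by
    intro z hz
    simp only [sqDist] at hz
    have h1 := abs_le.mp (abs_le_of_sq_le_sq (a := z.1 - q) (b := R)
      (by nlinarith [sq_nonneg (z.2 - -R)]) hR0.le)
    have h2 := abs_le.mp (abs_le_of_sq_le_sq (a := z.2 - -R) (b := R)
      (by nlinarith [sq_nonneg (z.1 - q)]) hR0.le)
    exact ⟨⟨by linarith, by linarith⟩, by linarith, by linarith⟩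
  have hbox' : ∀ z, sqDist (q, -R) z < R ^ 2 → z.1 ∈ Ioo a b ∧ z.2 ∈ Ioo p₀ 0 := by
    intro z hz
    refine ⟨(hbox z hz.le).1, ?_⟩
    simp only [sqDist] at hz
    have h2 := abs_lt.mp (abs_lt_of_sq_lt_sq (a := z.2 - -R) (b := R)
      (by nlinarith [sq_nonneg (z.1 - q)]) hR0.le)
    exact ⟨by linarith, by linarith⟩
  obtain ⟨K, hK, hgrow⟩ := PlaneJet.hopf_disc (J := Y.sub X) (c := (q, -R)) (R := R)
    hκ hC hR0 ((HX.continuousOn_sub HY).mono fun z hz => (hbox z hz).2)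
    (fun z hz => HX.supersol_sub HY hm (hbox' z hz).2)
    (fun z hz => hint z (hbox' z hz))
    (fun z hz => sub_nonneg.mpr (hnonneg z.1 (hbox z hz).1 z.2 (hbox z hz).2))
  -- Hopf's lemma parametrises the inward normal by `t / R`, whence the factor `R⁻¹`.
  have hdown : K * R⁻¹ ≤ -Y.dp (q, 0) - -X.dp (q, 0) := by
    refine HasDerivAt.le_of_le_right
      ((HY.hasDerivWithinAt_down q).sub (HX.hasDerivWithinAt_down q)) ?_
    filter_upwards [Ioo_mem_nhdsGT (show (0 : ℝ) < R / 2 by linarith)] with t ht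
    have h1 := hgrow (q, 0) (by simp [sqDist]) (t / R)
      ⟨by have := ht.1; positivity, by rw [div_le_iff₀ hR0]; linarith [ht.2]⟩
    have h2 : (q, (0 : ℝ)) + (t / R) • ((q, -R) - (q, (0 : ℝ))) = (q, -t) := by
      ext <;> simp
      field_simp
    rw [h2] at h1
    simp only [PlaneJet.sub] at h1
    simp only [Pi.sub_apply, neg_zero]
    rw [h0]
    calc K * R⁻¹ * t = K * (t / R) := by ring
      _ ≤ _ := by linarith
  have hlt : Y.dp (q, 0) < X.dp (q, 0) := by
    have : 0 < K * R⁻¹ := by positivity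
    linarith
  -- At a zero minimum along the edge the slopes agree and `Y_qq ≥ X_qq`. In the difference of the
  -- boundary conditions the kinetic part is then strictly positive, since `Y_p < X_p`, and the
  -- curvature part is nonnegative, since `σ ≤ 0`; yet they sum to zero.
  obtain ⟨e1, e2⟩ := HX.top_touching HY (f := fun _ => 0) (f' := fun _ => 0) (f'' := 0) (q := q)
    (fun q => hasDerivAt_const _ _) (hasDerivAt_const _ _) (by
      filter_upwards [Ioo_mem_nhds hq.1 hq.2] with x hx
      have := hnonneg x hx 0 ⟨hp₀.le, le_refl 0⟩
      simp only [h0]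
      linarith)
  have htop := HX.top_diff HY q
  have hYq : Y.dq (q, 0) = X.dq (q, 0) := by linarith
  rw [hYq, h0, sub_self, sub_self, mul_zero, mul_zero, add_zero, add_zero] at htop
  have hYp : 0 < Y.dp (q, 0) := hm.trans_le (HY.dp_lower (q, 0) hp)
  have h3 : (1 + X.dq (q, 0) ^ 2) / (2 * X.dp (q, 0) ^ 2) <
      (1 + X.dq (q, 0) ^ 2) / (2 * Y.dp (q, 0) ^ 2) := by
    apply div_lt_div_of_pos_left (by positivity) (by positivity)
    have := pow_lt_pow_left₀ hlt hYp.le (n := 2) (by norm_num)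
    linarith
  have h4 := mul_nonneg e2 (curvatureFactor_pos (sq_nonneg (X.dq (q, 0)))).le
  have h5 := mul_nonneg_of_nonpos_of_nonpos hσ (neg_nonpos.mpr h4)
  linarith

end HeightSystem

/-! ### Comparison in a neighbourhood of the bottom and lateral sides. -/

namespace PlaneJet

/-- Barrier which is strongly concave near the bottom and the lateral sides of the rectangle
`[0, π] × [p₀, 0]` and strongly increasing in `p` at the top. -/
noncomputable def edgeBarrier (p₀ α β c : ℝ) : PlaneJet where
  val z := c * (4 + Real.exp (β * z.2) - Real.exp (-(α * z.1)) - Real.exp (-(α * (Real.pi - z.1)))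
    - Real.exp (-(α * (z.2 - p₀))))
  dq z := c * (α * Real.exp (-(α * z.1)) - α * Real.exp (-(α * (Real.pi - z.1))))
  dp z := c * (β * Real.exp (β * z.2) + α * Real.exp (-(α * (z.2 - p₀))))
  dqq z := c * (-(α ^ 2 * Real.exp (-(α * z.1))) - α ^ 2 * Real.exp (-(α * (Real.pi - z.1))))
  dqp _ := 0
  dpp z := c * (β ^ 2 * Real.exp (β * z.2) - α ^ 2 * Real.exp (-(α * (z.2 - p₀))))

lemma hasFDerivAt_sum_of_hasDerivAt {f g f' g' : ℝ → ℝ} {z : ℝ × ℝ} (hf : HasDerivAt f (f' z.1) z.1)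
    (hg : HasDerivAt g (g' z.2) z.2) :
    HasFDerivAt (fun z : ℝ × ℝ => f z.1 + g z.2) (planeForm (f' z.1) (g' z.2)) z := by
  have h1 : HasFDerivAt (fun z : ℝ × ℝ => f z.1) (f' z.1 • ContinuousLinearMap.fst ℝ ℝ ℝ) z :=
    hf.comp_hasFDerivAt z hasFDerivAt_fst
  have h2 : HasFDerivAt (fun z : ℝ × ℝ => g z.2) (g' z.2 • ContinuousLinearMap.snd ℝ ℝ ℝ) z :=
    hg.comp_hasFDerivAt z hasFDerivAt_snd
  exact h1.add h2

lemma hasDerivAt_exp_neg_mul (α s : ℝ) :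
    HasDerivAt (fun s => Real.exp (-(α * s))) (-(α * Real.exp (-(α * s)))) s := by
  have := (((hasDerivAt_id s).const_mul α).neg).exp
  exact this.congr_deriv (by simp; ring)

lemma hasDerivAt_exp_neg_mul_rev (α c s : ℝ) :
    HasDerivAt (fun s => Real.exp (-(α * (c - s)))) (α * Real.exp (-(α * (c - s)))) s := by
  have := ((((hasDerivAt_id s).const_sub c).const_mul α).neg).exp
  exact this.congr_deriv (by simp; ring)

lemma hasDerivAt_exp_neg_mul_sub (α c s : ℝ) :
    HasDerivAt (fun s => Real.exp (-(α * (s - c)))) (-(α * Real.exp (-(α * (s - c))))) s := by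
  have := ((((hasDerivAt_id s).sub_const c).const_mul α).neg).exp
  exact this.congr_deriv (by simp; ring)

lemma hasDerivAt_exp_const_mul (β s : ℝ) :
    HasDerivAt (fun s => Real.exp (β * s)) (β * Real.exp (β * s)) s := by
  have := (((hasDerivAt_id s).const_mul β)).exp
  exact this.congr_deriv (by simp; ring)

lemma hasDerivAt_edge_q (α c s : ℝ) :
    HasDerivAt (fun s => c * (4 - Real.exp (-(α * s)) - Real.exp (-(α * (Real.pi - s)))))
      (c * (α * Real.exp (-(α * s)) - α * Real.exp (-(α * (Real.pi - s))))) s := by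
  have := ((((hasDerivAt_exp_neg_mul α s).const_sub 4).sub
    (hasDerivAt_exp_neg_mul_rev α Real.pi s))).const_mul c
  exact this.congr_deriv (by ring)

lemma hasDerivAt_edge_qq (α c s : ℝ) :
    HasDerivAt (fun s => c * (α * Real.exp (-(α * s)) - α * Real.exp (-(α * (Real.pi - s)))))
      (c * (-(α ^ 2 * Real.exp (-(α * s))) - α ^ 2 * Real.exp (-(α * (Real.pi - s))))) s := by
  have := ((((hasDerivAt_exp_neg_mul α s).const_mul α).sub
    ((hasDerivAt_exp_neg_mul_rev α Real.pi s).const_mul α))).const_mul c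
  exact this.congr_deriv (by ring)

lemma edgeBarrier_validAt (p₀ α β c : ℝ) (z : ℝ × ℝ) : (edgeBarrier p₀ α β c).ValidAt z := by
  refine ⟨?_, ?_, ?_⟩
  · have h1 : HasDerivAt (fun s => c * (Real.exp (β * s) - Real.exp (-(α * (s - p₀)))))
        (c * (β * Real.exp (β * z.2) + α * Real.exp (-(α * (z.2 - p₀))))) z.2 :=
      (((hasDerivAt_exp_const_mul β z.2).sub (hasDerivAt_exp_neg_mul_sub α p₀ z.2)).const_mul
        c).congr_deriv (by ring)
    have := hasFDerivAt_sum_of_hasDerivAt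
      (f' := fun s => c * (α * Real.exp (-(α * s)) - α * Real.exp (-(α * (Real.pi - s)))))
      (g' := fun s => c * (β * Real.exp (β * s) + α * Real.exp (-(α * (s - p₀)))))
      (hasDerivAt_edge_q α c z.1) h1
    refine this.congr_of_eventuallyEq (Eventually.of_forall fun x => ?_)
    simp only [edgeBarrier]; ring
  · have := hasFDerivAt_sum_of_hasDerivAt (g := fun _ => 0) (g' := fun _ => 0)
      (f' := fun s => c * (-(α ^ 2 * Real.exp (-(α * s)))
        - α ^ 2 * Real.exp (-(α * (Real.pi - s)))))
      (hasDerivAt_edge_qq α c z.1) (hasDerivAt_const z.2 (0 : ℝ))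
    refine this.congr_of_eventuallyEq (Eventually.of_forall fun x => ?_)
    simp only [edgeBarrier, add_zero]
  · have h1 : HasDerivAt (fun s => c * (β * Real.exp (β * s) + α * Real.exp (-(α * (s - p₀)))))
        (c * (β ^ 2 * Real.exp (β * z.2) - α ^ 2 * Real.exp (-(α * (z.2 - p₀))))) z.2 :=
      ((((hasDerivAt_exp_const_mul β z.2).const_mul β).add
        ((hasDerivAt_exp_neg_mul_sub α p₀ z.2).const_mul α)).const_mul c).congr_deriv (by ring)
    have := hasFDerivAt_sum_of_hasDerivAt (f := fun _ => 0) (f' := fun _ => 0)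
      (g' := fun s => c * (β ^ 2 * Real.exp (β * s) - α ^ 2 * Real.exp (-(α * (s - p₀)))))
      (hasDerivAt_const z.1 (0 : ℝ)) h1
    refine this.congr_of_eventuallyEq (Eventually.of_forall fun x => ?_)
    simp only [edgeBarrier, zero_add]

end PlaneJet

lemma hasDerivAt_horizontal {f : ℝ × ℝ → ℝ} {a b s p : ℝ}
    (h : HasFDerivAt f (planeForm a b) (s, p)) : HasDerivAt (fun s => f (s, p)) a s := by
  have := h.comp_hasDerivAt s ((hasDerivAt_id s).prodMk (hasDerivAt_const s p))
  rw [planeForm_apply] at this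
  exact this.congr_deriv (by simp)

lemma hasDerivAt_vertical {f : ℝ × ℝ → ℝ} {a b s p : ℝ}
    (h : HasFDerivAt f (planeForm a b) (s, p)) : HasDerivAt (fun p => f (s, p)) b p := by
  have := h.comp_hasDerivAt p ((hasDerivAt_const p s).prodMk (hasDerivAt_id p))
  rw [planeForm_apply] at this
  exact this.congr_deriv (by simp)

lemma mul_exp_neg_le_one (x : ℝ) : x * Real.exp (-x) ≤ 1 := by
  rw [Real.exp_neg, mul_inv_le_iff₀ (Real.exp_pos x)]
  linarith [Real.add_one_le_exp x]

lemma exp_neg_one_third : (1 / 3 : ℝ) ≤ Real.exp (-1) := by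
  rw [Real.exp_neg, ← one_div]
  exact one_div_le_one_div_of_le (Real.exp_pos 1) (by linarith [Real.exp_one_lt_d9])

namespace PlaneJet

/-- With `S` the sum of the three exponentials in `hS`, concavity contributes at least `α² κ S`. In
`hακ`, `2 * C` absorbs the first-order terms of size `α S`, and `3 * D` absorbs everything free of
`α`, since `α S ≥ 1/3`. -/
lemma edgeBarrier_ellip_gt {p₀ α β C κ M D μ s p a b V : ℝ} (hα1 : 1 ≤ α) (hβ0 : 0 ≤ β)
    (hC : 0 ≤ C) (hD0 : 0 ≤ D) (hD : D = (1 + 2 * M ^ 2) * β ^ 2 + C * (5 + β))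
    (hακ : 2 * C + 3 * D + 1 ≤ κ * α) (hμ0 : 0 < μ) (hp : p < 0)
    (ha : κ ≤ a ^ 2) (hb : κ ≤ 1 + b ^ 2) (hb' : b ^ 2 ≤ 2 * M ^ 2)
    (hS : 1 / 3 ≤ Real.exp (-(α * s)) + Real.exp (-(α * (Real.pi - s)))
      + Real.exp (-(α * (p - p₀)))) (v1 : |V| ≤ μ * 5) :
    C * (|V| + |(edgeBarrier p₀ α β (-μ)).dq (s, p)| + |(edgeBarrier p₀ α β (-μ)).dp (s, p)|)
      < (edgeBarrier p₀ α β (-μ)).ellip a b (s, p) := by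
  have hα0 : 0 < α := by linarith
  set K := edgeBarrier p₀ α β (-μ) with hK
  set e1 := Real.exp (-(α * s)) with he1
  set e2 := Real.exp (-(α * (Real.pi - s))) with he2
  set e3 := Real.exp (-(α * (p - p₀))) with he3
  set e4 := Real.exp (β * p) with he4
  have f1 : 0 < e1 := Real.exp_pos _
  have f2 : 0 < e2 := Real.exp_pos _
  have f3 : 0 < e3 := Real.exp_pos _
  have f4 : 0 < e4 := Real.exp_pos _
  have hKdq : K.dq (s, p) = -μ * (α * e1 - α * e2) := rfl
  have hKdp : K.dp (s, p) = -μ * (β * e4 + α * e3) := rfl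
  have hKdqq : K.dqq (s, p) = -μ * (-(α ^ 2 * e1) - α ^ 2 * e2) := rfl
  have hKdpp : K.dpp (s, p) = -μ * (β ^ 2 * e4 - α ^ 2 * e3) := rfl
  have hKdqp : K.dqp (s, p) = 0 := rfl
  have he4' : e4 ≤ 1 := Real.exp_le_one_iff.mpr (mul_nonpos_of_nonneg_of_nonpos hβ0 hp.le)
  have v4 : K.ellip a b (s, p) = μ * (α ^ 2 * (a ^ 2 * (e1 + e2) + (1 + b ^ 2) * e3)
      - (1 + b ^ 2) * (β ^ 2 * e4)) := by
    simp only [ellip, hKdqq, hKdpp, hKdqp]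
    ring
  clear_value e1 e2 e3 e4 K
  have g1 := mul_pos hα0 f1
  have g2 := mul_pos hα0 f2
  have g3 := mul_pos hα0 f3
  have v2 : |K.dq (s, p)| ≤ μ * (α * (e1 + e2 + e3)) := by
    rw [hKdq, abs_mul, abs_neg, abs_of_pos hμ0]
    apply mul_le_mul_of_nonneg_left _ hμ0.le
    rw [abs_le]
    constructor <;> linarith
  have v3 : |K.dp (s, p)| ≤ μ * (β + α * (e1 + e2 + e3)) := by
    rw [hKdp, abs_mul, abs_neg, abs_of_pos hμ0]
    apply mul_le_mul_of_nonneg_left _ hμ0.le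
    have g4 := mul_nonneg hβ0 f4.le
    have g5 : β * e4 ≤ β * 1 := mul_le_mul_of_nonneg_left he4' hβ0
    rw [abs_of_nonneg (by linarith)]
    linarith
  have v5 : κ * (e1 + e2 + e3) ≤ a ^ 2 * (e1 + e2) + (1 + b ^ 2) * e3 := by
    have g1 := mul_le_mul_of_nonneg_right ha (by linarith : 0 ≤ e1 + e2)
    have g2 := mul_le_mul_of_nonneg_right hb f3.le
    linarith
  have v6 : (1 + b ^ 2) * (β ^ 2 * e4) ≤ (1 + 2 * M ^ 2) * β ^ 2 := by
    have g1 : β ^ 2 * e4 ≤ β ^ 2 * 1 := mul_le_mul_of_nonneg_left he4' (sq_nonneg β)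
    have g2 : 1 + b ^ 2 ≤ 1 + 2 * M ^ 2 := by linarith
    calc (1 + b ^ 2) * (β ^ 2 * e4) ≤ (1 + 2 * M ^ 2) * (β ^ 2 * 1) :=
          mul_le_mul g2 g1 (by positivity) (by positivity)
      _ = _ := by ring
  rw [v4]
  have hlt : C * (5 + α * (e1 + e2 + e3) + (β + α * (e1 + e2 + e3))) <
      α ^ 2 * (a ^ 2 * (e1 + e2) + (1 + b ^ 2) * e3) - (1 + b ^ 2) * (β ^ 2 * e4) := by
    set S := e1 + e2 + e3 with hSdef
    have hS0 : 0 < S := by linarith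
    have w1 : α ^ 2 * (κ * S) ≤ α ^ 2 * (a ^ 2 * (e1 + e2) + (1 + b ^ 2) * e3) :=
      mul_le_mul_of_nonneg_left v5 (by positivity)
    have w2 : (α * S) * (3 * D + 1) ≤ (α * S) * (κ * α - 2 * C) :=
      mul_le_mul_of_nonneg_left (by linarith) (by positivity)
    have w3 : 1 / 3 ≤ α * S := by
      have := mul_le_mul_of_nonneg_right hα1 hS0.le
      linarith
    have w4 : 1 / 3 * (3 * D + 1) ≤ α * S * (3 * D + 1) :=
      mul_le_mul_of_nonneg_right w3 (by linarith)
    have w5 : (α * S) * (κ * α - 2 * C) = α ^ 2 * (κ * S) - 2 * (C * (α * S)) := by ring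
    have w6 : C * (5 + α * S + (β + α * S)) = C * (5 + β) + 2 * (C * (α * S)) := by ring
    rw [w6]
    linarith
  calc C * (|V| + |K.dq (s, p)| + |K.dp (s, p)|)
      ≤ C * (μ * 5 + μ * (α * (e1 + e2 + e3)) + μ * (β + α * (e1 + e2 + e3))) := by gcongr
    _ = μ * (C * (5 + α * (e1 + e2 + e3) + (β + α * (e1 + e2 + e3)))) := by ring
    _ < _ := mul_lt_mul_of_pos_left hlt hμ0

end PlaneJet

namespace HeightSystem

variable {p₀ m M k σ : ℝ}

/-- The boundary operator at the top excludes contact with a barrier that is steep enough. -/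
lemma false_of_top_contact {E : ℝ} {A B : ℝ → ℝ} {X Y : PlaneJet}
    (HX : HeightSystem p₀ m M k σ E A B X) (HY : HeightSystem p₀ m M k σ E A B Y)
    (hm : 0 < m) (hp₀ : p₀ < 0) (hσ : σ ≤ 0) {L μ β q φ φ' : ℝ} (hμ : 0 < μ)
    (hβ : L / m ^ 2 + 5 * |k| + 4 * |σ| * M * L < β * m / M ^ 4) (hβ0 : 0 ≤ β)
    (hφ : φ ∈ Icc (0 : ℝ) 5)
    (hval : Y.val (q, 0) - X.val (q, 0) = -μ * φ)
    (hdq : Y.dq (q, 0) - X.dq (q, 0) = -μ * φ')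
    (hφ' : |X.dq (q, 0) + Y.dq (q, 0)| * |φ'| ≤ 2 * L)
    (hdp : Y.dp (q, 0) - X.dp (q, 0) ≤ -μ * β)
    (hdqq : 0 ≤ Y.dqq (q, 0) - X.dqq (q, 0)) : False := by
  have hz : (q, (0 : ℝ)).2 ∈ Ioc p₀ 0 := ⟨hp₀, le_refl 0⟩
  have htop := HX.top_diff HY q
  have lXp := HX.dp_lower (q, 0) hz
  have lYp := HY.dp_lower (q, 0) hz
  have uXp := HX.dp_upper (q, 0) hz
  have uYp := HY.dp_upper (q, 0) hz
  have bqq := HX.dqq_bound (q, 0) hz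
  rw [hval] at htop
  set Xp := X.dp (q, 0)
  set Yp := Y.dp (q, 0)
  set Xq := X.dq (q, 0)
  set Yq := Y.dq (q, 0)
  set Xqq := X.dqq (q, 0)
  set Yqq := Y.dqq (q, 0)
  have hM : 0 < M := by linarith
  have hXp : 0 < Xp := by linarith
  have hYp : 0 < Yp := by linarith
  have hsq : |Yq ^ 2 - Xq ^ 2| ≤ μ * (2 * L) := by
    have : Yq ^ 2 - Xq ^ 2 = (Yq - Xq) * (Xq + Yq) := by ring
    rw [this, hdq, abs_mul, abs_mul, abs_neg, abs_of_pos hμ, mul_assoc]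
    rw [mul_comm |φ'|]
    exact mul_le_mul_of_nonneg_left hφ' hμ.le
  have hL : 0 ≤ L := by
    have : 0 ≤ |Xq + Yq| * |φ'| := by positivity
    linarith
  have split : (1 + Yq ^ 2) / (2 * Yp ^ 2) - (1 + Xq ^ 2) / (2 * Xp ^ 2) =
      (1 + Yq ^ 2) * ((Xp - Yp) * (Xp + Yp) / (2 * (Xp ^ 2 * Yp ^ 2)))
        + (Yq ^ 2 - Xq ^ 2) / (2 * Xp ^ 2) := by
    field_simp
    ring
  have hμβ : 0 ≤ μ * β := by positivity
  -- The only term of definite sign proportional to `β`: the kinetic energy increases when `h_p`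
  -- decreases by `μ β`. The next estimates bound the slope, gravity and curvature-factor
  -- contributions by the three summands in `hβ`.
  have b1 : μ * (β * m / M ^ 4) ≤
      (1 + Yq ^ 2) * ((Xp - Yp) * (Xp + Yp) / (2 * (Xp ^ 2 * Yp ^ 2))) := by
    have e1 : μ * (β * m / M ^ 4) = (μ * β) * (2 * m) / (2 * (M ^ 2 * M ^ 2)) := by
      field_simp
    have e2 : (μ * β) * (2 * m) / (2 * (M ^ 2 * M ^ 2)) ≤
        (Xp - Yp) * (Xp + Yp) / (2 * (Xp ^ 2 * Yp ^ 2)) := by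
      have : 0 ≤ Xp - Yp := by linarith
      gcongr <;> linarith
    have e3 : 0 ≤ (Xp - Yp) * (Xp + Yp) / (2 * (Xp ^ 2 * Yp ^ 2)) := by
      have : 0 ≤ Xp - Yp := by linarith
      positivity
    rw [e1]
    nlinarith [mul_nonneg (sq_nonneg Yq) e3]
  have b2 : -(μ * (L / m ^ 2)) ≤ (Yq ^ 2 - Xq ^ 2) / (2 * Xp ^ 2) := by
    have e1 : |(Yq ^ 2 - Xq ^ 2) / (2 * Xp ^ 2)| ≤ μ * (2 * L) / (2 * m ^ 2) := by
      rw [abs_div, abs_of_pos (by positivity : 0 < 2 * Xp ^ 2)]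
      gcongr
    have e2 : μ * (2 * L) / (2 * m ^ 2) = μ * (L / m ^ 2) := by field_simp
    have := (abs_le.mp e1).1
    linarith
  have b3 : -(μ * (5 * |k|)) ≤ k * (-μ * φ) := by
    have e1 : |k * (-μ * φ)| ≤ |k| * (μ * 5) := by
      rw [abs_mul, abs_mul, abs_neg, abs_of_pos hμ, abs_of_nonneg hφ.1]
      have := hφ.2
      gcongr
    have := (abs_le.mp e1).1
    linarith
  have b4 : 0 ≤ -σ * ((Yqq - Xqq) * curvatureFactor (Yq ^ 2)) :=
    mul_nonneg (by linarith) (mul_nonneg hdqq (curvatureFactor_pos (sq_nonneg _)).le)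
  have b5 : -(μ * (4 * |σ| * M * L)) ≤
      -σ * (Xqq * (curvatureFactor (Yq ^ 2) - curvatureFactor (Xq ^ 2))) := by
    have e0 := curvatureFactor_lipschitz (sq_nonneg Yq) (sq_nonneg Xq)
    have e1 : |-σ * (Xqq * (curvatureFactor (Yq ^ 2) - curvatureFactor (Xq ^ 2)))| ≤
        |σ| * (M * (2 * (μ * (2 * L)))) := by
      rw [abs_mul, abs_mul, abs_neg]
      gcongr
      linarith
    have := (abs_le.mp e1).1
    linarith
  have b6 := mul_lt_mul_of_pos_left hβ hμ
  rw [split] at htop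
  linarith

set_option maxHeartbeats 800000 in
/-- Maximum principle in a neighbourhood of the bottom and lateral sides of the rectangle, of a
width that depends only on the bounds for the solutions. -/
lemma exists_narrow_comparison (hm : 0 < m) (hM : 0 ≤ M) (hp₀ : p₀ < 0) (hσ : σ ≤ 0) (k : ℝ)
    {L : ℝ} (hL : 0 ≤ L) :
    ∃ ε > 0, ∀ {E : ℝ} {A B : ℝ → ℝ} {X Y : PlaneJet}, HeightSystem p₀ m M k σ E A B X →
      HeightSystem p₀ m M k σ E A B Y →
      (∀ p ∈ Icc p₀ 0, X.val (0, p) = Y.val (0, p)) →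
      (∀ p ∈ Icc p₀ 0, X.val (Real.pi, p) = Y.val (Real.pi, p)) →
      (∀ s ∈ Icc 0 Real.pi, |X.dq (s, 0) + Y.dq (s, 0)| ≤ L * s ∧
        |X.dq (s, 0) + Y.dq (s, 0)| ≤ L * (Real.pi - s)) →
      (∀ s ∈ Icc ε (Real.pi - ε), ∀ p ∈ Icc (p₀ + ε) 0, X.val (s, p) ≤ Y.val (s, p)) →
      ∀ s ∈ Icc 0 Real.pi, ∀ p ∈ Icc p₀ 0, X.val (s, p) ≤ Y.val (s, p) := by
  -- The order of choice matters: `β` makes the barrier steep enough at the top and must not depend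
  -- on `α`, while `α` is chosen after `β` to dominate in the interior. The width `ε` is `1 / α`.
  set G := L / m ^ 2 + 5 * |k| + 4 * |σ| * M * L with hG
  have hG0 : 0 ≤ G := by positivity
  set β := M ^ 4 * (G + 1) / m with hβ
  have hβ0 : 0 ≤ β := by positivity
  set C := diffConst m M with hCdef
  have hC : 0 ≤ C := diffConst_nonneg hm hM
  set κ := ellipConst m M with hκdef
  have hκ : 0 < κ := ellipConst_pos hm M
  set D := (1 + 2 * M ^ 2) * β ^ 2 + C * (5 + β) with hD
  have hD0 : 0 ≤ D := by positivity
  set α := 1 + (2 * C + 3 * D + 1) / κ with hα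
  have hα1 : 1 ≤ α := by
    have : 0 ≤ (2 * C + 3 * D + 1) / κ := by positivity
    linarith
  have hακ : 2 * C + 3 * D + 1 ≤ κ * α := by
    have : κ * α = κ + (2 * C + 3 * D + 1) := by rw [hα]; field_simp
    linarith
  have hα0 : 0 < α := by linarith
  clear_value α D
  refine ⟨1 / α, by positivity, ?_⟩
  intro E A B X Y HX HY hside0 hsidepi hslope hinner
  have hβG : G < β * m / M ^ 4 := by
    have hM0 : 0 < M := by
      have h1 := HX.dp_lower (0, 0) ⟨hp₀, le_refl 0⟩
      have h2 := HX.dp_upper (0, 0) ⟨hp₀, le_refl 0⟩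
      linarith
    have : β * m / M ^ 4 = G + 1 := by rw [hβ]; field_simp
    linarith
  set Rect := Icc 0 Real.pi ×ˢ Icc p₀ 0 with hRect
  set φ := (PlaneJet.edgeBarrier p₀ α β 1).val with hφ
  have hφe : ∀ z, φ z = 4 + Real.exp (β * z.2) - Real.exp (-(α * z.1))
      - Real.exp (-(α * (Real.pi - z.1))) - Real.exp (-(α * (z.2 - p₀))) := fun z => by
    simp [hφ, PlaneJet.edgeBarrier]
  -- The constant `4` outweighs the three subtracted exponentials, each at most `1` on the
  -- rectangle.
  have hφpos : ∀ z ∈ Rect, 1 ≤ φ z ∧ φ z ≤ 5 := by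
    rintro z ⟨⟨h1, h2⟩, h3, h4⟩
    rw [hφe]
    have e1 : Real.exp (-(α * z.1)) ≤ 1 :=
      Real.exp_le_one_iff.mpr (neg_nonpos.mpr (mul_nonneg hα0.le h1))
    have e2 : Real.exp (-(α * (Real.pi - z.1))) ≤ 1 :=
      Real.exp_le_one_iff.mpr (neg_nonpos.mpr (mul_nonneg hα0.le (by linarith)))
    have e3 : Real.exp (-(α * (z.2 - p₀))) ≤ 1 :=
      Real.exp_le_one_iff.mpr (neg_nonpos.mpr (mul_nonneg hα0.le (by linarith)))
    have e4 : Real.exp (β * z.2) ≤ 1 :=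
      Real.exp_le_one_iff.mpr (mul_nonpos_of_nonneg_of_nonpos hβ0 h4)
    have f1 := Real.exp_pos (-(α * z.1))
    have f2 := Real.exp_pos (-(α * (Real.pi - z.1)))
    have f3 := Real.exp_pos (-(α * (z.2 - p₀)))
    have f4 := Real.exp_pos (β * z.2)
    constructor <;> linarith
  have hφcont : Continuous φ := by
    simp only [hφ, PlaneJet.edgeBarrier]; fun_prop
  have hwcont : ContinuousOn (Y.sub X).val Rect :=
    (HX.continuousOn_sub HY).mono fun z hz => hz.2
  have hcomp : IsCompact Rect := isCompact_Icc.prod isCompact_Icc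
  -- Minimising the quotient `(Y - X) / φ` scales the barrier so that `-μ φ` touches `Y - X` from
  -- below; it remains to exclude `μ > 0`.
  obtain ⟨z, hz, hzmin⟩ := hcomp.exists_isMinOn
    ⟨(0, 0), ⟨le_refl 0, Real.pi_pos.le⟩, hp₀.le, le_refl 0⟩
    (hwcont.div hφcont.continuousOn fun z hz => by have := (hφpos z hz).1; positivity)
  set μ := -((Y.sub X).val z / φ z) with hμ
  have hφz := hφpos z hz
  have hzval : (Y.sub X).val z = -μ * φ z := by rw [hμ, neg_neg, div_mul_cancel₀]; linarith
  have hall : ∀ y ∈ Rect, -μ * φ y ≤ (Y.sub X).val y := by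
    intro y hy
    have h1 : (Y.sub X).val z / φ z ≤ (Y.sub X).val y / φ y := hzmin hy
    have h2 : -μ = (Y.sub X).val z / φ z := by rw [hμ]; ring
    rw [h2]
    have h3 := (hφpos y hy).1
    rwa [le_div_iff₀ (by linarith)] at h1
  rcases le_or_gt μ 0 with hμ0 | hμ0
  · intro s hs p hp
    have h1 := hall (s, p) ⟨hs, hp⟩
    have h2 := (hφpos (s, p) ⟨hs, hp⟩).1
    have : 0 ≤ (Y.sub X).val (s, p) := le_trans (mul_nonneg (by linarith) (by linarith)) h1
    exact sub_nonneg.mp this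
  exfalso
  have hneg : (Y.sub X).val z < 0 := by
    rw [hzval]
    exact mul_neg_of_neg_of_pos (neg_lt_zero.mpr hμ0) (by linarith)
  have hnegs : Y.val z - X.val z < 0 := hneg
  obtain ⟨s, p⟩ := z
  obtain ⟨⟨hs0, hspi⟩, hp1, hp2⟩ := hz
  simp only at hs0 hspi hp1 hp2
  have hs0' : 0 < s := by
    refine lt_of_le_of_ne hs0 fun h => ?_
    subst h
    have := hside0 p ⟨hp1, hp2⟩
    linarith
  have hspi' : s < Real.pi := by
    refine lt_of_le_of_ne hspi fun h => ?_
    subst h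
    have := hsidepi p ⟨hp1, hp2⟩
    linarith
  have hp1' : p₀ < p := by
    refine lt_of_le_of_ne hp1 fun h => ?_
    subst h
    have := HX.bed s
    have := HY.bed s
    linarith
  set K := PlaneJet.edgeBarrier p₀ α β (-μ) with hK
  have hKval : ∀ y, K.val y = -μ * φ y := fun y => by
    rw [hφe]; simp only [hK, PlaneJet.edgeBarrier]
  have hKv : ∀ y, K.ValidAt y := fun y => PlaneJet.edgeBarrier_validAt _ _ _ _ y
  set e1 := Real.exp (-(α * s)) with he1
  set e2 := Real.exp (-(α * (Real.pi - s))) with he2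
  set e3 := Real.exp (-(α * (p - p₀))) with he3
  set e4 := Real.exp (β * p) with he4
  have f1 : 0 < e1 := Real.exp_pos _
  have f2 : 0 < e2 := Real.exp_pos _
  have f3 : 0 < e3 := Real.exp_pos _
  have f4 : 0 < e4 := Real.exp_pos _
  have hKdq : K.dq (s, p) = -μ * (α * e1 - α * e2) := rfl
  have hKdp : K.dp (s, p) = -μ * (β * e4 + α * e3) := rfl
  have hKdqq : K.dqq (s, p) = -μ * (-(α ^ 2 * e1) - α ^ 2 * e2) := rfl
  have hKdpp : K.dpp (s, p) = -μ * (β ^ 2 * e4 - α ^ 2 * e3) := rfl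
  rcases lt_or_eq_of_le hp2 with hp2' | hp2'
  · have hnb : ∀ᶠ y in 𝓝 (s, p), y ∈ Ioo 0 Real.pi ×ˢ Ioo p₀ 0 :=
      (isOpen_Ioo.prod isOpen_Ioo).mem_nhds ⟨⟨hs0', hspi'⟩, hp1', hp2'⟩
    refine PlaneJet.Supersol.false_of_touching (J := Y.sub X) (K := K) (κ := κ) (N := 2 * M ^ 2)
      (C := C) (z := (s, p)) (hnb.mono fun y hy => HX.supersol_sub HY hm hy.2)
      (Eventually.of_forall hKv) ?_ ?_
    · filter_upwards [hnb] with y hy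
      rw [hKval, hKval, hzval, sub_self]
      exact sub_nonneg.mpr (hall y ⟨⟨hy.1.1.le, hy.1.2.le⟩, hy.2.1.le, hy.2.2.le⟩)
    · intro a b hab hN
      have ha : κ ≤ a ^ 2 := by simpa using hab 1 0
      have hb : κ ≤ 1 + b ^ 2 := by simpa using hab 0 1
      -- The contact point lies outside the core, hence within `1 / α` of a side or the bed, where
      -- one exponential is at least `e⁻¹`.
      have hS : 1 / 3 ≤ e1 + e2 + e3 := by
        have hor : s < 1 / α ∨ Real.pi - 1 / α < s ∨ p < p₀ + 1 / α := by
          by_contra hcon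
          push Not at hcon
          have := hinner s ⟨hcon.1, hcon.2.1⟩ p ⟨hcon.2.2, hp2⟩
          linarith
        have hexp : ∀ d : ℝ, d < 1 / α → 1 / 3 ≤ Real.exp (-(α * d)) := fun d hd => by
          refine exp_neg_one_third.trans (Real.exp_le_exp.mpr ?_)
          rw [lt_div_iff₀ hα0] at hd
          linarith
        rcases hor with h | h | h
        · have := hexp s h
          linarith
        · have := hexp (Real.pi - s) (by linarith)
          linarith
        · have := hexp (p - p₀) (by linarith)
          linarith
      refine PlaneJet.edgeBarrier_ellip_gt hα1 hβ0 hC hD0 hD hακ hμ0 hp2' ha hb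
        (by linarith [sq_nonneg a]) hS ?_
      rw [hzval, abs_mul, abs_neg, abs_of_pos hμ0, abs_of_pos (by linarith)]
      exact mul_le_mul_of_nonneg_left hφz.2 hμ0.le
  · subst hp2'
    have he4' : e4 = 1 := by simp [he4]
    obtain ⟨t1, t2⟩ := HX.top_touching HY (f := fun s => K.val (s, 0)) (f' := fun s => K.dq (s, 0))
      (f'' := K.dqq (s, 0)) (q := s) (fun q => hasDerivAt_horizontal (hKv (q, 0)).val)
      (hasDerivAt_horizontal (hKv (s, 0)).dq) (by
        filter_upwards [Ioo_mem_nhds hs0' hspi'] with x hx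
        have h1 := hall (x, 0) ⟨⟨hx.1.le, hx.2.le⟩, hp₀.le, le_refl 0⟩
        simp only [hKval]
        simp only [PlaneJet.sub] at h1 hzval
        linarith)
    have t3 : 0 ≤ -Y.dp (s, 0) - -X.dp (s, 0) + K.dp (s, 0) := by
      have hKd : HasDerivWithinAt (fun t => K.val (s, -t)) (-K.dp (s, 0)) (Ici 0) 0 := by
        have h1 := hasDerivAt_vertical (hKv (s, -0)).val
        have h2 := HasDerivAt.scomp (0 : ℝ) h1 (hasDerivAt_neg (0 : ℝ))
        exact (h2.congr_deriv (by simp)).hasDerivWithinAt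
      have := HasDerivAt.le_of_le_right (k := 0)
        (((HY.hasDerivWithinAt_down s).sub (HX.hasDerivWithinAt_down s)).sub hKd) (by
        filter_upwards [Ioo_mem_nhdsGT (show (0 : ℝ) < -p₀ by linarith)] with t ht
        have h1 := hall (s, -t) ⟨⟨hs0, hspi⟩, by linarith [ht.2], by linarith [ht.1]⟩
        simp only [Pi.sub_apply, neg_zero, hKval]
        simp only [PlaneJet.sub] at h1 hzval
        linarith)
      linarith
    refine HX.false_of_top_contact HY hm hp₀ hσ (L := L) (μ := μ) (β := β) (q := s) (φ := φ (s, 0))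
      (φ' := α * e1 - α * e2) hμ0 hβG hβ0 ⟨by linarith [hφz.1], hφz.2⟩ hzval (by rw [t1, hKdq])
      ?_ ?_ ?_
    -- The tangential slope of the barrier may be as large as `α`, but `X_q + Y_q` vanishes linearly
    -- at the corners and `α s exp(-α s) ≤ 1`, so the product is bounded independently of `α`.
    · obtain ⟨l1, l2⟩ := hslope s ⟨hs0, hspi⟩
      set T := |X.dq (s, 0) + Y.dq (s, 0)| with hT
      have hT0 : 0 ≤ T := abs_nonneg _
      have g1 := mul_exp_neg_le_one (α * s)
      have g2 := mul_exp_neg_le_one (α * (Real.pi - s))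
      rw [← he1] at g1
      rw [← he2] at g2
      have k1 : T * (α * e1) ≤ L := by
        calc T * (α * e1) ≤ L * s * (α * e1) := by gcongr
          _ = L * (α * s * e1) := by ring
          _ ≤ L * 1 := by gcongr
          _ = L := mul_one L
      have k2 : T * (α * e2) ≤ L := by
        calc T * (α * e2) ≤ L * (Real.pi - s) * (α * e2) := by gcongr
          _ = L * (α * (Real.pi - s) * e2) := by ring
          _ ≤ L * 1 := by gcongr
          _ = L := mul_one L
      have k3 : |α * e1 - α * e2| ≤ α * e1 + α * e2 := by
        have := mul_pos hα0 f1
        have := mul_pos hα0 f2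
        rw [abs_le]; constructor <;> linarith
      calc T * |α * e1 - α * e2| ≤ T * (α * e1 + α * e2) := by gcongr
        _ ≤ 2 * L := by linarith
    · rw [hKdp, he4'] at t3
      have := mul_pos hα0 f3
      nlinarith
    · rw [hKdqq] at t2
      have : 0 ≤ μ * (α ^ 2 * e1 + α ^ 2 * e2) := by positivity
      linarith

end HeightSystem

/-! ### Moving planes. -/

/-- Every curve `p = const` of the family rises from the trough line `-π` to the crest line `xc`
and then falls to the trough line `π`, strictly near the trough lines if `p ≠ p₀`. -/
structure CrestedProfile (p₀ xc : ℝ) (u : ℝ → ℝ → ℝ) : Prop where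
  crest : xc ∈ Ioo (-Real.pi) Real.pi
  rises : ∀ p ∈ Icc p₀ 0, ∀ a b, -Real.pi ≤ a → a ≤ b → b ≤ xc → u a p ≤ u b p
  falls : ∀ p ∈ Icc p₀ 0, ∀ a b, xc ≤ a → a ≤ b → b ≤ Real.pi → u b p ≤ u a p
  strict : ∀ p ∈ Ioc p₀ 0, ∃ δ > 0,
    (∀ a b, -Real.pi ≤ a → a < b → b ≤ -Real.pi + δ → u a p < u b p) ∧
    (∀ a b, Real.pi - δ ≤ a → a < b → b ≤ Real.pi → u b p < u a p)
  periodic : ∀ q, ∀ p ∈ Icc p₀ 0, u (q + 2 * Real.pi) p = u q p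

namespace CrestedProfile

variable {p₀ xc : ℝ} {u : ℝ → ℝ → ℝ}

lemma reflect (P : CrestedProfile p₀ xc u) :
    CrestedProfile p₀ (-xc) (fun q p => u (-q) p) where
  crest := ⟨by linarith [P.crest.2], by linarith [P.crest.1]⟩
  rises p hp a b h1 h2 h3 := P.falls p hp (-b) (-a) (by linarith) (by linarith) (by linarith)
  falls p hp a b h1 h2 h3 := P.rises p hp (-b) (-a) (by linarith) (by linarith) (by linarith)
  strict p hp := by
    obtain ⟨δ, hδ, h1, h2⟩ := P.strict p hp
    exact ⟨δ, hδ, fun a b ha hab hb => h2 (-b) (-a) (by linarith) (by linarith) (by linarith),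
      fun a b ha hab hb => h1 (-b) (-a) (by linarith) (by linarith) (by linarith)⟩
  periodic q p hp := by
    have := P.periodic (-(q + 2 * Real.pi)) p hp
    rw [← this]
    ring_nf

/-- Strictness near the trough followed by weak monotonicity up to the crest, from whichever trough
lies on the same side of the crest as `q`. -/
lemma trough_lt (P : CrestedProfile p₀ xc u) {q p : ℝ} (hp : p ∈ Ioc p₀ 0)
    (hq : q ∈ Ioo (-Real.pi) Real.pi) : u (-Real.pi) p < u q p := by
  obtain ⟨δ, hδ, h1, h2⟩ := P.strict p hp
  have hp' : p ∈ Icc p₀ 0 := ⟨hp.1.le, hp.2⟩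
  rcases le_total q xc with h | h
  · have a1 := min_le_left q (-Real.pi + δ)
    have a2 := min_le_right q (-Real.pi + δ)
    have a3 : -Real.pi < min q (-Real.pi + δ) := lt_min hq.1 (by linarith)
    exact (h1 _ _ (le_refl _) a3 a2).trans_le (P.rises p hp' _ _ a3.le a1 h)
  · have a1 := le_max_left q (Real.pi - δ)
    have a2 := le_max_right q (Real.pi - δ)
    have a3 : max q (Real.pi - δ) < Real.pi := max_lt hq.2 (by linarith)
    have h3 := P.periodic (-Real.pi) p hp'
    rw [show -Real.pi + 2 * Real.pi = Real.pi by ring] at h3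
    rw [← h3]
    exact (h2 _ _ a2 a3 (le_refl _)).trans_le (P.falls p hp' _ _ h a1 a3.le)

end CrestedProfile

/-- The reflection in the line `q = l` does not lie above the profile to the right of the line. -/
def ReflectionBelow (p₀ : ℝ) (u : ℝ → ℝ → ℝ) (l : ℝ) : Prop :=
  ∀ s ∈ Icc 0 Real.pi, ∀ p ∈ Icc p₀ 0, u (l - s) p ≤ u (l + s) p

namespace HeightSystem

variable {p₀ m M k σ E xc : ℝ} {A B : ℝ → ℝ} {h : PlaneJet}

/-- Clamping `p` to the strip gives a continuous function on the whole plane, so compactness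
arguments need no relative neighbourhoods. -/
lemma continuous_clamp (H : HeightSystem p₀ m M k σ E A B h) (hp₀ : p₀ < 0) :
    Continuous fun z : ℝ × ℝ => h.val (z.1, max p₀ (min z.2 0)) :=
  H.cont.comp_continuous (by fun_prop)
    fun z => ⟨le_max_left _ _, max_le hp₀.le (min_le_right _ _)⟩

lemma clamp_eq {p : ℝ} (hp : p ∈ Icc p₀ 0) : max p₀ (min p 0) = p := by
  rw [min_eq_left hp.2, max_eq_right hp.1]

lemma continuous_horizontal (H : HeightSystem p₀ m M k σ E A B h) {p : ℝ} (hp : p ∈ Icc p₀ 0) :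
    Continuous fun q => h.val (q, p) :=
  H.cont.comp_continuous (by fun_prop) fun _ => hp

lemma top_slope_lipschitz (H : HeightSystem p₀ m M k σ E A B h) (hp₀ : p₀ < 0) (a b : ℝ) :
    |h.dq (a, 0) - h.dq (b, 0)| ≤ M * |a - b| :=
  convex_univ.norm_image_sub_le_of_norm_hasDerivWithin_le
    (f := fun q => h.dq (q, 0)) (f' := fun q => h.dqq (q, 0))
    (fun x _ => (H.top_dqq x).hasDerivWithinAt)
    (fun x _ => H.dqq_bound (x, 0) ⟨hp₀, le_refl 0⟩) (mem_univ b) (mem_univ a)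

lemma top_slope_periodic (H : HeightSystem p₀ m M k σ E A B h) (hp₀ : p₀ < 0) (q : ℝ) :
    h.dq (q + 2 * Real.pi, 0) = h.dq (q, 0) := by
  have h1 := (H.top_dq (q + 2 * Real.pi)).comp_add_const q (2 * Real.pi)
  have h2 : (fun q => h.val (q + 2 * Real.pi, 0)) = fun q => h.val (q, 0) :=
    funext fun q => H.periodic q 0 ⟨hp₀.le, le_refl 0⟩
  rw [h2] at h1
  exact h1.unique (H.top_dq q)

/-- The profile and its mirror image, written in the distance `s` from the line, solve the same
system, so `sub_pos` applies. -/
lemma reflection_lt (H : HeightSystem p₀ m M k σ E A B h) (hm : 0 < m) (hp₀ : p₀ < 0)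
    (hσ : σ ≤ 0) {l : ℝ} (hl : ReflectionBelow p₀ (fun q p => h.val (q, p)) l)
    (hne : ∃ s ∈ Ioo 0 Real.pi, ∃ p ∈ Ioo p₀ 0, h.val (l - s, p) ≠ h.val (l + s, p)) :
    ∀ s ∈ Ioo 0 Real.pi, ∀ p ∈ Ioc p₀ 0, h.val (l - s, p) < h.val (l + s, p) :=
  (H.translate l).reflect.sub_pos (H.translate l) hm hp₀ hσ (a := 0) (b := Real.pi)
    (fun s hs p hp => hl s ⟨hs.1.le, hs.2.le⟩ p hp) hne

/-- Strict inequality on the compact core survives small changes of `l`, and the comparison near the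
edges fills in the rest. The core can be fixed in advance because `ε` depends on the uniform bounds
only. -/
lemma eventually_reflectionBelow (H : HeightSystem p₀ m M k σ E A B h) (hm : 0 < m) (hp₀ : p₀ < 0)
    (hσ : σ ≤ 0) {l : ℝ} (hl : ReflectionBelow p₀ (fun q p => h.val (q, p)) l)
    (hne : ∃ s ∈ Ioo 0 Real.pi, ∃ p ∈ Ioo p₀ 0, h.val (l - s, p) ≠ h.val (l + s, p)) :
    ∀ᶠ l' in 𝓝 l, ReflectionBelow p₀ (fun q p => h.val (q, p)) l' := by
  have hpos := H.reflection_lt hm hp₀ hσ hl hne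
  have hM := H.M_nonneg hp₀
  obtain ⟨ε, hε, hnarrow⟩ := exists_narrow_comparison hm hM hp₀ hσ k
    (L := 2 * M) (by positivity)
  have hK : IsCompact (Icc ε (Real.pi - ε) ×ˢ Icc (p₀ + ε) 0) := isCompact_Icc.prod isCompact_Icc
  have hev : ∀ᶠ l' in 𝓝 l, ∀ z ∈ Icc ε (Real.pi - ε) ×ˢ Icc (p₀ + ε) 0,
      h.val (l' - z.1, max p₀ (min z.2 0)) < h.val (l' + z.1, max p₀ (min z.2 0)) := by
    refine hK.eventually_forall_of_forall_eventually fun z hz => ?_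
    have hc := H.continuous_clamp hp₀
    have c1 : Continuous fun y : ℝ × ℝ × ℝ => h.val (y.1 - y.2.1, max p₀ (min y.2.2 0)) :=
      hc.comp (f := fun y : ℝ × ℝ × ℝ => (y.1 - y.2.1, y.2.2)) (by fun_prop)
    have c2 : Continuous fun y : ℝ × ℝ × ℝ => h.val (y.1 + y.2.1, max p₀ (min y.2.2 0)) :=
      hc.comp (f := fun y : ℝ × ℝ × ℝ => (y.1 + y.2.1, y.2.2)) (by fun_prop)
    refine c1.continuousAt.eventually_lt c2.continuousAt ?_
    simp only
    have hz1 := hz.1.1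
    have hz2 := hz.1.2
    have hz3 := hz.2.1
    have hz4 := hz.2.2
    rw [clamp_eq ⟨by linarith, hz4⟩]
    exact hpos z.1 ⟨by linarith, by linarith⟩ z.2 ⟨by linarith, hz4⟩
  filter_upwards [hev] with l' hl'
  refine hnarrow (H.translate l').reflect (H.translate l') (fun p _ => ?_) (fun p hp => ?_)
    (fun s hs => ?_) (fun s hs p hp => ?_)
  · simp [PlaneJet.reflect, PlaneJet.translate]
  · have := H.periodic (l' - Real.pi) p hp
    simp only [PlaneJet.reflect, PlaneJet.translate]
    rw [← sub_eq_add_neg, ← this]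
    ring_nf
  -- Reflection changes the sign of the slope, so the sum of slopes is a difference of `h_q` at two
  -- points a distance `2s` apart or, by periodicity, `2π - 2s`; hence `L = 2M`.
  · simp only [PlaneJet.reflect, PlaneJet.translate]
    have h1 := H.top_slope_lipschitz hp₀ (l' + s) (l' + -s)
    have h2 := H.top_slope_lipschitz hp₀ (l' + s) (l' + -s + 2 * Real.pi)
    rw [H.top_slope_periodic hp₀] at h2
    rw [neg_add_eq_sub]
    constructor
    · refine h1.trans (le_of_eq ?_)
      rw [abs_of_nonneg (by linarith [hs.1])]
      ring
    · refine h2.trans (le_of_eq ?_)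
      rw [abs_of_nonpos (by linarith [hs.2])]
      ring
  · have h1 := hl' (s, p) ⟨hs, hp⟩
    simp only at h1
    rw [clamp_eq ⟨by linarith [hp.1], hp.2⟩] at h1
    exact h1.le

lemma isClosed_reflectionBelow (H : HeightSystem p₀ m M k σ E A B h) :
    IsClosed {l | ReflectionBelow p₀ (fun q p => h.val (q, p)) l} := by
  have : {l | ReflectionBelow p₀ (fun q p => h.val (q, p)) l} =
      ⋂ s ∈ Icc 0 Real.pi, ⋂ p ∈ Icc p₀ 0, {l | h.val (l - s, p) ≤ h.val (l + s, p)} := by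
    ext l
    simp only [ReflectionBelow, mem_iInter]
    rfl
  rw [this]
  refine isClosed_biInter fun s _ => isClosed_biInter fun p hp => ?_
  exact isClosed_le ((H.continuous_horizontal hp).comp (continuous_id.sub continuous_const))
    ((H.continuous_horizontal hp).comp (continuous_id.add continuous_const))

/-- For `s = l + π` one point is on the trough line and its mirror image is strictly between two
troughs. -/
lemma exists_reflection_ne (hp₀ : p₀ < 0) (P : CrestedProfile p₀ xc fun q p => h.val (q, p))
    {l : ℝ} (hl : l ∈ Ioo (-Real.pi) 0) :
    ∃ s ∈ Ioo 0 Real.pi, ∃ p ∈ Ioo p₀ 0, h.val (l - s, p) ≠ h.val (l + s, p) := by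
  refine ⟨l + Real.pi, ⟨by linarith [hl.1], by linarith [hl.2]⟩, p₀ / 2,
    ⟨by linarith, by linarith⟩, ?_⟩
  have := P.trough_lt (q := l + (l + Real.pi)) (p := p₀ / 2) ⟨by linarith, by linarith⟩
    ⟨by linarith [hl.1], by linarith [hl.2]⟩
  rw [show l - (l + Real.pi) = -Real.pi by ring]
  exact this.ne

lemma eqOn_reflection (H : HeightSystem p₀ m M k σ E A B h) (hm : 0 < m) (hp₀ : p₀ < 0)
    (hσ : σ ≤ 0) (P : CrestedProfile p₀ xc fun q p => h.val (q, p)) (hxc : 0 ≤ xc) :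
    ∀ s ∈ Ioo 0 Real.pi, ∀ p ∈ Ioo p₀ 0, h.val (0 - s, p) = h.val (0 + s, p) := by
  -- This line is midway between the trough `-π` and the crest. Until `l - s` reaches the trough
  -- both points are on the rising side; afterwards `l - s + 2π` and `l + s` are both on the falling
  -- side.
  have hstart : ReflectionBelow p₀ (fun q p => h.val (q, p)) ((xc - Real.pi) / 2) := by
    intro s hs p hp
    have c1 := P.crest.1
    have c2 := P.crest.2
    have s1 := hs.1
    have s2 := hs.2
    rcases le_total s ((xc - Real.pi) / 2 + Real.pi) with h1 | h1
    · exact P.rises p hp _ _ (by linarith) (by linarith) (by linarith)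
    · have := P.periodic ((xc - Real.pi) / 2 - s) p hp
      simp only at this ⊢
      rw [← this]
      exact P.falls p hp _ _ (by linarith) (by linarith) (by linarith)
  have hzero : ReflectionBelow p₀ (fun q p => h.val (q, p)) 0 := by
    have hsub : Icc ((xc - Real.pi) / 2) 0 ⊆
        {l | ReflectionBelow p₀ (fun q p => h.val (q, p)) l} := by
      -- Continuity method: the admissible set is closed and, below `0`, extends to the right of
      -- each of its points.
      refine (H.isClosed_reflectionBelow.inter isClosed_Icc).Icc_subset_of_forall_exists_gt
        hstart ?_
      rintro l ⟨hl, hl1, hl2⟩ y hy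
      have hev := H.eventually_reflectionBelow hm hp₀ hσ hl
        (exists_reflection_ne hp₀ P ⟨by linarith [P.crest.1], hl2⟩)
      have hev' : ∀ᶠ l' in 𝓝[>] l, l' ∈ {l | ReflectionBelow p₀ (fun q p => h.val (q, p)) l} ∧
          l' ∈ Ioc l y := (hev.filter_mono nhdsWithin_le_nhds).and (Ioc_mem_nhdsGT hy)
      exact hev'.exists
    exact hsub ⟨by linarith [P.crest.2], le_refl 0⟩
  by_contra hcon
  push Not at hcon
  have hev := H.eventually_reflectionBelow hm hp₀ hσ hzero hcon
  obtain ⟨δ, hδ, hleft, -⟩ := P.strict 0 ⟨hp₀, le_refl 0⟩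
  have hev' : ∀ᶠ l in 𝓝[>] (0 : ℝ), ReflectionBelow p₀ (fun q p => h.val (q, p)) l ∧
      l ∈ Ioo 0 (min (δ / 2) Real.pi) := (hev.filter_mono nhdsWithin_le_nhds).and
        (Ioo_mem_nhdsGT (lt_min (half_pos hδ) Real.pi_pos))
  obtain ⟨l, hl, hl0, hl1⟩ := hev'.exists
  have hlδ := hl1.trans_le (min_le_left _ _)
  have hlπ := hl1.trans_le (min_le_right _ _)
  -- With `s = π - l/2` the two points are, modulo `2π`, `-π + 3l/2` and `-π + l/2`. Both are in the
  -- strictly rising zone, and the inequality has the wrong sign.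
  have h1 := hl (Real.pi - l / 2) ⟨by linarith, by linarith⟩ 0 ⟨hp₀.le, le_refl 0⟩
  have h2 := hleft (-Real.pi + l / 2) (-Real.pi + 3 * l / 2) (by linarith) (by linarith)
  have h3 := P.periodic (-Real.pi + l / 2) 0 ⟨hp₀.le, le_refl 0⟩
  simp only at h1 h2 h3
  rw [show l - (Real.pi - l / 2) = -Real.pi + 3 * l / 2 by ring,
    show l + (Real.pi - l / 2) = -Real.pi + l / 2 + 2 * Real.pi by ring, h3] at h1
  linarith [h2 (by linarith)]

lemma even_of_crest_nonneg (H : HeightSystem p₀ m M k σ E A B h) (hm : 0 < m) (hp₀ : p₀ < 0)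
    (hσ : σ ≤ 0) (P : CrestedProfile p₀ xc fun q p => h.val (q, p)) (hxc : 0 ≤ xc) (q : ℝ) {p : ℝ}
    (hp : p ∈ Icc p₀ 0) : h.val (-q, p) = h.val (q, p) := by
  have h0 := H.eqOn_reflection hm hp₀ hσ P hxc
  have hcl : closure (Ioo 0 Real.pi ×ˢ Ioo p₀ 0) = Icc 0 Real.pi ×ˢ Icc p₀ 0 := by
    rw [closure_prod_eq, closure_Ioo Real.pi_pos.ne, closure_Ioo hp₀.ne]
  have h1 : EqOn (fun z : ℝ × ℝ => h.val (-z.1, max p₀ (min z.2 0)))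
      (fun z : ℝ × ℝ => h.val (z.1, max p₀ (min z.2 0))) (Icc 0 Real.pi ×ˢ Icc p₀ 0) := by
    rw [← hcl]
    refine EqOn.closure (fun z hz => ?_)
      ((H.continuous_clamp hp₀).comp (f := fun z : ℝ × ℝ => (-z.1, z.2)) (by fun_prop))
      (H.continuous_clamp hp₀)
    have := h0 z.1 hz.1 z.2 hz.2
    rw [clamp_eq ⟨hz.2.1.le, hz.2.2.le⟩]
    simpa using this
  have h2 : ∀ s ∈ Icc 0 Real.pi, h.val (-s, p) = h.val (s, p) := fun s hs => by
    have := h1 (show (s, p) ∈ Icc 0 Real.pi ×ˢ Icc p₀ 0 from ⟨hs, hp⟩)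
    simp only at this
    rwa [clamp_eq hp] at this
  have hper : Function.Periodic (fun q => h.val (-q, p) - h.val (q, p)) (2 * Real.pi) := fun q => by
    have e1 := H.periodic q p hp
    have e2 := H.periodic (-(q + 2 * Real.pi)) p hp
    rw [show -(q + 2 * Real.pi) + 2 * Real.pi = -q by ring] at e2
    simp only
    rw [e1, e2]
  obtain ⟨y, hy, hqy⟩ := hper.exists_mem_Ico Real.two_pi_pos q (-Real.pi)
  rcases le_total 0 y with hy0 | hy0
  · have := h2 y ⟨hy0, by linarith [hy.2]⟩
    linarith
  · have := h2 (-y) ⟨by linarith, by linarith [hy.1]⟩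
    rw [neg_neg] at this
    linarith

/-- If `xc > 0`, evenness makes each curve fall on `[0, π]`, while it also rises on `[0, xc]`. The
line `-xc / 4` is admissible and, being negative, gives strict inequality; its value at `s = xc / 4`
on the surface contradicts `h(0) ≤ h(xc / 2) = h(-xc / 2)`. -/
lemma crest_not_pos (H : HeightSystem p₀ m M k σ E A B h) (hm : 0 < m) (hp₀ : p₀ < 0)
    (hσ : σ ≤ 0) (P : CrestedProfile p₀ xc fun q p => h.val (q, p)) : xc ≤ 0 := by
  by_contra! hxc
  have heven := fun q p (hp : p ∈ Icc p₀ 0) => H.even_of_crest_nonneg hm hp₀ hσ P hxc.le q hp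
  have hanti : ∀ p ∈ Icc p₀ 0, ∀ a b, 0 ≤ a → a ≤ b → b ≤ Real.pi →
      h.val (b, p) ≤ h.val (a, p) := fun p hp a b h1 h2 h3 => by
    rw [← heven b p hp, ← heven a p hp]
    exact P.rises p hp (-b) (-a) (by linarith) (by linarith) (by linarith)
  have c2 := P.crest.2
  have hl : ReflectionBelow p₀ (fun q p => h.val (q, p)) (-xc / 4) := by
    intro s hs p hp
    have s1 := hs.1
    have s2 := hs.2
    simp only
    rcases le_total (s + xc / 4) Real.pi with h1 | h1
    · rw [← heven (-xc / 4 - s) p hp]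
      rcases le_total 0 (-xc / 4 + s) with h2 | h2
      · exact hanti p hp _ _ h2 (by linarith) (by linarith)
      · rw [← heven (-xc / 4 + s) p hp]
        exact hanti p hp _ _ (by linarith) (by linarith) (by linarith)
    · rw [← H.periodic _ p hp]
      exact hanti p hp _ _ (by linarith) (by linarith) (by linarith)
  have hlt := H.reflection_lt hm hp₀ hσ hl
    (exists_reflection_ne hp₀ P ⟨by linarith, by linarith⟩) (xc / 4)
    ⟨by linarith, by linarith⟩ 0 ⟨hp₀, le_refl 0⟩
  have h00 : (0 : ℝ) ∈ Icc p₀ 0 := ⟨hp₀.le, le_refl 0⟩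
  rw [show -xc / 4 - xc / 4 = -(xc / 2) by ring, show -xc / 4 + xc / 4 = 0 by ring,
    heven _ 0 h00] at hlt
  have e1 := P.rises 0 h00 0 (xc / 2) (by linarith [Real.pi_pos]) (by linarith) (by linarith)
  linarith

/-- A solution of the height equation with a single crest line per period is even. -/
theorem even_and_crest_eq_zero (H : HeightSystem p₀ m M k σ E A B h) (hm : 0 < m) (hp₀ : p₀ < 0)
    (hσ : σ ≤ 0) (P : CrestedProfile p₀ xc fun q p => h.val (q, p)) :
    xc = 0 ∧ ∀ q, ∀ p ∈ Icc p₀ 0, h.val (-q, p) = h.val (q, p) := by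
  have h1 := H.crest_not_pos hm hp₀ hσ P
  have h2 := H.reflect.crest_not_pos hm hp₀ hσ P.reflect
  have h3 : xc = 0 := by linarith
  exact ⟨h3, fun q p hp => H.even_of_crest_nonneg hm hp₀ hσ P h3.ge q hp⟩

end HeightSystem

/-! ### The semi-hodograph transform: streamline height over a column. -/

lemma isOpen_openFluid {η : ℝ → ℝ} (hη : Continuous η) : IsOpen (openFluid η) :=
  (isOpen_lt continuous_const continuous_snd).inter
    (isOpen_lt continuous_snd (hη.comp continuous_fst))

lemma isClosed_closedFluid {η : ℝ → ℝ} (hη : Continuous η) : IsClosed (closedFluid η) :=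
  (isClosed_le continuous_const continuous_snd).inter
    (isClosed_le continuous_snd (hη.comp continuous_fst))

lemma openFluid_subset_closedFluid (η : ℝ → ℝ) : openFluid η ⊆ closedFluid η :=
  fun _ hz => ⟨hz.1.le, hz.2.le⟩

lemma closedFluid_mem_nhds {η : ℝ → ℝ} (hη : Continuous η) {z : ℝ × ℝ} (hz : z ∈ openFluid η) :
    closedFluid η ∈ 𝓝 z :=
  mem_of_superset ((isOpen_openFluid hη).mem_nhds hz) (openFluid_subset_closedFluid η)

/-- Projection of the vertical coordinate onto the fluid column above `x`. -/
noncomputable def columnProj (η : ℝ → ℝ) (x y : ℝ) : ℝ := max 0 (min y (η x))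

/-- Extension of a function on the fluid domain to the plane, of slope `-1` in each column
outside the fluid. -/
noncomputable def columnExtend (η : ℝ → ℝ) (ψ : ℝ → ℝ → ℝ) (x y : ℝ) : ℝ :=
  ψ x (columnProj η x y) - (y - columnProj η x y)

section Column

variable {η : ℝ → ℝ} {ψ : ℝ → ℝ → ℝ}

lemma columnProj_mem (hpos : ∀ x, 0 < η x) (x y : ℝ) : columnProj η x y ∈ Icc 0 (η x) :=
  ⟨le_max_left _ _, max_le (hpos x).le (min_le_right _ _)⟩

lemma columnProj_of_mem {x y : ℝ} (hy : y ∈ Icc 0 (η x)) : columnProj η x y = y := by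
  rw [columnProj, min_eq_left hy.2, max_eq_right hy.1]

lemma columnExtend_of_mem {x y : ℝ} (hy : y ∈ Icc 0 (η x)) : columnExtend η ψ x y = ψ x y := by
  rw [columnExtend, columnProj_of_mem hy, sub_self, sub_zero]

lemma continuous_columnExtend (hη : Continuous η) (hpos : ∀ x, 0 < η x)
    (hψ : ContinuousOn (Function.uncurry ψ) (closedFluid η)) :
    Continuous fun z : ℝ × ℝ => columnExtend η ψ z.1 z.2 := by
  have h1 : Continuous fun z : ℝ × ℝ => columnProj η z.1 z.2 := by
    unfold columnProj; fun_prop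
  have h2 : Continuous fun z : ℝ × ℝ => Function.uncurry ψ (z.1, columnProj η z.1 z.2) :=
    hψ.comp_continuous (continuous_fst.prodMk h1) fun z => columnProj_mem hpos z.1 z.2
  exact h2.sub (continuous_snd.sub h1)

/-- The projection is monotone and 1-Lipschitz. Either it moves, and `ψ` decreases strictly, or it
does not, and the linear term does. -/
lemma columnExtend_strictAnti {x : ℝ} (hpos : ∀ x, 0 < η x)
    (hanti : StrictAntiOn (ψ x) (Icc 0 (η x))) : StrictAnti (columnExtend η ψ x) := by
  intro y₁ y₂ hlt
  have m1 := columnProj_mem hpos x y₁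
  have m2 := columnProj_mem hpos x y₂
  have hle : columnProj η x y₁ ≤ columnProj η x y₂ :=
    max_le_max (le_refl _) (min_le_min_right _ hlt.le)
  have hdiff : columnProj η x y₂ - columnProj η x y₁ ≤ y₂ - y₁ := by
    unfold columnProj
    rcases le_total y₁ (η x) with a | a <;> rcases le_total y₂ (η x) with b | b <;>
      rcases le_total 0 y₁ with d | d <;> rcases le_total 0 y₂ with e | e <;>
      simp [a, b, d, e, (hpos x).le] <;> linarith [hpos x]
  unfold columnExtend
  rcases hle.lt_or_eq with h | h
  · have := hanti m1 m2 h
    linarith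
  · rw [h]
    linarith

lemma columnExtend_surjective {x p₀ : ℝ} (hη : Continuous η) (hpos : ∀ x, 0 < η x)
    (hψ : ContinuousOn (Function.uncurry ψ) (closedFluid η))
    (h0 : ψ x (η x) = 0) (h1 : ψ x 0 = -p₀) (t : ℝ) : ∃ y, columnExtend η ψ x y = t := by
  have hc : Continuous (columnExtend η ψ x) :=
    (continuous_columnExtend hη hpos hψ).comp (continuous_const.prodMk continuous_id)
  have ht : columnExtend η ψ x (η x + |t|) ≤ t := by
    have : columnProj η x (η x + |t|) = η x := by
      rw [columnProj, min_eq_right (by linarith [abs_nonneg t]), max_eq_right (hpos x).le]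
    rw [columnExtend, this, h0]
    linarith [neg_abs_le t]
  have hb : t ≤ columnExtend η ψ x (-|t| - |p₀|) := by
    have : columnProj η x (-|t| - |p₀|) = 0 := by
      rw [columnProj, max_eq_left]
      exact (min_le_left _ _).trans (by linarith [abs_nonneg t, abs_nonneg p₀])
    rw [columnExtend, this, h1]
    linarith [le_abs_self t, le_abs_self p₀]
  exact mem_range_of_exists_le_of_exists_ge hc ⟨_, ht⟩ ⟨_, hb⟩

end Column

section Height

variable {g σ c Patm p₀ : ℝ} {η : ℝ → ℝ} {u v ρ P ψ : ℝ → ℝ → ℝ}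

/-- The height above the bed of the streamline `ψ = -p` at the horizontal position `q`. -/
noncomputable def streamHeight (η : ℝ → ℝ) (ψ : ℝ → ℝ → ℝ) (z : ℝ × ℝ) : ℝ :=
  Classical.epsilon fun y => columnExtend η ψ z.1 y = -z.2

/-- A wave without stagnation points together with its pseudo-stream function. -/
structure UnidirectionalWave (g σ c Patm p₀ : ℝ) (η : ℝ → ℝ) (u v ρ P ψ : ℝ → ℝ → ℝ) : Prop where
  wave : IsSteadyStratifiedWave g σ c Patm η u v ρ P
  stream : IsPseudoStreamFunction c η u v ρ ψ p₀
  noStag : ∀ x y, (x, y) ∈ closedFluid η → u x y < c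

namespace UnidirectionalWave

lemma continuous_surface (W : UnidirectionalWave g σ c Patm p₀ η u v ρ P ψ) : Continuous η := W.wave.surface_contDiff.continuous

lemma strictAntiOn_stream (W : UnidirectionalWave g σ c Patm p₀ η u v ρ P ψ) (x : ℝ) : StrictAntiOn (ψ x) (Icc 0 (η x)) := by
  refine strictAntiOn_of_deriv_neg (convex_Icc _ _) ?_ fun y hy => ?_
  · exact W.stream.continuousOn.comp (f := fun y => (x, y)) (by fun_prop) fun y hy => hy
  · rw [interior_Icc] at hy
    have hz : (x, y) ∈ openFluid η := hy
    have hz' := openFluid_subset_closedFluid η hz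
    rw [(W.stream.deriv_y x y hz).deriv]
    exact mul_neg_of_pos_of_neg (Real.sqrt_pos.mpr (W.wave.density_pos x y hz'))
      (by linarith [W.noStag x y hz'])

lemma p₀_neg (W : UnidirectionalWave g σ c Patm p₀ η u v ρ P ψ) : p₀ < 0 := by
  have h1 := W.strictAntiOn_stream 0 ⟨le_refl 0, (W.wave.surface_pos 0).le⟩
    ⟨(W.wave.surface_pos 0).le, le_refl _⟩ (W.wave.surface_pos 0)
  rw [W.stream.surface, W.stream.bed] at h1
  linarith

lemma extend_strictAnti (W : UnidirectionalWave g σ c Patm p₀ η u v ρ P ψ) (x : ℝ) : StrictAnti (columnExtend η ψ x) :=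
  columnExtend_strictAnti W.wave.surface_pos (W.strictAntiOn_stream x)

lemma extend_height (W : UnidirectionalWave g σ c Patm p₀ η u v ρ P ψ) (z : ℝ × ℝ) : columnExtend η ψ z.1 (streamHeight η ψ z) = -z.2 :=
  Classical.epsilon_spec (columnExtend_surjective W.continuous_surface W.wave.surface_pos
    W.stream.continuousOn (W.stream.surface z.1) (W.stream.bed z.1) (-z.2))

lemma extend_bed (W : UnidirectionalWave g σ c Patm p₀ η u v ρ P ψ) (x : ℝ) : columnExtend η ψ x 0 = -p₀ := by
  rw [columnExtend_of_mem ⟨le_refl 0, (W.wave.surface_pos x).le⟩, W.stream.bed]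

lemma extend_surface (W : UnidirectionalWave g σ c Patm p₀ η u v ρ P ψ) (x : ℝ) : columnExtend η ψ x (η x) = 0 := by
  rw [columnExtend_of_mem ⟨(W.wave.surface_pos x).le, le_refl _⟩, W.stream.surface]

/-- By strict monotonicity in each column, comparing the height with a level `a` amounts to
comparing the extended `ψ` at `a` with `-p`, an open condition in `(q, p)`. -/
lemma continuous_height (W : UnidirectionalWave g σ c Patm p₀ η u v ρ P ψ) : Continuous (streamHeight η ψ) := by
  have hc := continuous_columnExtend W.continuous_surface W.wave.surface_pos W.stream.continuousOn
  refine continuous_iff_continuousAt.mpr fun z => tendsto_order.mpr ⟨fun a ha => ?_, fun a ha => ?_⟩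
  · have h1 : -z.2 < columnExtend η ψ z.1 a := by
      rw [← W.extend_height z]; exact W.extend_strictAnti z.1 ha
    have hca : Continuous fun y : ℝ × ℝ => columnExtend η ψ y.1 a :=
      hc.comp (f := fun y : ℝ × ℝ => (y.1, a)) (by fun_prop)
    filter_upwards [(continuous_snd.neg.continuousAt).eventually_lt hca.continuousAt h1] with y hy
    have hy' := hy
    rw [Pi.neg_apply] at hy'
    rw [← W.extend_height y] at hy'
    exact (W.extend_strictAnti y.1).lt_iff_gt.mp hy'
  · have h1 : columnExtend η ψ z.1 a < -z.2 := by
      rw [← W.extend_height z]; exact W.extend_strictAnti z.1 ha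
    have hca : Continuous fun y : ℝ × ℝ => columnExtend η ψ y.1 a :=
      hc.comp (f := fun y : ℝ × ℝ => (y.1, a)) (by fun_prop)
    filter_upwards [hca.continuousAt.eventually_lt (continuous_snd.neg.continuousAt) h1] with y hy
    have hy' := hy
    rw [Pi.neg_apply] at hy'
    rw [← W.extend_height y] at hy'
    exact (W.extend_strictAnti y.1).lt_iff_gt.mp hy'

lemma height_mem (W : UnidirectionalWave g σ c Patm p₀ η u v ρ P ψ) {z : ℝ × ℝ} (hz : z.2 ∈ Icc p₀ 0) :
    (z.1, streamHeight η ψ z) ∈ closedFluid η := by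
  constructor
  · refine (W.extend_strictAnti z.1).le_iff_ge.mp ?_
    rw [W.extend_height, W.extend_bed]
    linarith [hz.1]
  · refine (W.extend_strictAnti z.1).le_iff_ge.mp ?_
    simp only
    rw [W.extend_height, W.extend_surface]
    linarith [hz.2]

lemma height_mem_open (W : UnidirectionalWave g σ c Patm p₀ η u v ρ P ψ) {z : ℝ × ℝ} (hz : z.2 ∈ Ioo p₀ 0) :
    (z.1, streamHeight η ψ z) ∈ openFluid η := by
  constructor
  · refine (W.extend_strictAnti z.1).lt_iff_gt.mp ?_
    rw [W.extend_height, W.extend_bed]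
    linarith [hz.1]
  · refine (W.extend_strictAnti z.1).lt_iff_gt.mp ?_
    simp only
    rw [W.extend_height, W.extend_surface]
    linarith [hz.2]

lemma stream_height (W : UnidirectionalWave g σ c Patm p₀ η u v ρ P ψ) {z : ℝ × ℝ} (hz : z.2 ∈ Icc p₀ 0) : ψ z.1 (streamHeight η ψ z) = -z.2 := by
  rw [← columnExtend_of_mem (ψ := ψ) (W.height_mem hz)]
  exact W.extend_height z

lemma height_eq_of_stream (W : UnidirectionalWave g σ c Patm p₀ η u v ρ P ψ) {x y p : ℝ} (hy : (x, y) ∈ closedFluid η) (h : ψ x y = -p) :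
    streamHeight η ψ (x, p) = y := by
  refine (W.extend_strictAnti x).injective ?_
  rw [W.extend_height (x, p), columnExtend_of_mem hy, h]

lemma stream_mem (W : UnidirectionalWave g σ c Patm p₀ η u v ρ P ψ) {x y : ℝ} (hy : (x, y) ∈ closedFluid η) : -ψ x y ∈ Icc p₀ 0 := by
  have hanti := (W.strictAntiOn_stream x).antitoneOn
  have h1 := hanti hy ⟨(W.wave.surface_pos x).le, le_refl _⟩ hy.2
  have h2 := hanti ⟨le_refl 0, (W.wave.surface_pos x).le⟩ hy hy.1
  rw [W.stream.surface] at h1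
  rw [W.stream.bed] at h2
  exact ⟨by linarith, by linarith⟩

lemma height_stream (W : UnidirectionalWave g σ c Patm p₀ η u v ρ P ψ) {x y : ℝ} (hy : (x, y) ∈ closedFluid η) :
    streamHeight η ψ (x, -ψ x y) = y := W.height_eq_of_stream hy (by ring)

lemma height_bed (W : UnidirectionalWave g σ c Patm p₀ η u v ρ P ψ) (q : ℝ) : streamHeight η ψ (q, p₀) = 0 :=
  W.height_eq_of_stream ⟨le_refl 0, (W.wave.surface_pos q).le⟩ (W.stream.bed q)

lemma height_surface (W : UnidirectionalWave g σ c Patm p₀ η u v ρ P ψ) (q : ℝ) : streamHeight η ψ (q, 0) = η q :=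
  W.height_eq_of_stream ⟨(W.wave.surface_pos q).le, le_refl _⟩ (by rw [W.stream.surface, neg_zero])

lemma mem_closed_shift (W : UnidirectionalWave g σ c Patm p₀ η u v ρ P ψ) {x y : ℝ} (h : (x, y) ∈ closedFluid η) :
    (x + 2 * Real.pi, y) ∈ closedFluid η :=
  ⟨h.1, by simpa [W.wave.surface_periodic] using h.2⟩

lemma mem_open_shift (W : UnidirectionalWave g σ c Patm p₀ η u v ρ P ψ) {x y : ℝ} (h : (x, y) ∈ openFluid η) :
    (x + 2 * Real.pi, y) ∈ openFluid η :=
  ⟨h.1, by simpa [W.wave.surface_periodic] using h.2⟩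

/-- In a column, the difference of `ψ` at `x + 2π` and at `x` has zero vertical derivative, since
`ρ` and `u` are periodic, and vanishes on the bed. -/
lemma stream_periodic (W : UnidirectionalWave g σ c Patm p₀ η u v ρ P ψ) : IsPeriodicX η ψ := by
  intro x y hy
  have hcol : ∀ x, ContinuousOn (ψ x) (Icc 0 (η x)) := fun x =>
    W.stream.continuousOn.comp (f := fun y => (x, y)) (by fun_prop) fun y hy => hy
  have hc : ContinuousOn (fun y => ψ (x + 2 * Real.pi) y - ψ x y) (Icc 0 (η x)) := by
    refine ContinuousOn.sub ?_ (hcol x)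
    have := hcol (x + 2 * Real.pi)
    rwa [W.wave.surface_periodic] at this
  have hd : ∀ t ∈ Ioo 0 (η x), HasDerivAt (fun y => ψ (x + 2 * Real.pi) y - ψ x y) 0 t := by
    intro t ht
    have ht' : (x, t) ∈ openFluid η := ht
    have ht'' := openFluid_subset_closedFluid η ht'
    refine ((W.stream.deriv_y _ t (W.mem_open_shift ht')).sub
      (W.stream.deriv_y x t ht')).congr_deriv ?_
    rw [W.wave.density_periodic x t ht'', W.wave.u_periodic x t ht'', sub_self]
  have hdiff : DifferentiableOn ℝ (fun y => ψ (x + 2 * Real.pi) y - ψ x y)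
      (interior (Icc 0 (η x))) := by
    rw [interior_Icc]
    exact fun t ht => (hd t ht).differentiableAt.differentiableWithinAt
  have h0 : (0 : ℝ) ∈ Icc 0 (η x) := ⟨le_refl 0, (W.wave.surface_pos x).le⟩
  have h1 := monotoneOn_of_deriv_nonneg (convex_Icc 0 (η x)) hc hdiff
    (fun t ht => by rw [interior_Icc] at ht; exact (hd t ht).deriv.ge) h0 hy hy.1
  have h2 := antitoneOn_of_deriv_nonpos (convex_Icc 0 (η x)) hc hdiff
    (fun t ht => by rw [interior_Icc] at ht; exact (hd t ht).deriv.le) h0 hy hy.1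
  simp only [W.stream.bed] at h1 h2
  linarith

lemma height_periodic (W : UnidirectionalWave g σ c Patm p₀ η u v ρ P ψ) (q p : ℝ) (hp : p ∈ Icc p₀ 0) :
    streamHeight η ψ (q + 2 * Real.pi, p) = streamHeight η ψ (q, p) := by
  have h1 := W.height_mem (z := (q, p)) hp
  refine W.height_eq_of_stream (W.mem_closed_shift h1) ?_
  rw [W.stream_periodic _ _ h1, W.stream_height (z := (q, p)) hp]

end UnidirectionalWave

end Height

/-! ### Uniform bounds on the fluid domain. -/

lemma hasFDerivAt_of_isC1Up {η : ℝ → ℝ} {f : ℝ → ℝ → ℝ} (hη : Continuous η) (hf : IsC1Up η f)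
    {z : ℝ × ℝ} (hz : z ∈ openFluid η) :
    HasFDerivAt (Function.uncurry f) (planeForm (partialX f z.1 z.2) (partialY f z.1 z.2)) z := by
  have h1 : DifferentiableAt ℝ (Function.uncurry f) z :=
    (hf.contDiffAt (closedFluid_mem_nhds hη hz)).differentiableAt (by norm_num)
  obtain ⟨L, hL⟩ := h1
  have e : L = planeForm (L (1, 0)) (L (0, 1)) := by
    ext <;> simp
  rw [e] at hL
  have hx := (hasDerivAt_horizontal (s := z.1) (p := z.2) hL).deriv
  have hy := (hasDerivAt_vertical (s := z.1) (p := z.2) hL).deriv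
  unfold partialX partialY
  simp only [Function.uncurry] at hx hy
  rw [hx, hy]
  exact hL

/-- `F` is bounded on `S`. -/
def BddAbsOn (S : Set (ℝ × ℝ)) (F : ℝ × ℝ → ℝ) : Prop := ∃ C, ∀ z ∈ S, |F z| ≤ C

namespace BddAbsOn

variable {S T : Set (ℝ × ℝ)} {F G : ℝ × ℝ → ℝ}

lemma add (hF : BddAbsOn S F) (hG : BddAbsOn S G) : BddAbsOn S fun z => F z + G z := by
  obtain ⟨C, hC⟩ := hF
  obtain ⟨D, hD⟩ := hG
  exact ⟨C + D, fun z hz => (abs_add_le _ _).trans (add_le_add (hC z hz) (hD z hz))⟩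

lemma neg (hF : BddAbsOn S F) : BddAbsOn S fun z => -F z := by
  obtain ⟨C, hC⟩ := hF
  exact ⟨C, fun z hz => by rw [abs_neg]; exact hC z hz⟩

lemma mul (hF : BddAbsOn S F) (hG : BddAbsOn S G) : BddAbsOn S fun z => F z * G z := by
  obtain ⟨C, hC⟩ := hF
  obtain ⟨D, hD⟩ := hG
  refine ⟨C * D, fun z hz => ?_⟩
  rw [abs_mul]
  exact mul_le_mul (hC z hz) (hD z hz) (abs_nonneg _) ((abs_nonneg _).trans (hC z hz))

lemma const_mul (a : ℝ) (hF : BddAbsOn S F) : BddAbsOn S fun z => a * F z :=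
  mul ⟨|a|, fun _ _ => le_refl _⟩ hF

lemma mono (hF : BddAbsOn S F) (h : T ⊆ S) : BddAbsOn T F := by
  obtain ⟨C, hC⟩ := hF
  exact ⟨C, fun z hz => hC z (h hz)⟩

lemma congr (hF : BddAbsOn S F) (h : ∀ z ∈ S, G z = F z) : BddAbsOn S G := by
  obtain ⟨C, hC⟩ := hF
  exact ⟨C, fun z hz => by rw [h z hz]; exact hC z hz⟩

end BddAbsOn

lemma bddAbsOn_of_periodic {S : Set (ℝ × ℝ)} {F : ℝ × ℝ → ℝ}
    (hS : ∀ x y, (x + 2 * Real.pi, y) ∈ S ↔ (x, y) ∈ S)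
    (hF : ∀ x y, (x, y) ∈ S → F (x + 2 * Real.pi, y) = F (x, y))
    (hb : BddAbsOn (S ∩ {z | z.1 ∈ Icc (-Real.pi) Real.pi}) F) : BddAbsOn S F := by
  obtain ⟨C, hC⟩ := hb
  refine ⟨C, fun z hz => ?_⟩
  -- Membership and value are paired so that a single reduction modulo `2π` transports both.
  have hper : Function.Periodic (fun x => ((x, z.2) ∈ S, S.indicator F (x, z.2)))
      (2 * Real.pi) := fun x => by
    refine Prod.ext (propext (hS x z.2)) ?_
    simp only
    by_cases h : (x, z.2) ∈ S
    · rw [indicator_of_mem h, indicator_of_mem ((hS x z.2).mpr h), hF x z.2 h]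
    · rw [indicator_of_notMem h, indicator_of_notMem (fun h' => h ((hS x z.2).mp h'))]
  obtain ⟨y, hy, hzy⟩ := hper.exists_mem_Ico Real.two_pi_pos z.1 (-Real.pi)
  rw [Prod.mk.injEq] at hzy
  have hyS : (y, z.2) ∈ S := by rw [← hzy.1]; exact hz
  have h2 := hzy.2
  rw [indicator_of_mem hyS, indicator_of_mem (show (z.1, z.2) ∈ S from hz)] at h2
  have h3 : F z = F (y, z.2) := h2
  rw [h3]
  exact hC (y, z.2) ⟨hyS, hy.1, by linarith [hy.2]⟩

lemma isCompact_fluid_cell {η : ℝ → ℝ} (hη : Continuous η) :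
    IsCompact (closedFluid η ∩ {z | z.1 ∈ Icc (-Real.pi) Real.pi}) := by
  obtain ⟨C, hC⟩ := (isCompact_Icc (a := -Real.pi) (b := Real.pi)).bddAbove_image hη.continuousOn
  refine ((isCompact_Icc (a := -Real.pi) (b := Real.pi)).prod (isCompact_Icc (a := 0) (b := C))).of_isClosed_subset
    ((isClosed_closedFluid hη).inter (isClosed_Icc.preimage continuous_fst)) fun z hz => ?_
  exact ⟨hz.2, hz.1.1, hz.1.2.trans (hC (mem_image_of_mem η hz.2))⟩

lemma bddAbsOn_closedFluid {η : ℝ → ℝ} (hη : Continuous η)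
    (hper : ∀ x, η (x + 2 * Real.pi) = η x) {f : ℝ → ℝ → ℝ}
    (hf : ContinuousOn (Function.uncurry f) (closedFluid η)) (hfp : IsPeriodicX η f) :
    BddAbsOn (closedFluid η) (Function.uncurry f) := by
  refine bddAbsOn_of_periodic (fun x y => ?_) hfp ?_
  · simp only [closedFluid, mem_ofPred_eq, hper]
  · obtain ⟨C, hC⟩ := (isCompact_fluid_cell hη).exists_bound_of_continuousOn
      (hf.mono inter_subset_left)
    exact ⟨C, hC⟩

/-- A derivative relative to the closed domain is continuous at `z₀`, hence bounded nearby, and at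
interior points it is the ordinary derivative. This bounds the partial derivatives up to the
boundary without evaluating them there. -/
lemma exists_local_bound_partial {η : ℝ → ℝ} (hη : Continuous η) {f : ℝ → ℝ → ℝ}
    (hf : IsC1Up η f) {z₀ : ℝ × ℝ} (hz₀ : z₀ ∈ closedFluid η) :
    ∃ C, ∀ᶠ z in 𝓝 z₀, z ∈ openFluid η →
      |partialX f z.1 z.2| ≤ C ∧ |partialY f z.1 z.2| ≤ C := by
  have h1 : ContDiffWithinAt ℝ (0 + 1) (Function.uncurry f) (closedFluid η) z₀ := by
    simpa using hf z₀ hz₀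
  obtain ⟨U, hU, -, f', hf', hcont⟩ := (contDiffWithinAt_succ_iff_hasFDerivWithinAt
    (by simp)).mp h1
  rw [insert_eq_of_mem hz₀] at hU
  have hc := hcont.continuousWithinAt
  have hb : ∀ᶠ z in 𝓝[closedFluid η] z₀, ‖f' z‖ < ‖f' z₀‖ + 1 := by
    have hb' : ∀ᶠ z in 𝓝[U] z₀, ‖f' z‖ < ‖f' z₀‖ + 1 :=
      hc.norm.eventually_lt continuousWithinAt_const (by simp)
    exact hb'.filter_mono (nhdsWithin_le_iff.mpr hU)
  refine ⟨‖f' z₀‖ + 1, ?_⟩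
  obtain ⟨V, hVo, hzV, hVU⟩ := mem_nhdsWithin.mp hU
  filter_upwards [hVo.mem_nhds hzV, eventually_nhdsWithin_iff.mp hb] with z hzV' hzb hzo
  have hzc := openFluid_subset_closedFluid η hzo
  have hzU : z ∈ U := hVU ⟨hzV', hzc⟩
  have hUn : U ∈ 𝓝 z := mem_of_superset
    (inter_mem (hVo.mem_nhds hzV') (closedFluid_mem_nhds hη hzo)) hVU
  have hd := (hf' z hzU).hasFDerivAt hUn
  have heq := hd.unique (hasFDerivAt_of_isC1Up hη hf hzo)
  have hn := (hzb hzc).le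
  rw [heq] at hn
  have n1 := (planeForm (partialX f z.1 z.2) (partialY f z.1 z.2)).le_opNorm (1, 0)
  have n2 := (planeForm (partialX f z.1 z.2) (partialY f z.1 z.2)).le_opNorm (0, 1)
  simp [Prod.norm_def] at n1 n2
  exact ⟨n1.trans hn, n2.trans hn⟩

lemma bddAbsOn_partial {η : ℝ → ℝ} (hη : Continuous η)
    (hper : ∀ x, η (x + 2 * Real.pi) = η x) {f : ℝ → ℝ → ℝ}
    (hf : IsC1Up η f) (hfp : IsPeriodicX η f) :
    BddAbsOn (openFluid η) (fun z => partialX f z.1 z.2) ∧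
      BddAbsOn (openFluid η) (fun z => partialY f z.1 z.2) := by
  have hcell : ∃ C, ∀ z ∈ closedFluid η ∩ {z | z.1 ∈ Icc (-Real.pi) Real.pi},
      z ∈ openFluid η → |partialX f z.1 z.2| ≤ C ∧ |partialY f z.1 z.2| ≤ C := by
    refine (isCompact_fluid_cell hη).induction_on
      (p := fun t => ∃ C, ∀ z ∈ t, z ∈ openFluid η →
        |partialX f z.1 z.2| ≤ C ∧ |partialY f z.1 z.2| ≤ C) ⟨0, fun z hz => hz.elim⟩ ?_ ?_ ?_
    · rintro s t hst ⟨C, hC⟩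
      exact ⟨C, fun z hz => hC z (hst hz)⟩
    · rintro s t ⟨C, hC⟩ ⟨D, hD⟩
      refine ⟨max C D, fun z hz hzo => ?_⟩
      rcases hz with h | h
      · exact ⟨(hC z h hzo).1.trans (le_max_left _ _), (hC z h hzo).2.trans (le_max_left _ _)⟩
      · exact ⟨(hD z h hzo).1.trans (le_max_right _ _), (hD z h hzo).2.trans (le_max_right _ _)⟩
    · intro z hz
      obtain ⟨C, hC⟩ := exists_local_bound_partial hη hf hz.1
      exact ⟨_, mem_nhdsWithin_of_mem_nhds hC, C, fun y hy => hy⟩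
  obtain ⟨C, hC⟩ := hcell
  have hS : ∀ x y, (x + 2 * Real.pi, y) ∈ openFluid η ↔ (x, y) ∈ openFluid η := fun x y => by
    simp only [openFluid, mem_ofPred_eq, hper]
  have hsub := openFluid_subset_closedFluid η
  constructor
  · refine bddAbsOn_of_periodic hS (fun x y hxy => ?_)
      ⟨C, fun z hz => (hC z ⟨hsub hz.1, hz.2⟩ hz.1).1⟩
    have hev : (fun s => f (s + 2 * Real.pi) y) =ᶠ[𝓝 x] fun s => f s y := by
      have : ∀ᶠ s in 𝓝 x, (s, y) ∈ openFluid η :=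
        (Continuous.continuousAt (f := fun s : ℝ => (s, y)) (by fun_prop)).eventually
          ((isOpen_openFluid hη).mem_nhds hxy)
      filter_upwards [this] with s hs using hfp s y (hsub hs)
    have := hev.deriv_eq
    rw [deriv_comp_add_const (fun s => f s y) (2 * Real.pi) x] at this
    exact this
  · refine bddAbsOn_of_periodic hS (fun x y hxy => ?_)
      ⟨C, fun z hz => (hC z ⟨hsub hz.1, hz.2⟩ hz.1).2⟩
    have hev : (fun s => f (x + 2 * Real.pi) s) =ᶠ[𝓝 y] fun s => f x s := by
      have : ∀ᶠ s in 𝓝 y, (x, s) ∈ openFluid η :=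
        (Continuous.continuousAt (f := fun s : ℝ => (x, s)) (by fun_prop)).eventually
          ((isOpen_openFluid hη).mem_nhds hxy)
      filter_upwards [this] with s hs using hfp x s (hsub hs)
    exact hev.deriv_eq

/-- Composition of a function on the fluid domain with the semi-hodograph transform. -/
noncomputable def onStream (η : ℝ → ℝ) (ψ f : ℝ → ℝ → ℝ) (z : ℝ × ℝ) : ℝ :=
  f z.1 (streamHeight η ψ z)

namespace UnidirectionalWave

variable {g σ c Patm p₀ : ℝ} {η : ℝ → ℝ} {u v ρ P ψ : ℝ → ℝ → ℝ}

lemma bddAbsOn_onStream (W : UnidirectionalWave g σ c Patm p₀ η u v ρ P ψ) {f : ℝ → ℝ → ℝ}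
    (hf : ContinuousOn (Function.uncurry f) (closedFluid η)) (hfp : IsPeriodicX η f) :
    BddAbsOn {z | z.2 ∈ Icc p₀ 0} (onStream η ψ f) := by
  obtain ⟨C, hC⟩ := bddAbsOn_closedFluid W.continuous_surface W.wave.surface_periodic hf hfp
  exact ⟨C, fun z hz => hC _ (W.height_mem hz)⟩

lemma bddAbsOn_onStream_partial (W : UnidirectionalWave g σ c Patm p₀ η u v ρ P ψ)
    {f : ℝ → ℝ → ℝ} (hf : IsC1Up η f) (hfp : IsPeriodicX η f) :
    BddAbsOn {z | z.2 ∈ Ioo p₀ 0} (onStream η ψ (partialX f)) ∧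
      BddAbsOn {z | z.2 ∈ Ioo p₀ 0} (onStream η ψ (partialY f)) := by
  obtain ⟨⟨C, hC⟩, D, hD⟩ := bddAbsOn_partial W.continuous_surface W.wave.surface_periodic hf hfp
  exact ⟨⟨C, fun z hz => hC _ (W.height_mem_open hz)⟩,
    ⟨D, fun z hz => hD _ (W.height_mem_open hz)⟩⟩

lemma continuousOn_onStream (W : UnidirectionalWave g σ c Patm p₀ η u v ρ P ψ) {f : ℝ → ℝ → ℝ}
    (hf : ContinuousOn (Function.uncurry f) (closedFluid η)) :
    ContinuousOn (onStream η ψ f) {z | z.2 ∈ Icc p₀ 0} :=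
  hf.comp (f := fun z : ℝ × ℝ => (z.1, streamHeight η ψ z))
    (continuous_fst.prodMk W.continuous_height).continuousOn fun _ hz => W.height_mem hz

end UnidirectionalWave

/-! ### Derivatives of the height up to second order. -/

/-- Horizontal derivative of the height function. -/
noncomputable def heightDq (c : ℝ) (η : ℝ → ℝ) (u v ψ : ℝ → ℝ → ℝ) (z : ℝ × ℝ) : ℝ :=
  -(onStream η ψ v z * (c - onStream η ψ u z)⁻¹)

/-- Vertical derivative of the height function. -/
noncomputable def heightDp (c : ℝ) (η : ℝ → ℝ) (u ρ ψ : ℝ → ℝ → ℝ) (z : ℝ × ℝ) : ℝ :=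
  (Real.sqrt (onStream η ψ ρ z))⁻¹ * (c - onStream η ψ u z)⁻¹

/-- The height function with its derivatives in the open strip, and with the second derivative of
the surface at the top. -/
noncomputable def heightJet (c : ℝ) (η : ℝ → ℝ) (u v ρ ψ : ℝ → ℝ → ℝ) : PlaneJet where
  val := streamHeight η ψ
  dq := heightDq c η u v ψ
  dp := heightDp c η u ρ ψ
  dqq z := if z.2 < 0 then
      -((onStream η ψ (partialX v) z + onStream η ψ (partialY v) z * heightDq c η u v ψ z)
          * (c - onStream η ψ u z)⁻¹
        + onStream η ψ v z * ((c - onStream η ψ u z)⁻¹ ^ 2 *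
          (onStream η ψ (partialX u) z + onStream η ψ (partialY u) z * heightDq c η u v ψ z)))
    else deriv (deriv η) z.1
  dqp z := -(onStream η ψ (partialY v) z * heightDp c η u ρ ψ z * (c - onStream η ψ u z)⁻¹
        + onStream η ψ v z * ((c - onStream η ψ u z)⁻¹ ^ 2 *
          (onStream η ψ (partialY u) z * heightDp c η u ρ ψ z)))
  dpp z := -(1 / 2 * (Real.sqrt (onStream η ψ ρ z))⁻¹ ^ 3 *
        (onStream η ψ (partialY ρ) z * heightDp c η u ρ ψ z)) * (c - onStream η ψ u z)⁻¹
      + (Real.sqrt (onStream η ψ ρ z))⁻¹ * ((c - onStream η ψ u z)⁻¹ ^ 2 *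
        (onStream η ψ (partialY u) z * heightDp c η u ρ ψ z))

namespace UnidirectionalWave

variable {g σ c Patm p₀ : ℝ} {η : ℝ → ℝ} {u v ρ P ψ : ℝ → ℝ → ℝ}

lemma speed_pos (W : UnidirectionalWave g σ c Patm p₀ η u v ρ P ψ) {z : ℝ × ℝ}
    (hz : z.2 ∈ Icc p₀ 0) : 0 < c - onStream η ψ u z := by
  have := W.noStag _ _ (W.height_mem hz)
  unfold onStream
  linarith

lemma onStream_density_pos (W : UnidirectionalWave g σ c Patm p₀ η u v ρ P ψ) {z : ℝ × ℝ}
    (hz : z.2 ∈ Icc p₀ 0) : 0 < onStream η ψ ρ z :=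
  W.wave.density_pos _ _ (W.height_mem hz)

/-- Only partial derivatives of `ψ` are prescribed; their continuity gives total differentiability.
-/
lemma hasFDerivAt_stream (W : UnidirectionalWave g σ c Patm p₀ η u v ρ P ψ) {z : ℝ × ℝ}
    (hz : z ∈ openFluid η) :
    HasFDerivAt (fun z : ℝ × ℝ => ψ z.1 z.2) (planeForm (-(Real.sqrt (ρ z.1 z.2) * v z.1 z.2))
      (Real.sqrt (ρ z.1 z.2) * (u z.1 z.2 - c))) z := by
  have hnb := (isOpen_openFluid W.continuous_surface).mem_nhds hz
  have hc : ∀ {f : ℝ → ℝ → ℝ}, IsC1Up η f → ContinuousAt (fun z : ℝ × ℝ => f z.1 z.2) z :=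
    fun hf => (hasFDerivAt_of_isC1Up W.continuous_surface hf hz).continuousAt
  have cu := hc W.wave.u_contDiff
  have cv := hc W.wave.v_contDiff
  have cρ := hc W.wave.density_contDiff
  have h := hasStrictFDerivAt_uncurry_coprod (𝕜 := ℝ) (u := z) (f := ψ)
    (f₁ := fun x y => (-(Real.sqrt (ρ x y) * v x y)) • ContinuousLinearMap.id ℝ ℝ)
    (f₂ := fun x y => (Real.sqrt (ρ x y) * (u x y - c)) • ContinuousLinearMap.id ℝ ℝ)
    (by
      filter_upwards [hnb] with y hy
      refine (W.stream.deriv_x y.1 y.2 hy).hasFDerivAt.congr_fderiv ?_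
      ext; simp [Function.HasUncurry.uncurry])
    (by
      filter_upwards [hnb] with y hy
      refine (W.stream.deriv_y y.1 y.2 hy).hasFDerivAt.congr_fderiv ?_
      ext; simp [Function.HasUncurry.uncurry])
    (by
      have : ContinuousAt (fun z : ℝ × ℝ => (-(Real.sqrt (ρ z.1 z.2) * v z.1 z.2)) •
        ContinuousLinearMap.id ℝ ℝ) z := ((cρ.sqrt.mul cv).neg).smul continuousAt_const
      exact this)
    (by
      have : ContinuousAt (fun z : ℝ × ℝ => (Real.sqrt (ρ z.1 z.2) * (u z.1 z.2 - c)) •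
        ContinuousLinearMap.id ℝ ℝ) z :=
        (cρ.sqrt.mul (cu.sub continuousAt_const)).smul continuousAt_const
      exact this)
  refine h.hasFDerivAt.congr_fderiv ?_
  ext <;> simp [Function.HasUncurry.uncurry]

/-- The map `(q, p) ↦ (q, h)` is a continuous right inverse of `(x, y) ↦ (x, -ψ)`, whose derivative
is invertible because `ψ_y < 0`. -/
lemma hasFDerivAt_height (W : UnidirectionalWave g σ c Patm p₀ η u v ρ P ψ) {z : ℝ × ℝ}
    (hz : z.2 ∈ Ioo p₀ 0) :
    HasFDerivAt (streamHeight η ψ) (planeForm (heightDq c η u v ψ z) (heightDp c η u ρ ψ z)) z := by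
  have hz' : z.2 ∈ Icc p₀ 0 := ⟨hz.1.le, hz.2.le⟩
  set y := (z.1, streamHeight η ψ z) with hy
  have hs := W.hasFDerivAt_stream (z := y) (W.height_mem_open hz)
  have hf : HasFDerivAt (fun z : ℝ × ℝ => (z.1, -ψ z.1 z.2))
      ((ContinuousLinearMap.fst ℝ ℝ ℝ).prod (-planeForm (-(Real.sqrt (ρ y.1 y.2) * v y.1 y.2))
      (Real.sqrt (ρ y.1 y.2) * (u y.1 y.2 - c)))) y := hasFDerivAt_fst.prodMk hs.neg
  have hcont : ContinuousAt (fun z : ℝ × ℝ => (z.1, streamHeight η ψ z)) z :=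
    (continuous_fst.prodMk W.continuous_height).continuousAt
  have hcomp : (fun z : ℝ × ℝ => (z.1, -ψ z.1 z.2)) ∘ (fun z : ℝ × ℝ => (z.1, streamHeight η ψ z))
      =ᶠ[𝓝 z] id := by
    filter_upwards [(isOpen_Ioo.preimage continuous_snd).mem_nhds hz] with x hx
    have := W.stream_height (z := x) ⟨hx.1.le, hx.2.le⟩
    simp [this]
  have hsp := W.speed_pos hz'
  have hρ := Real.sqrt_pos.mpr (W.onStream_density_pos hz')
  have h := HasFDerivAt.of_comp_of_leftInverse
    (f'symm := (ContinuousLinearMap.fst ℝ ℝ ℝ).prod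
      (planeForm (heightDq c η u v ψ z) (heightDp c η u ρ ψ z))) hcont hf (hasFDerivAt_id z) hcomp
    (fun a => by
      ext
      · simp
      · simp only [hy, heightDq, heightDp, onStream, ContinuousLinearMap.prod_apply,
          ContinuousLinearMap.coe_fst', neg_apply, planeForm_apply]
        unfold onStream at hsp hρ
        have := hsp.ne'
        have := hρ.ne'
        field_simp
        ring)
  have h2 := (hasFDerivAt_snd (p := (z.1, streamHeight η ψ z))).comp z h
  exact h2.congr_fderiv (by ext <;> simp)

lemma hasFDerivAt_onStream (W : UnidirectionalWave g σ c Patm p₀ η u v ρ P ψ) {f : ℝ → ℝ → ℝ}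
    (hf : IsC1Up η f) {z : ℝ × ℝ} (hz : z.2 ∈ Ioo p₀ 0) :
    HasFDerivAt (onStream η ψ f) (planeForm
      (onStream η ψ (partialX f) z + onStream η ψ (partialY f) z * heightDq c η u v ψ z)
      (onStream η ψ (partialY f) z * heightDp c η u ρ ψ z)) z := by
  have h1 := hasFDerivAt_of_isC1Up W.continuous_surface hf (W.height_mem_open hz)
  have h2 := HasFDerivAt.comp (f := fun z : ℝ × ℝ => (z.1, streamHeight η ψ z)) z h1
    (hasFDerivAt_fst.prodMk (W.hasFDerivAt_height hz))
  refine h2.congr_fderiv ?_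
  ext <;> simp [onStream]

/-- Moving in `q` at fixed `p` follows a streamline, along which mass conservation keeps `ρ`
constant. -/
lemma onStream_density_dq (W : UnidirectionalWave g σ c Patm p₀ η u v ρ P ψ) {z : ℝ × ℝ}
    (hz : z.2 ∈ Ioo p₀ 0) :
    onStream η ψ (partialX ρ) z + onStream η ψ (partialY ρ) z * heightDq c η u v ψ z = 0 := by
  have h := W.wave.mass _ _ (W.height_mem_open hz)
  have hsp := W.speed_pos (z := z) ⟨hz.1.le, hz.2.le⟩
  unfold heightDq
  unfold onStream at *
  have := hsp.ne'
  field_simp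
  linarith

lemma hasFDerivAt_inv_speed (W : UnidirectionalWave g σ c Patm p₀ η u v ρ P ψ) {z : ℝ × ℝ}
    (hz : z.2 ∈ Ioo p₀ 0) :
    HasFDerivAt (fun z => (c - onStream η ψ u z)⁻¹) (planeForm
      ((c - onStream η ψ u z)⁻¹ ^ 2 *
        (onStream η ψ (partialX u) z + onStream η ψ (partialY u) z * heightDq c η u v ψ z))
      ((c - onStream η ψ u z)⁻¹ ^ 2 *
        (onStream η ψ (partialY u) z * heightDp c η u ρ ψ z))) z := by
  have h1 := (W.hasFDerivAt_onStream W.wave.u_contDiff hz).const_sub c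
  have hsp := W.speed_pos (z := z) ⟨hz.1.le, hz.2.le⟩
  have h2 := (hasDerivAt_inv hsp.ne').comp_hasFDerivAt z h1
  refine h2.congr_fderiv ?_
  ext <;> simp

lemma hasFDerivAt_inv_sqrt_density (W : UnidirectionalWave g σ c Patm p₀ η u v ρ P ψ) {z : ℝ × ℝ}
    (hz : z.2 ∈ Ioo p₀ 0) :
    HasFDerivAt (fun z => (Real.sqrt (onStream η ψ ρ z))⁻¹) (planeForm 0
      (-(1 / 2 * (Real.sqrt (onStream η ψ ρ z))⁻¹ ^ 3 *
        (onStream η ψ (partialY ρ) z * heightDp c η u ρ ψ z)))) z := by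
  have h1 := W.hasFDerivAt_onStream W.wave.density_contDiff hz
  rw [W.onStream_density_dq hz] at h1
  have hρ := W.onStream_density_pos (z := z) ⟨hz.1.le, hz.2.le⟩
  have hs := Real.sqrt_pos.mpr hρ
  have h2 := (((Real.hasDerivAt_sqrt hρ.ne').inv hs.ne')).comp_hasFDerivAt z h1
  refine h2.congr_fderiv ?_
  have := hs.ne'
  ext
  · simp
  · simp
    field_simp

lemma heightJet_validAt (W : UnidirectionalWave g σ c Patm p₀ η u v ρ P ψ) {z : ℝ × ℝ}
    (hz : z.2 ∈ Ioo p₀ 0) : (heightJet c η u v ρ ψ).ValidAt z := by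
  have hi := W.hasFDerivAt_inv_speed hz
  have hr := W.hasFDerivAt_inv_sqrt_density hz
  have hv := W.hasFDerivAt_onStream W.wave.v_contDiff hz
  refine ⟨W.hasFDerivAt_height hz, ?_, ?_⟩
  · refine (hv.mul hi).neg.congr_fderiv ?_
    ext
    · simp [heightJet, hz.2]; ring
    · simp [heightJet]; ring
  · refine (hr.mul hi).congr_fderiv ?_
    -- Incompressibility makes the `q`-derivative of `h_p` equal to the `p`-derivative of `h_q`.
    have hinc := W.wave.incompressible _ _ (W.height_mem_open hz)
    have hinc' : onStream η ψ (partialX u) z = -onStream η ψ (partialY v) z := by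
      unfold onStream; linarith
    ext
    · simp only [heightJet, heightDq, heightDp, hinc']
      generalize (c - onStream η ψ u z)⁻¹ = i
      simp
      ring
    · simp [heightJet]; ring

end UnidirectionalWave

/-! ### Bernoulli's law and the height equation. -/

/-- Bernoulli's total head, constant along streamlines. -/
noncomputable def totalHead (g c : ℝ) (η : ℝ → ℝ) (u v ρ P ψ : ℝ → ℝ → ℝ) (z : ℝ × ℝ) : ℝ :=
  onStream η ψ P z + onStream η ψ ρ z * ((c - onStream η ψ u z) ^ 2 + onStream η ψ v z ^ 2) / 2
    + g * (onStream η ψ ρ z * streamHeight η ψ z)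

/-- Vertical derivative of the total head. -/
noncomputable def totalHeadDp (g c : ℝ) (η : ℝ → ℝ) (u v ρ P ψ : ℝ → ℝ → ℝ) (z : ℝ × ℝ) : ℝ :=
  heightDp c η u ρ ψ z *
      (onStream η ψ (partialY P) z + onStream η ψ (partialY ρ) z *
        ((c - onStream η ψ u z) ^ 2 + onStream η ψ v z ^ 2) / 2
        + onStream η ψ ρ z * (-(c - onStream η ψ u z) * onStream η ψ (partialY u) z
          + onStream η ψ v z * onStream η ψ (partialY v) z)
        + g * (onStream η ψ (partialY ρ) z * streamHeight η ψ z + onStream η ψ ρ z))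

namespace UnidirectionalWave

variable {g σ c Patm p₀ : ℝ} {η : ℝ → ℝ} {u v ρ P ψ : ℝ → ℝ → ℝ}

/-- The vanishing `q`-derivative is the momentum equation projected on the streamline direction `(u
- c, v)`, the density being constant along it. -/
lemma hasFDerivAt_totalHead (W : UnidirectionalWave g σ c Patm p₀ η u v ρ P ψ) {z : ℝ × ℝ}
    (hz : z.2 ∈ Ioo p₀ 0) :
    HasFDerivAt (totalHead g c η u v ρ P ψ) (planeForm 0 (totalHeadDp g c η u v ρ P ψ z)) z := by
  have hP := W.hasFDerivAt_onStream W.wave.pressure_contDiff hz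
  have hρ := W.hasFDerivAt_onStream W.wave.density_contDiff hz
  have hu := (W.hasFDerivAt_onStream W.wave.u_contDiff hz).const_sub c
  have hv := W.hasFDerivAt_onStream W.wave.v_contDiff hz
  have hh := W.hasFDerivAt_height hz
  have h := (hP.add ((hρ.mul ((hu.pow 2).add (hv.pow 2))).mul_const (1 / 2))).add
    ((hρ.mul hh).const_mul g)
  have h' : HasFDerivAt (totalHead g c η u v ρ P ψ) _ z := h.congr_of_eventuallyEq
    (Eventually.of_forall fun x => by simp only [totalHead, Pi.add_apply, Pi.mul_apply]; simp; ring)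
  refine h'.congr_fderiv ?_
  have hinc := W.wave.incompressible _ _ (W.height_mem_open hz)
  have hx := W.wave.momentum_x _ _ (W.height_mem_open hz)
  have hy := W.wave.momentum_y _ _ (W.height_mem_open hz)
  have hsp := W.speed_pos (z := z) ⟨hz.1.le, hz.2.le⟩
  have hd := W.onStream_density_dq hz
  ext
  · simp [hd]
    unfold heightDq
    unfold onStream at *
    have := hsp.ne'
    field_simp
    linear_combination (c - u z.1 (streamHeight η ψ z)) * hx - v z.1 (streamHeight η ψ z) * hy
  · simp [totalHeadDp]
    ring

lemma heightDp_pos (W : UnidirectionalWave g σ c Patm p₀ η u v ρ P ψ) {z : ℝ × ℝ}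
    (hz : z.2 ∈ Icc p₀ 0) : 0 < heightDp c η u ρ ψ z :=
  mul_pos (inv_pos.mpr (Real.sqrt_pos.mpr (W.onStream_density_pos hz)))
    (inv_pos.mpr (W.speed_pos hz))

/-- Vertical momentum eliminates `P_y` from the `p`-derivative of the head and incompressibility
eliminates `u_x`. What remains is an algebraic identity in the velocity, the density and their
derivatives. -/
lemma height_equation (W : UnidirectionalWave g σ c Patm p₀ η u v ρ P ψ) {z : ℝ × ℝ}
    (hz : z.2 ∈ Ioo p₀ 0) :
    (heightJet c η u v ρ ψ).ellip (heightDp c η u ρ ψ z) (-heightDq c η u v ψ z) z =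
      heightDp c η u ρ ψ z ^ 3 *
        (g * (onStream η ψ (partialY ρ) z * heightDp c η u ρ ψ z) * streamHeight η ψ z +
        -totalHeadDp g c η u v ρ P ψ z) := by
  have hinc := W.wave.incompressible _ _ (W.height_mem_open hz)
  have hy := W.wave.momentum_y _ _ (W.height_mem_open hz)
  have hsp := W.speed_pos (z := z) ⟨hz.1.le, hz.2.le⟩
  have hρ := W.onStream_density_pos (z := z) ⟨hz.1.le, hz.2.le⟩
  have hs := Real.sqrt_pos.mpr hρ
  have hsq := Real.sq_sqrt hρ.le
  have eu : u z.1 (streamHeight η ψ z) = onStream η ψ u z := rfl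
  have ev : v z.1 (streamHeight η ψ z) = onStream η ψ v z := rfl
  have eρ : ρ z.1 (streamHeight η ψ z) = onStream η ψ ρ z := rfl
  have eux : partialX u z.1 (streamHeight η ψ z) = onStream η ψ (partialX u) z := rfl
  have euy : partialY u z.1 (streamHeight η ψ z) = onStream η ψ (partialY u) z := rfl
  have evx : partialX v z.1 (streamHeight η ψ z) = onStream η ψ (partialX v) z := rfl
  have evy : partialY v z.1 (streamHeight η ψ z) = onStream η ψ (partialY v) z := rfl
  have ePy : partialY P z.1 (streamHeight η ψ z) = onStream η ψ (partialY P) z := rfl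
  rw [eux, evy] at hinc
  rw [eu, ev, eρ, evx, evy, ePy] at hy
  have hP : onStream η ψ (partialY P) z = -(g * onStream η ψ ρ z)
      - onStream η ψ ρ z * (onStream η ψ u z - c) * onStream η ψ (partialX v) z
      - onStream η ψ ρ z * onStream η ψ v z * onStream η ψ (partialY v) z := by linarith
  have hux : onStream η ψ (partialX u) z = -onStream η ψ (partialY v) z := by linarith
  simp only [PlaneJet.ellip, heightJet, hz.2, if_true, totalHeadDp, heightDq, heightDp, hP, hux]
  generalize onStream η ψ ρ z = R at *
  set r := Real.sqrt R with hr
  have hc : onStream η ψ u z = c - (c - onStream η ψ u z) := by ring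
  generalize c - onStream η ψ u z = w at *
  rw [hc]
  rw [← hsq]
  have := hsp.ne'
  have := hs.ne'
  field_simp
  ring

end UnidirectionalWave

/-! ### The height of a wave solves the boundary value problem. -/

/-- A function on the strip whose horizontal derivative vanishes is a function of `p` alone, and so
is its vertical derivative. -/
lemma horizontal_const {p₀ : ℝ} {F b : ℝ × ℝ → ℝ}
    (hF : ∀ z : ℝ × ℝ, z.2 ∈ Ioo p₀ 0 → HasFDerivAt F (planeForm 0 (b z)) z) (q : ℝ) {p : ℝ}
    (hp : p ∈ Ioo p₀ 0) : F (q, p) = F (0, p) ∧ b (q, p) = b (0, p) := by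
  have h1 : ∀ p ∈ Ioo p₀ 0, F (q, p) = F (0, p) := fun p hp =>
    is_const_of_deriv_eq_zero (f := fun q => F (q, p))
      (fun q => (hasDerivAt_horizontal (hF (q, p) hp)).differentiableAt)
      (fun q => (hasDerivAt_horizontal (hF (q, p) hp)).deriv) q 0
  refine ⟨h1 p hp, ?_⟩
  have h2 := hasDerivAt_vertical (hF (q, p) hp)
  have h3 := hasDerivAt_vertical (hF (0, p) hp)
  have h4 : (fun p => F (q, p)) =ᶠ[𝓝 p] fun p => F (0, p) := by
    filter_upwards [Ioo_mem_nhds hp.1 hp.2] with x hx using h1 x hx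
  exact (h2.congr_of_eventuallyEq h4.symm).unique h3

lemma eqOn_strip_of_continuousOn {p₀ : ℝ} (hp₀ : p₀ < 0) {F G : ℝ × ℝ → ℝ}
    (hF : ContinuousOn F {z | z.2 ∈ Icc p₀ 0}) (hG : ContinuousOn G {z | z.2 ∈ Icc p₀ 0})
    {q q' : ℝ} (h : ∀ p ∈ Ioo p₀ 0, F (q, p) = G (q', p)) {p : ℝ} (hp : p ∈ Icc p₀ 0) :
    F (q, p) = G (q', p) := by
  have c1 : ContinuousOn (fun p => F (q, p)) (Icc p₀ 0) :=
    hF.comp (f := fun p => (q, p)) (by fun_prop) fun p hp => hp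
  have c2 : ContinuousOn (fun p => G (q', p)) (Icc p₀ 0) :=
    hG.comp (f := fun p => (q', p)) (by fun_prop) fun p hp => hp
  exact EqOn.of_subset_closure (s := Ioo p₀ 0) h c1 c2 Ioo_subset_Icc_self
    (by rw [closure_Ioo hp₀.ne]) hp

namespace UnidirectionalWave

variable {g σ c Patm p₀ : ℝ} {η : ℝ → ℝ} {u v ρ P ψ : ℝ → ℝ → ℝ}

lemma continuousOn_inv_speed (W : UnidirectionalWave g σ c Patm p₀ η u v ρ P ψ) :
    ContinuousOn (fun z => (c - onStream η ψ u z)⁻¹) {z | z.2 ∈ Icc p₀ 0} :=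
  (continuousOn_const.sub (W.continuousOn_onStream W.wave.u_contDiff.continuousOn)).inv₀
    fun _ hz => (W.speed_pos hz).ne'

lemma continuousOn_heightDq (W : UnidirectionalWave g σ c Patm p₀ η u v ρ P ψ) :
    ContinuousOn (heightDq c η u v ψ) {z | z.2 ∈ Icc p₀ 0} :=
  ((W.continuousOn_onStream W.wave.v_contDiff.continuousOn).mul W.continuousOn_inv_speed).neg

lemma continuousOn_heightDp (W : UnidirectionalWave g σ c Patm p₀ η u v ρ P ψ) :
    ContinuousOn (heightDp c η u ρ ψ) {z | z.2 ∈ Icc p₀ 0} :=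
  ((W.continuousOn_onStream W.wave.density_contDiff.continuousOn).sqrt.inv₀ fun _ hz =>
    (Real.sqrt_pos.mpr (W.onStream_density_pos hz)).ne').mul W.continuousOn_inv_speed

lemma continuousOn_totalHead (W : UnidirectionalWave g σ c Patm p₀ η u v ρ P ψ) :
    ContinuousOn (totalHead g c η u v ρ P ψ) {z | z.2 ∈ Icc p₀ 0} := by
  have hu := W.continuousOn_onStream W.wave.u_contDiff.continuousOn
  have hv := W.continuousOn_onStream W.wave.v_contDiff.continuousOn
  have hρ := W.continuousOn_onStream W.wave.density_contDiff.continuousOn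
  have hP := W.continuousOn_onStream W.wave.pressure_contDiff.continuousOn
  exact (hP.add ((hρ.mul (((continuousOn_const.sub hu).pow 2).add (hv.pow 2))).div_const 2)).add
    (continuousOn_const.mul (hρ.mul W.continuous_height.continuousOn))

lemma totalHead_eq (W : UnidirectionalWave g σ c Patm p₀ η u v ρ P ψ) (q : ℝ) {p : ℝ}
    (hp : p ∈ Icc p₀ 0) : totalHead g c η u v ρ P ψ (q, p) = totalHead g c η u v ρ P ψ (0, p) :=
  eqOn_strip_of_continuousOn W.p₀_neg W.continuousOn_totalHead W.continuousOn_totalHead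
    (fun _ hp => (horizontal_const (fun _ hz => W.hasFDerivAt_totalHead hz) q hp).1) hp

lemma hasFDerivAt_density (W : UnidirectionalWave g σ c Patm p₀ η u v ρ P ψ) {z : ℝ × ℝ}
    (hz : z.2 ∈ Ioo p₀ 0) :
    HasFDerivAt (onStream η ψ ρ) (planeForm 0
      (onStream η ψ (partialY ρ) z * heightDp c η u ρ ψ z)) z := by
  have h := W.hasFDerivAt_onStream W.wave.density_contDiff hz
  rwa [W.onStream_density_dq hz] at h

lemma density_eq (W : UnidirectionalWave g σ c Patm p₀ η u v ρ P ψ) (q : ℝ) {p : ℝ}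
    (hp : p ∈ Icc p₀ 0) : onStream η ψ ρ (q, p) = onStream η ψ ρ (0, p) :=
  have hc := W.continuousOn_onStream W.wave.density_contDiff.continuousOn
  eqOn_strip_of_continuousOn W.p₀_neg hc hc
    (fun _ hp => (horizontal_const (fun _ hz => W.hasFDerivAt_density hz) q hp).1) hp

lemma heightDq_surface (W : UnidirectionalWave g σ c Patm p₀ η u v ρ P ψ) (q : ℝ) :
    heightDq c η u v ψ (q, 0) = deriv η q := by
  have h0 := W.speed_pos (z := (q, 0)) ⟨W.p₀_neg.le, le_refl 0⟩
  have h := W.wave.kinematic q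
  unfold heightDq
  unfold onStream at *
  rw [W.height_surface] at *
  have := h0.ne'
  field_simp
  linarith

lemma contDiff_deriv_surface (W : UnidirectionalWave g σ c Patm p₀ η u v ρ P ψ) :
    ContDiff ℝ 1 (deriv η) := by
  have h : ContDiff ℝ (1 + 1) η := by
    rw [one_add_one_eq_two]; exact W.wave.surface_contDiff
  exact (contDiff_succ_iff_deriv.mp h).2.2

lemma bounds (W : UnidirectionalWave g σ c Patm p₀ η u v ρ P ψ) :
    BddAbsOn {z | z.2 ∈ Icc p₀ 0} (heightDq c η u v ψ) ∧
    BddAbsOn {z | z.2 ∈ Icc p₀ 0} (heightDp c η u ρ ψ) ∧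
    BddAbsOn {z | z.2 ∈ Icc p₀ 0} (fun z => (heightDp c η u ρ ψ z)⁻¹) ∧
    BddAbsOn {z | z.2 ∈ Ioc p₀ 0} (heightJet c η u v ρ ψ).dqq ∧
    BddAbsOn {z | z.2 ∈ Ioo p₀ 0} (heightJet c η u v ρ ψ).dqp ∧
    BddAbsOn {z | z.2 ∈ Ioo p₀ 0} (heightJet c η u v ρ ψ).dpp ∧
    BddAbsOn {z | z.2 ∈ Ioo p₀ 0}
      (fun z => onStream η ψ (partialY ρ) z * heightDp c η u ρ ψ z) := by
  have hsub : {z : ℝ × ℝ | z.2 ∈ Ioo p₀ 0} ⊆ {z | z.2 ∈ Icc p₀ 0} := fun z hz =>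
    ⟨hz.1.le, hz.2.le⟩
  have bv : BddAbsOn {z | z.2 ∈ Icc p₀ 0} (onStream η ψ v) :=
    W.bddAbsOn_onStream W.wave.v_contDiff.continuousOn W.wave.v_periodic
  have bi : BddAbsOn {z | z.2 ∈ Icc p₀ 0} (fun z => (c - onStream η ψ u z)⁻¹) :=
    W.bddAbsOn_onStream (f := fun x y => (c - u x y)⁻¹)
      ((continuousOn_const.sub W.wave.u_contDiff.continuousOn).inv₀ fun z hz =>
        (sub_pos.mpr (W.noStag z.1 z.2 hz)).ne')
      (fun x y hxy => by simp only [W.wave.u_periodic x y hxy])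
  have br : BddAbsOn {z | z.2 ∈ Icc p₀ 0} (fun z => (Real.sqrt (onStream η ψ ρ z))⁻¹) :=
    W.bddAbsOn_onStream (f := fun x y => (Real.sqrt (ρ x y))⁻¹)
      (W.wave.density_contDiff.continuousOn.sqrt.inv₀ fun z hz =>
        (Real.sqrt_pos.mpr (W.wave.density_pos z.1 z.2 hz)).ne')
      (fun x y hxy => by simp only [W.wave.density_periodic x y hxy])
  have bpi : BddAbsOn {z | z.2 ∈ Icc p₀ 0} (fun z => (heightDp c η u ρ ψ z)⁻¹) := by
    have := W.bddAbsOn_onStream (f := fun x y => Real.sqrt (ρ x y) * (c - u x y))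
      (W.wave.density_contDiff.continuousOn.sqrt.mul
        (continuousOn_const.sub W.wave.u_contDiff.continuousOn))
      (fun x y hxy => by
        simp only [W.wave.density_periodic x y hxy, W.wave.u_periodic x y hxy])
    refine this.congr fun z _ => ?_
    unfold heightDp onStream
    rw [mul_inv, inv_inv, inv_inv]
  have bq : BddAbsOn {z | z.2 ∈ Icc p₀ 0} (heightDq c η u v ψ) := (bv.mul bi).neg
  have bp : BddAbsOn {z | z.2 ∈ Icc p₀ 0} (heightDp c η u ρ ψ) := br.mul bi
  obtain ⟨bux, buy⟩ := W.bddAbsOn_onStream_partial W.wave.u_contDiff W.wave.u_periodic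
  obtain ⟨bvx, bvy⟩ := W.bddAbsOn_onStream_partial W.wave.v_contDiff W.wave.v_periodic
  obtain ⟨-, bρy⟩ := W.bddAbsOn_onStream_partial W.wave.density_contDiff W.wave.density_periodic
  have bv' := bv.mono hsub
  have bi' := bi.mono hsub
  have bi2 : BddAbsOn {z | z.2 ∈ Ioo p₀ 0} (fun z => (c - onStream η ψ u z)⁻¹ ^ 2) :=
    (bi'.mul bi').congr fun z _ => pow_two _
  have br' := br.mono hsub
  have br3 : BddAbsOn {z | z.2 ∈ Ioo p₀ 0}
      (fun z => 1 / 2 * (Real.sqrt (onStream η ψ ρ z))⁻¹ ^ 3) :=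
    (((br'.mul br').mul br').const_mul (1 / 2)).congr fun z _ => by ring
  have bq' := bq.mono hsub
  have bp' := bp.mono hsub
  refine ⟨bq, bp, bpi, ?_, ((bvy.mul bp').mul bi' |>.add (bv'.mul (bi2.mul (buy.mul bp')))).neg,
    ((br3.mul (bρy.mul bp')).neg.mul bi').add (br'.mul (bi2.mul (buy.mul bp'))), bρy.mul bp'⟩
  obtain ⟨C, hC⟩ := (((bvx.add (bvy.mul bq')).mul bi').add
    (bv'.mul (bi2.mul (bux.add (buy.mul bq'))))).neg
  have h2 : Continuous (deriv (deriv η)) := by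
    exact W.contDiff_deriv_surface.continuous_deriv (le_refl _)
  have hper1 : Function.Periodic (deriv η) (2 * Real.pi) := fun x => by
    have h3 : (fun x => η (x + 2 * Real.pi)) = η := funext W.wave.surface_periodic
    have h4 := deriv_comp_add_const η (2 * Real.pi) x
    rw [h3] at h4
    exact h4.symm
  have hper2 : Function.Periodic (deriv (deriv η)) (2 * Real.pi) := fun x => by
    have h3 : (fun x => deriv η (x + 2 * Real.pi)) = deriv η := funext hper1
    have h4 := deriv_comp_add_const (deriv η) (2 * Real.pi) x
    rw [h3] at h4
    exact h4.symm
  obtain ⟨D, hD⟩ := (isCompact_Icc (a := -Real.pi)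
    (b := -Real.pi + 2 * Real.pi)).exists_bound_of_continuousOn h2.continuousOn
  refine ⟨max C D, fun z hz => ?_⟩
  rcases lt_or_eq_of_le hz.2 with h | h
  · refine le_trans ?_ ((hC z ⟨hz.1, h⟩).trans (le_max_left _ _))
    simp only [heightJet, h, if_true]
    exact le_refl _
  · obtain ⟨y, hy, hzy⟩ := hper2.exists_mem_Ico Real.two_pi_pos z.1 (-Real.pi)
    have := hD y ⟨hy.1, hy.2.le⟩
    refine le_trans ?_ (this.trans (le_max_right _ _))
    simp only [heightJet, h, lt_irrefl, if_false]
    rw [hzy, Real.norm_eq_abs]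

/-- The height function of a wave solves the height equation. -/
lemma exists_heightSystem (W : UnidirectionalWave g σ c Patm p₀ η u v ρ P ψ) :
    ∃ m M k E A B, 0 < m ∧ HeightSystem p₀ m M k σ E A B (heightJet c η u v ρ ψ) := by
  obtain ⟨⟨C1, h1⟩, ⟨C2, h2⟩, ⟨C3, h3⟩, ⟨C4, h4⟩, ⟨C5, h5⟩, ⟨C6, h6⟩, C7, h7⟩ := W.bounds
  have hp₀ := W.p₀_neg
  have hsub : ∀ {z : ℝ × ℝ}, z.2 ∈ Ioc p₀ 0 → z.2 ∈ Icc p₀ 0 := fun hz => ⟨hz.1.le, hz.2⟩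
  have ht : ∀ q : ℝ, (q, (0 : ℝ)).2 ∈ Icc p₀ 0 := fun q => ⟨hp₀.le, le_refl 0⟩
  obtain ⟨M, m1, m2, m4, m5, m6, m7⟩ : ∃ M, C1 ≤ M ∧ C2 ≤ M ∧ C4 ≤ M ∧ C5 ≤ M ∧ C6 ≤ M ∧
      |g| * C7 ≤ M := by
    refine ⟨max C1 (max C2 (max C4 (max C5 (max C6 (|g| * C7))))), ?_⟩
    simp
  have hC3 : 0 < C3 := by
    refine lt_of_lt_of_le ?_ (h3 (0, 0) (ht 0))
    exact abs_pos.mpr (inv_ne_zero (W.heightDp_pos (ht 0)).ne')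
  -- `C3` bounds `1 / h_p`. Surface density and surface head are constants, and `A = g ρ_p` and `B`,
  -- minus the derivative of the head, depend on `p` alone, so all may be read off at `q = 0`.
  refine ⟨C3⁻¹, M, g * onStream η ψ ρ (0, 0), totalHead g c η u v ρ P ψ (0, 0) - Patm,
    fun p => g * (onStream η ψ (partialY ρ) (0, p) * heightDp c η u ρ ψ (0, p)),
    fun p => -totalHeadDp g c η u v ρ P ψ (0, p), inv_pos.mpr hC3, ?_⟩
  exact
  { valid := fun z hz => W.heightJet_validAt hz
    cont := W.continuous_height.continuousOn
    periodic := fun q p hp => W.height_periodic q p hp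
    bed := W.height_bed
    dq_bound := fun z hz => (h1 z (hsub hz)).trans m1
    dp_lower := fun z hz => by
      have hpos := W.heightDp_pos (hsub hz)
      have := h3 z (hsub hz)
      rw [abs_of_pos (inv_pos.mpr hpos)] at this
      exact (inv_le_comm₀ hpos hC3).mp this
    dp_upper := fun z hz => (le_abs_self _).trans ((h2 z (hsub hz)).trans m2)
    dqq_bound := fun z hz => (h4 z hz).trans m4
    dqp_bound := fun z hz => (h5 z hz).trans m5
    dpp_bound := fun z hz => (h6 z hz).trans m6
    coeff_bound := fun p hp => by
      rw [abs_mul]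
      exact (mul_le_mul_of_nonneg_left (h7 (0, p) hp) (abs_nonneg g)).trans m7
    eqn := fun z hz => by
      have e1 := (horizontal_const (fun _ hz => W.hasFDerivAt_density hz) z.1 hz).2
      have e2 := (horizontal_const (fun _ hz => W.hasFDerivAt_totalHead hz) z.1 hz).2
      refine (W.height_equation hz).trans ?_
      rw [← e1, ← e2]
      rfl
    top_dq := fun q => by
      have h : (fun q => streamHeight η ψ (q, 0)) = η := funext W.height_surface
      simp only [heightJet]
      rw [h, W.heightDq_surface]
      exact (W.wave.surface_contDiff.differentiable (by norm_num) q).hasDerivAt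
    top_dqq := fun q => by
      have h : (fun q => heightDq c η u v ψ (q, 0)) = deriv η := funext W.heightDq_surface
      simp only [heightJet, lt_irrefl, if_false]
      rw [h]
      exact (W.contDiff_deriv_surface.differentiable (by norm_num) q).hasDerivAt
    top_dp := fun q => by
      have hd : ∀ p ∈ Ioo p₀ 0, HasDerivAt (fun p => streamHeight η ψ (q, p))
          (heightDp c η u ρ ψ (q, p)) p := fun p hp =>
        hasDerivAt_vertical (W.hasFDerivAt_height (z := (q, p)) hp)
      have hmem : Ioo p₀ 0 ∈ 𝓝[<] (0 : ℝ) := Ioo_mem_nhdsLT hp₀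
      -- At the top only a one-sided derivative is available; it is the limit of the interior values
      -- of `h_p`, which is continuous up to `p = 0`.
      refine hasDerivWithinAt_Iic_of_tendsto_deriv (s := Ioo p₀ 0)
        (fun p hp => (hd p hp).differentiableAt.differentiableWithinAt)
        (W.continuous_height.comp (by fun_prop)).continuousWithinAt hmem ?_
      have hc : ContinuousWithinAt (fun p => heightDp c η u ρ ψ (q, p)) (Icc p₀ 0) 0 :=
        W.continuousOn_heightDp.comp (f := fun p => (q, p)) (by fun_prop) (fun p hp => hp) 0
          ⟨hp₀.le, le_refl 0⟩
      have hc' : Tendsto (fun p => heightDp c η u ρ ψ (q, p)) (𝓝[<] 0)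
          (𝓝 (heightDp c η u ρ ψ (q, 0))) :=
        hc.tendsto.mono_left (nhdsWithin_le_iff.mpr
          (mem_of_superset hmem Ioo_subset_Icc_self))
      refine hc'.congr' ?_
      filter_upwards [hmem] with p hp using (hd p hp).deriv.symm
    top_cond := fun q => by
      have hH := W.totalHead_eq q (ht q)
      have hρe := W.density_eq q (ht q)
      have hdyn := W.wave.dynamic q
      have hsp := W.speed_pos (ht q)
      have hρ := W.onStream_density_pos (ht q)
      have hPs : onStream η ψ P (q, 0) = P q (η q) := by
        unfold onStream; rw [W.height_surface]
      have hkin : (1 + heightDq c η u v ψ (q, 0) ^ 2) / (2 * heightDp c η u ρ ψ (q, 0) ^ 2) =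
          onStream η ψ ρ (q, 0) *
            ((c - onStream η ψ u (q, 0)) ^ 2 + onStream η ψ v (q, 0) ^ 2) / 2 := by
        have hs := Real.sqrt_pos.mpr hρ
        have hsq := Real.sq_sqrt hρ.le
        unfold heightDq heightDp
        have := hsp.ne'
        have := hs.ne'
        field_simp
        rw [hsq]
      simp only [heightJet, lt_irrefl, if_false]
      rw [hkin, ← hρe, ← hH, W.heightDq_surface, W.height_surface]
      unfold totalHead
      rw [hPs, hdyn, W.height_surface]
      unfold curvatureFactor
      ring }

end UnidirectionalWave

/-! ### Back to the physical variables. -/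

namespace UnidirectionalWave

variable {g σ c Patm p₀ xc : ℝ} {η : ℝ → ℝ} {u v ρ P ψ : ℝ → ℝ → ℝ}

lemma mem_streamline (W : UnidirectionalWave g σ c Patm p₀ η u v ρ P ψ) {p : ℝ}
    (hp : p ∈ Icc p₀ 0) (q : ℝ) : (q, streamHeight η ψ (q, p)) ∈ streamline η ψ p :=
  ⟨W.height_mem (z := (q, p)) hp, W.stream_height (z := (q, p)) hp⟩

lemma crestedProfile (W : UnidirectionalWave g σ c Patm p₀ η u v ρ P ψ)
    (hxc : xc ∈ Ioo (-Real.pi) Real.pi) (hmono : StreamlinesMonotone η ψ p₀ xc)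
    (hstrict : StreamlinesStrictNearTrough η ψ p₀) :
    CrestedProfile p₀ xc fun q p => (heightJet c η u v ρ ψ).val (q, p) where
  crest := hxc
  rises p hp a b h1 h2 h3 :=
    (hmono p hp).1 _ (W.mem_streamline hp a) _ (W.mem_streamline hp b) h1 h2 h3
  falls p hp a b h1 h2 h3 :=
    (hmono p hp).2 _ (W.mem_streamline hp a) _ (W.mem_streamline hp b) h1 h2 h3
  strict p hp := by
    obtain ⟨δ, hδ, hl, hr⟩ := hstrict p hp
    have hp' : p ∈ Icc p₀ 0 := ⟨hp.1.le, hp.2⟩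
    exact ⟨δ, hδ,
      fun a b h1 h2 h3 => hl _ (W.mem_streamline hp' a) _ (W.mem_streamline hp' b) h1 h2 h3,
      fun a b h1 h2 h3 => hr _ (W.mem_streamline hp' a) _ (W.mem_streamline hp' b) h1 h2 h3⟩
  periodic q p hp := W.height_periodic q p hp

/-- If the height function is even then so is the whole flow. -/
lemma isSymmetricAbout_zero (W : UnidirectionalWave g σ c Patm p₀ η u v ρ P ψ)
    (heven : ∀ q, ∀ p ∈ Icc p₀ 0, streamHeight η ψ (-q, p) = streamHeight η ψ (q, p)) :
    IsSymmetricAbout 0 η u v ρ P ψ := by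
  have hp₀ := W.p₀_neg
  have hη : ∀ x, η (-x) = η x := fun x => by
    rw [← W.height_surface, ← W.height_surface]
    exact heven x 0 ⟨hp₀.le, le_refl 0⟩
  have hder : ∀ q, ∀ p ∈ Ioo p₀ 0, -heightDq c η u v ψ (-q, p) = heightDq c η u v ψ (q, p) ∧
      heightDp c η u ρ ψ (-q, p) = heightDp c η u ρ ψ (q, p) := fun q p hp => by
    have h1 := PlaneJet.hasFDerivAt_comp_reflect (z := (q, p))
      (W.hasFDerivAt_height (z := (-q, p)) hp)
    have h2 := W.hasFDerivAt_height (z := (q, p)) hp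
    have h3 : (fun z : ℝ × ℝ => streamHeight η ψ (-z.1, z.2)) =ᶠ[𝓝 (q, p)] streamHeight η ψ := by
      filter_upwards [(isOpen_Ioo.preimage continuous_snd).mem_nhds hp] with z hz
      exact heven z.1 z.2 ⟨hz.1.le, hz.2.le⟩
    exact planeForm_inj ((h1.congr_of_eventuallyEq h3.symm).unique h2)
  have hq : ∀ q, ∀ p ∈ Icc p₀ 0, heightDq c η u v ψ (-q, p) = -heightDq c η u v ψ (q, p) :=
    fun q p hp => eqOn_strip_of_continuousOn hp₀ W.continuousOn_heightDq
      W.continuousOn_heightDq.neg (G := fun z => -heightDq c η u v ψ z)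
      (fun p hp => by rw [← (hder q p hp).1, neg_neg]) hp
  have hp : ∀ q, ∀ p ∈ Icc p₀ 0, heightDp c η u ρ ψ (-q, p) = heightDp c η u ρ ψ (q, p) :=
    fun q p hp => eqOn_strip_of_continuousOn hp₀ W.continuousOn_heightDp
      W.continuousOn_heightDp (fun p hp => (hder q p hp).2) hp
  have hden : ∀ q, ∀ p ∈ Icc p₀ 0, onStream η ψ ρ (-q, p) = onStream η ψ ρ (q, p) :=
    fun q p hp => by rw [W.density_eq _ hp, W.density_eq q hp]
  -- Inverts `h_p = 1 / (√ρ (c - u))` for `u`; next `h_q = -v / (c - u)` gives `v`, and the head, a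
  -- function of `p` alone, gives `P`.
  have hu : ∀ q, ∀ p ∈ Icc p₀ 0, onStream η ψ u (-q, p) = onStream η ψ u (q, p) :=
    fun q p hpp => by
      have h := hp q p hpp
      have hs := Real.sqrt_pos.mpr (W.onStream_density_pos (z := (q, p)) hpp)
      unfold heightDp at h
      rw [hden q p hpp] at h
      have h2 := inv_injective (mul_left_cancel₀ (inv_ne_zero hs.ne') h)
      linarith
  have hv : ∀ q, ∀ p ∈ Icc p₀ 0, onStream η ψ v (-q, p) = -onStream η ψ v (q, p) :=
    fun q p hpp => by
      have h := hq q p hpp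
      have hs := W.speed_pos (z := (q, p)) hpp
      unfold heightDq at h
      rw [hu q p hpp, ← neg_mul] at h
      rw [← neg_mul] at h
      have h2 := mul_right_cancel₀ (inv_ne_zero hs.ne') (h.trans (neg_mul _ _).symm)
      linarith
  have hP : ∀ q, ∀ p ∈ Icc p₀ 0, onStream η ψ P (-q, p) = onStream η ψ P (q, p) :=
    fun q p hpp => by
      have h := (W.totalHead_eq (-q) hpp).trans (W.totalHead_eq q hpp).symm
      unfold totalHead at h
      rw [hden q p hpp, hu q p hpp, hv q p hpp, heven q p hpp] at h
      linarith
  have hval : ∀ (f : ℝ → ℝ → ℝ) {x y : ℝ}, (x, y) ∈ closedFluid η →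
      onStream η ψ f (x, -ψ x y) = f x y ∧ onStream η ψ f (-x, -ψ x y) = f (-x) y :=
    fun f x y hxy => by
      have h := W.height_stream hxy
      unfold onStream
      rw [heven x _ (W.stream_mem hxy), h]
      exact ⟨rfl, rfl⟩
  have hneg : ∀ x : ℝ, 2 * 0 - x = -x := fun x => by ring
  refine ⟨fun x => ?_, fun x y hxy => ?_, fun x y hxy => ?_, fun x y hxy => ?_,
    fun x y hxy => ?_, fun x y hxy => ?_⟩
  · rw [hneg, hη]
  · rw [hneg, ← (hval u hxy).1, ← (hval u hxy).2, hu x _ (W.stream_mem hxy)]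
  · rw [hneg, ← (hval v hxy).1, ← (hval v hxy).2, hv x _ (W.stream_mem hxy)]
  · rw [hneg, ← (hval ρ hxy).1, ← (hval ρ hxy).2, hden x _ (W.stream_mem hxy)]
  · rw [hneg, ← (hval P hxy).1, ← (hval P hxy).2, hP x _ (W.stream_mem hxy)]
  · have h := W.stream_height (z := (-x, -ψ x y)) (W.stream_mem hxy)
    rw [heven x _ (W.stream_mem hxy), W.height_stream hxy] at h
    rw [hneg]
    linarith

end UnidirectionalWave

/-- Symmetry of steady stratified waves whose streamlines are monotone between trough and crest.
The reflection argument only uses that the streamline density is differentiable, so neither `hanti`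
nor the sign of `g` enters. -/
theorem theorem3p1
    (g σ c Patm p₀ xc : ℝ) (η : ℝ → ℝ) (u v ρ P ψ : ℝ → ℝ → ℝ) (rhoS : ℝ → ℝ)
    (hg : 0 < g) (hσ : σ ≤ 0)
    (hwave : IsSteadyStratifiedWave g σ c Patm η u v ρ P)
    (hψ : IsPseudoStreamFunction c η u v ρ ψ p₀)
    -- no stagnation points, that is, `ψ_y < 0`
    (hstag : ∀ x y, (x, y) ∈ closedFluid η → u x y < c)
    -- `rhoS` is the streamline density function, and it is nonincreasing
    (hrho : ∀ x y, (x, y) ∈ closedFluid η → ρ x y = rhoS (-ψ x y))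
    (hanti : AntitoneOn rhoS (Set.Icc p₀ 0))
    (hxc : xc ∈ Set.Ioo (-Real.pi) Real.pi)
    (hmono : StreamlinesMonotone η ψ p₀ xc)
    (hstrict : StreamlinesStrictNearTrough η ψ p₀) :
    xc = 0 ∧ IsSymmetricAbout xc η u v ρ P ψ := by
  have W : UnidirectionalWave g σ c Patm p₀ η u v ρ P ψ := ⟨hwave, hψ, hstag⟩
  obtain ⟨m, M, k, E, A, B, hm, H⟩ := W.exists_heightSystem
  obtain ⟨h0, heven⟩ := H.even_and_crest_eq_zero hm W.p₀_neg hσ (W.crestedProfile hxc hmono hstrict)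
  subst h0
  exact ⟨rfl, W.isSymmetricAbout_zero heven⟩
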